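/- **Setting.** There are $N$ agents. Agent $i$ has a closed convex action set $\mathcal X_i\subseteq\mathbb R^{d_i}$ ($d_i\ge 1$) of diameter at most $D_x$; put $\mathcal X=\prod_i\mathcal X_i$. Its cost is $J_i(x,\xi_i)$, $x=(x_i,x_{-i})\in\mathcal X$, where $\xi_i\in\Xi_i$ is a random variable with a fixed law and $J_i(x,\cdot)$ is measurable; its risk level is $\alpha_i\in(0,1]$. Let $F_i^x(y)=\mathbb P\{J_i(x,\xi_i)\le y\}$. The conditional value at risk of a distribution function $F$ is $\mathrm{CVaR}_\alpha[F]=\inf_{z\in\mathbb R}\{z+\frac1\alpha\int_z^\infty(1-F(y))\,dy\}$, i.e. $\inf_z\{z+\frac1\alpha\mathbb E[(Z-z)^+]\}$ for $Z\sim F$, and $C_i(x)=\mathrm{CVaR}_{\alpha_i}[F_i^x]$. Let $S(\alpha)=\sum_{i=1}^N\alpha_i^{-2}$. Norms are Euclidean. Assume, for all $i$: 1. $J_i(x_i,x_{-i},\xi_i)$ is convex in $x_i\in\mathcal X_i$ for all $x_{-i}$ and $\xi_i$, and $|J_i|\le U$ on $\mathcal X\times\Xi_i$; 2. $x\mapsto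 J_i(x,\xi_i)$ is $L_0$-Lipschitz on $\mathcal X$ for every $\xi_i$; 3. $\sup_y|F_i^w(y)-F_i^v(y)|\le C_0\|w-v\|$ for all $w,v\in\mathcal X$. **Algorithm.** Given $T$, $a\in(0,1)$ and $b>0$, let $n_t=\lceil bU^2(T-t+1)^a\rceil$, $\eta_i=\frac{D_x}{d_iL_0N}T^{-3a/4}$, $\delta=\frac{D_x}{N^{1/6}}T^{-a/4}$, $\beta=\frac1{U^2T^{a/4}}$ and $\mathcal X_i^\delta=\{x\in\mathcal X_i:\mathrm{dist}(x,\partial\mathcal X_i)\ge\delta\}$. Start from any $x_{i,1}\in\mathcal X_i^\delta$ (in particular $\mathcal X_i^\delta\neq\emptyset$) and any initial CVaR values $c_{i,0}\in[-U,U]$. In episode $t=1,\dots,T$ each agent draws $u_{i,t}$ uniformly from the unit sphere of $\mathbb R^{d_i}$ and plays $\hat x_{i,t}=x_{i,t}+\delta u_{i,t}$ in $n_t$ rounds; it observes the costs $J_i(\hat x_t,\xi_{i,t}^j)$, $j=1,\dots,n_t$, and forms $$\hat F_{i,t}(y)=\frac1{n_t}\sum_{j=1}^{n_t}\mathbf 1\{J_i(\hat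 x_t,\xi_{i,t}^j)\le y\},\qquad \bar F_{i,1}=\hat F_{i,1},\qquad \bar F_{i,t}=\beta\bar F_{i,t-1}+(1-\beta)\hat F_{i,t}\ (t\ge2),$$ $$c_{i,t}=\mathrm{CVaR}_{\alpha_i}[\bar F_{i,t}],\qquad \bar g_{i,t}=\frac{d_i}\delta\,(c_{i,t}-c_{i,t-1})\,u_{i,t},\qquad x_{i,t+1}=\mathcal P_{\mathcal X_i^\delta}(x_{i,t}-\eta_i\bar g_{i,t}),$$ where $\mathcal P$ is the Euclidean projection. (The formulas are applied also for the finitely many $T$ with $\beta\ge1$.) The directions $u_{i,t}$ are independent over $i$ and $t$; each $\xi_{i,t}^j$ has the law of $\xi_i$; the vectors $(\xi_{i,t}^j)_{i=1}^N$ are independent over $(t,j)$; directions and samples are independent of each other. The regret of agent $i$ is $$\mathrm R_{C_i}(T)=\sum_{t=1}^TC_i(\hat x_{i,t},\hat x_{-i,t})-\min_{\tilde x_i\in\mathcal X_i}\sum_{t=1}^TC_i(\tilde x_i,\hat x_{-i,t}).$$ **Theorem.** Let $a\in(0,1)$ and $b,U,C_0,\ell,\rho>0$. There is a constant $K>0$,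 depending only on $a,b,U,C_0,\ell,\rho$, such that the following holds for all $L_0\ge\ell$ and $D_x\ge\ell$, all $N$, and every game as above in which each $\mathcal X_i$ contains a closed ball of radius $D_x/\rho$. For every integer $T\ge(8N^{2/3})^{1/a}$, every $\gamma\in(0,1)$ and every run of the algorithm as above, with probability at least $1-\gamma$, simultaneously for all agents $i$, $$\mathrm R_{C_i}(T)\le K\,D_x\,d_i\,L_0\,N\,S(\alpha)\,\ln(T/\gamma)\,T^{1-a/4}.$$ -/

import Mathlib

open MeasureTheory ProbabilityTheory

noncomputable section

/-- The action space `ℝ^n` of one agent, with its Euclidean norm. -/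
abbrev Act (n : ℕ) : Type := EuclideanSpace ℝ (Fin n)

/-- The space of action profiles: concatenated vectors with the Euclidean norm. -/
abbrev Profile {N : ℕ} (d : Fin N → ℕ) : Type := PiLp 2 (fun i => Act (d i))

/-- The profile in which agent `i` plays `y` and all the others play as in `x`. -/
def replaceAction {N : ℕ} {d : Fin N → ℕ} (x : Profile d) (i : Fin N) (y : Act (d i)) :
    Profile d :=
  WithLp.toLp 2 (Function.update (fun k => x k) i y)

/-- Conditional value at risk at level `α` of a cost with distribution function `F`, by the
Rockafellar–Uryasev formula `inf_z (z + E[(Z - z)⁺] / α)`, where `E[(Z - z)⁺] = ∫_z^∞ (1 - F)`. -/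
def cvar (α : ℝ) (F : ℝ → ℝ) : ℝ :=
  ⨅ z : ℝ, (z + α⁻¹ * ∫ y in Set.Ioi z, (1 - F y))

/-- The points of `X` at distance at least `δ` from the boundary of `X`. -/
def shrink {n : ℕ} (X : Set (Act n)) (δ : ℝ) : Set (Act n) :=
  {x ∈ X | δ ≤ Metric.infDist x (frontier X)}

open Classical in
/-- Euclidean projection onto `S`: a nearest point of `S`
(it exists and is unique for `S` nonempty, closed and convex; the value `x` is a dummy otherwise). -/
def nearestPoint {n : ℕ} (S : Set (Act n)) (x : Act n) : Act n :=
  if h : ∃ p ∈ S, ∀ q ∈ S, dist x p ≤ dist x q then h.choose else x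

/-- The uniform probability distribution on the unit sphere of `ℝ^n` (for `n ≥ 1`). -/
def uniformSphere (n : ℕ) : Measure (Act n) :=
  (((volume : Measure (Act n)).toSphere Set.univ)⁻¹ • (volume : Measure (Act n)).toSphere).map
    Subtype.val

/-- The data of a game with `N` risk-averse agents: agent `i` chooses actions in
`X i ⊆ ℝ^(d i)`, has noise `ξ_i` in `Ξ i` with distribution `law i`, cost `J i x ξ_i`
and risk level `α i`. -/
structure RiskGame (N : ℕ) where
  d : Fin N → ℕ
  X : (i : Fin N) → Set (Act (d i))
  Ξ : Fin N → Type*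
  ms : (i : Fin N) → MeasurableSpace (Ξ i)
  law : (i : Fin N) → Measure (Ξ i)
  J : (i : Fin N) → Profile d → Ξ i → ℝ
  α : Fin N → ℝ

attribute [instance] RiskGame.ms

namespace RiskGame

variable {N : ℕ} (G : RiskGame N)

/-- The joint action space. -/
def joint : Set (Profile G.d) := {x | ∀ i, x i ∈ G.X i}

/-- The distribution function of the cost of agent `i` at the profile `x`. -/
def cdf (i : Fin N) (x : Profile G.d) (y : ℝ) : ℝ :=
  (G.law i).real {ξ | G.J i x ξ ≤ y}

/-- The risk-averse objective `C_i(x) = CVaR_{α_i}[J_i(x, ξ_i)]`. -/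
def C (i : Fin N) (x : Profile G.d) : ℝ := cvar (G.α i) (G.cdf i x)

/-- `S(α) = ∑_i 1 / α_i²`. -/
def S : ℝ := ∑ i, 1 / G.α i ^ 2

/-- Standing conventions: positive dimensions, risk levels in `(0, 1]`, closed convex action sets of
diameter at most `Dx`, random noise, and costs that are random variables. -/
structure Standing (Dx : ℝ) : Prop where
  dim_pos : ∀ i, 0 < G.d i
  level_pos : ∀ i, 0 < G.α i
  level_le_one : ∀ i, G.α i ≤ 1
  convex : ∀ i, Convex ℝ (G.X i)
  closed : ∀ i, IsClosed (G.X i)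
  diam_le : ∀ i, ∀ x ∈ G.X i, ∀ y ∈ G.X i, dist x y ≤ Dx
  law_prob : ∀ i, IsProbabilityMeasure (G.law i)
  measurable_cost : ∀ i, ∀ x ∈ G.joint, Measurable (G.J i x)

/-- Each cost is convex in the agent's own action and bounded by `U`. -/
def ConvexBounded (U : ℝ) : Prop :=
  ∀ i, ∀ ξ : G.Ξ i,
    (∀ x ∈ G.joint, ConvexOn ℝ (G.X i) (fun y => G.J i (replaceAction x i y) ξ)) ∧
    ∀ x ∈ G.joint, |G.J i x ξ| ≤ U

/-- Each cost is `L₀`-Lipschitz in the action profile. -/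
def LipschitzCost (L₀ : ℝ) : Prop :=
  ∀ i, ∀ ξ : G.Ξ i, ∀ x ∈ G.joint, ∀ y ∈ G.joint, |G.J i x ξ - G.J i y ξ| ≤ L₀ * ‖x - y‖

/-- The distribution functions of the costs are `C₀`-Lipschitz in the action profile, uniformly. -/
def LipschitzCDF (C₀ : ℝ) : Prop :=
  ∀ i, ∀ w ∈ G.joint, ∀ v ∈ G.joint, ∀ y : ℝ, |G.cdf i w y - G.cdf i v y| ≤ C₀ * ‖w - v‖

end RiskGame

/-- The number `n_t = ⌈b U² (T - t + 1)^a⌉` of samples in episode `t ∈ {1, …, T}`. -/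
def sampleSize (a b U : ℝ) (T t : ℕ) : ℕ := ⌈b * U ^ 2 * ((T : ℝ) - t + 1) ^ a⌉₊

/-- The parameters of the algorithm: sample sizes `n t`, step sizes `η i` of the agents, size `δ` of
the perturbation, momentum `β`. -/
structure Params (N : ℕ) where
  n : ℕ → ℕ
  η : Fin N → ℝ
  δ : ℝ
  β : ℝ

/-- The parameter choice `n_t = ⌈b U² (T - t + 1)^a⌉`, `η_i = D_x / (d_i L₀ N) T^(-3a/4)`,
`δ = D_x / N^(1/6) T^(-a/4)`, `β = 1 / (U² T^(a/4))`. -/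
def tunedParams {N : ℕ} (d : Fin N → ℕ) (a b U L₀ Dx : ℝ) (T : ℕ) : Params N where
  n := sampleSize a b U T
  η := fun i => Dx / ((d i : ℝ) * L₀ * N) * (T : ℝ) ^ (-(3 * a / 4))
  δ := Dx / (N : ℝ) ^ (1 / 6 : ℝ) * (T : ℝ) ^ (-(a / 4))
  β := 1 / (U ^ 2 * (T : ℝ) ^ (a / 4))

/-- What the agents carry from one episode to the next. After episode `t` these are the actions
`x_{i,t+1}`, the distribution estimates `F̄_{i,t}` and the CVaR estimates `CVaR_{α_i}[F̄_{i,t}]`. -/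
structure AlgState {N : ℕ} (d : Fin N → ℕ) where
  x : Profile d
  Fbar : Fin N → ℝ → ℝ
  est : Fin N → ℝ

namespace RiskGame

variable {N : ℕ} (G : RiskGame N) (p : Params N)

/-- The played profile `x̂ = x + δ u`. -/
def perturb (x : Profile G.d) (u : (i : Fin N) → Act (G.d i)) : Profile G.d :=
  WithLp.toLp 2 (fun i => x i + p.δ • u i)

/-- The empirical distribution function of the costs of agent `i` at the played profile `xhat`
from `n` samples. -/
def edf (i : Fin N) (n : ℕ) (xhat : Profile G.d) (ξ : ℕ → G.Ξ i) (y : ℝ) : ℝ :=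
  (1 / (n : ℝ)) * ∑ j ∈ Finset.range n, Set.indicator {c : ℝ | c ≤ y} 1 (G.J i xhat (ξ j))

/-- The distribution estimate of agent `i` in episode `t`: the empirical distribution function for
`t = 1`, and with the momentum term for `t ≥ 2`. -/
def momentumEdf (t : ℕ) (s : AlgState G.d) (u : (i : Fin N) → Act (G.d i))
    (ξ : (i : Fin N) → ℕ → G.Ξ i) (i : Fin N) (y : ℝ) : ℝ :=
  if t = 1 then G.edf i (p.n t) (G.perturb p s.x u) (ξ i) y
  else p.β * s.Fbar i y + (1 - p.β) * G.edf i (p.n t) (G.perturb p s.x u) (ξ i) y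

/-- The gradient estimate of agent `i` in episode `t`, with residual feedback. -/
def gradEstimate (t : ℕ) (s : AlgState G.d) (u : (i : Fin N) → Act (G.d i))
    (ξ : (i : Fin N) → ℕ → G.Ξ i) (i : Fin N) : Act (G.d i) :=
  ((G.d i : ℝ) / p.δ * (cvar (G.α i) (G.momentumEdf p t s u ξ i) - s.est i)) • u i

/-- Episode `t` of the algorithm, with directions `u i` and samples `ξ i j`. -/
def episode (t : ℕ) (s : AlgState G.d) (u : (i : Fin N) → Act (G.d i))
    (ξ : (i : Fin N) → ℕ → G.Ξ i) : AlgState G.d where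
  x := WithLp.toLp 2 (fun i =>
    nearestPoint (shrink (G.X i) p.δ) (s.x i - p.η i • G.gradEstimate p t s u ξ i))
  Fbar := G.momentumEdf p t s u ξ
  est := fun i => cvar (G.α i) (G.momentumEdf p t s u ξ i)

/-- The state after `t` episodes, from the initial actions `x₁` and the values `v₀ i` that stand for
`CVaR_{α_i}[F̄_{i,0}]`. The directions and samples of episode `t` are `u i t` and
`ξ i t 0, ξ i t 1, …`. The initial `Fbar` is a dummy: episode `1` does not use it. -/
def state (x₁ : Profile G.d) (v₀ : Fin N → ℝ) (u : (i : Fin N) → ℕ → Act (G.d i))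
    (ξ : (i : Fin N) → ℕ → ℕ → G.Ξ i) : ℕ → AlgState G.d
  | 0 => ⟨x₁, fun _ _ => 0, v₀⟩
  | t + 1 => G.episode p (t + 1) (state x₁ v₀ u ξ t) (fun i => u i (t + 1)) (fun i => ξ i (t + 1))

/-- The profile `x̂_t` played in episode `t ≥ 1`. -/
def played (x₁ : Profile G.d) (v₀ : Fin N → ℝ) (u : (i : Fin N) → ℕ → Act (G.d i))
    (ξ : (i : Fin N) → ℕ → ℕ → G.Ξ i) (t : ℕ) : Profile G.d :=
  G.perturb p (G.state p x₁ v₀ u ξ (t - 1)).x (fun i => u i t)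

/-- The regret of agent `i` over episodes `1, …, T` for the sequence `xhat` of played profiles. -/
def regret (i : Fin N) (T : ℕ) (xhat : ℕ → Profile G.d) : ℝ :=
  ∑ t ∈ Finset.Icc 1 T, G.C i (xhat t) -
    ⨅ y : G.X i, ∑ t ∈ Finset.Icc 1 T, G.C i (replaceAction (xhat t) i y)

/-- The randomness of the algorithm: the directions `u i t` are independent and uniform on the unit
spheres, the samples `ξ i t j` have the distribution of `ξ_i`, the noise vectors
`(ξ i t j)_i` are independent over `(t, j)` (the agents' components of one vector may be
dependent), and directions and samples are independent of each other. -/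
structure IsSampling {Ω : Type*} [MeasurableSpace Ω] (μ : Measure Ω)
    (u : (i : Fin N) → ℕ → Ω → Act (G.d i)) (ξ : (i : Fin N) → ℕ → ℕ → Ω → G.Ξ i) : Prop where
  measurable_dir : ∀ i t, Measurable (u i t)
  measurable_noise : ∀ i t j, Measurable (ξ i t j)
  law_dir : ∀ i t, μ.map (u i t) = uniformSphere (G.d i)
  law_noise : ∀ i t j, μ.map (ξ i t j) = G.law i
  indep_dir : iIndepFun (fun (k : Fin N × ℕ) ω => u k.1 k.2 ω) μ
  indep_noise : iIndepFun (fun (q : ℕ × ℕ) ω => (fun i => ξ i q.1 q.2 ω)) μ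
  indep_dir_noise : IndepFun (fun ω => (fun (k : Fin N × ℕ) => u k.1 k.2 ω))
    (fun ω => (fun (q : ℕ × ℕ) (i : Fin N) => ξ i q.1 q.2 ω)) μ

end RiskGame

end

/-!
Averaged over the direction `u`, the residual feedback `g_t = (d / δ) (c_t - c_{t-1}) u` is, up to
the error of the estimate `c_t`, the gradient of a smoothing of `C_i` over a ball of radius `δ`: the
previous value `c_{t-1}` does not depend on `u` and averages out. Projected gradient descent
therefore has a regret made of

* the optimization error `D² / η + η ∑ ‖g_t‖²`;
* the deviation of the estimates from their conditional means, a martingale. Since the best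
  response depends on the whole run, the deviation is first tested against a ghost descent driven by
  the noise itself, after which Azuma's inequality applies to a predictable integrand;
* the smoothing and shrinking error, of order `L₀ δ` per episode;
* the error of the estimated conditional values at risk. As the latter is `α⁻¹`-Lipschitz in the
  `L¹` distance of distribution functions, it suffices to follow that distance under
  `F̄_t = β F̄_{t-1} + (1 - β) F̂_t`: it contracts by `β` while each step adds the sampling error of
  order `U / √n_t` and the drift of the costs.

The step sizes balance these terms at `T ^ (1 - a / 4)`.
-/

noncomputable section

/-- `F` is the distribution function of a cost in `[-U, U]`. Monotonicity is left out, since the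
estimates for the conditional value at risk only involve the values of `F`. -/
structure IsCostCDF (U : ℝ) (F : ℝ → ℝ) : Prop where
  measurable : Measurable F
  nonneg : ∀ y, 0 ≤ F y
  le_one : ∀ y, F y ≤ 1
  eq_zero : ∀ y, y < -U → F y = 0
  eq_one : ∀ y, U ≤ y → F y = 1

namespace IsCostCDF

variable {U α : ℝ} {F F' : ℝ → ℝ}

lemma bound_nonneg (hF : IsCostCDF U F) : 0 ≤ U := by
  by_contra! hU
  linarith [hF.eq_zero U (by linarith), hF.eq_one U le_rfl]

lemma convexCombination (hF : IsCostCDF U F) (hF' : IsCostCDF U F') {β : ℝ} (h0 : 0 ≤ β)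
    (h1 : β ≤ 1) : IsCostCDF U fun y => β * F y + (1 - β) * F' y where
  measurable := (hF.measurable.const_mul _).add (hF'.measurable.const_mul _)
  nonneg y := add_nonneg (mul_nonneg h0 (hF.nonneg y))
    (mul_nonneg (sub_nonneg.2 h1) (hF'.nonneg y))
  le_one y := by
    have hβF := mul_le_mul_of_nonneg_left (hF.le_one y) h0
    have hβF' := mul_le_mul_of_nonneg_left (hF'.le_one y) (sub_nonneg.2 h1)
    linarith
  eq_zero y hy := by rw [hF.eq_zero y hy, hF'.eq_zero y hy]; ring
  eq_one y hy := by rw [hF.eq_one y hy, hF'.eq_one y hy]; ring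

lemma abs_sub_le_one (hF : IsCostCDF U F) (hF' : IsCostCDF U F') (y : ℝ) :
    |F y - F' y| ≤ 1 :=
  abs_sub_le_of_nonneg_of_le (hF.nonneg y) (hF.le_one y) (hF'.nonneg y) (hF'.le_one y)

lemma abs_sub_le_indicator (hF : IsCostCDF U F) (hF' : IsCostCDF U F') {c : ℝ}
    (hc : ∀ y, |F y - F' y| ≤ c) (y : ℝ) :
    |F y - F' y| ≤ (Set.Icc (-U) U).indicator (fun _ => c) y := by
  by_cases hy : y ∈ Set.Icc (-U) U
  · rw [Set.indicator_of_mem hy]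
    exact hc y
  · rw [Set.indicator_of_notMem hy]
    rcases lt_or_ge y (-U) with h | h
    · simp [hF.eq_zero y h, hF'.eq_zero y h]
    · have hUy : U ≤ y := (not_le.1 fun h' => hy ⟨h, h'⟩).le
      simp [hF.eq_one y hUy, hF'.eq_one y hUy]

lemma integrable_indicator_Icc (U c : ℝ) :
    Integrable ((Set.Icc (-U) U).indicator fun _ => c) :=
  (integrable_indicator_iff measurableSet_Icc).2 (integrableOn_const measure_Icc_lt_top.ne)

lemma integrable_sub (hF : IsCostCDF U F) (hF' : IsCostCDF U F') :
    Integrable fun y => F y - F' y :=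
  (integrable_indicator_Icc U 1).mono' (hF.measurable.sub hF'.measurable).aestronglyMeasurable
    (.of_forall (hF.abs_sub_le_indicator hF' (hF.abs_sub_le_one hF')))

lemma integral_abs_sub_le (hF : IsCostCDF U F) (hF' : IsCostCDF U F') {c : ℝ}
    (hc : ∀ y, |F y - F' y| ≤ c) : ∫ y, |F y - F' y| ≤ 2 * U * c := by
  calc ∫ y, |F y - F' y| ≤ ∫ y, (Set.Icc (-U) U).indicator (fun _ => c) y :=
        integral_mono (hF.integrable_sub hF').abs (integrable_indicator_Icc U c)
          (hF.abs_sub_le_indicator hF' hc)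
    _ = 2 * U * c := by
        rw [integral_indicator measurableSet_Icc, setIntegral_const, Real.volume_real_Icc,
          smul_eq_mul, max_eq_left (by linarith [hF.bound_nonneg])]
        ring

lemma integrableOn_one_sub (hF : IsCostCDF U F) (z : ℝ) :
    IntegrableOn (fun y => 1 - F y) (Set.Ioi z) := by
  have hIoc : IntegrableOn (fun y => 1 - F y) (Set.Ioc z U) :=
    Measure.integrableOn_of_bounded (M := 1) measure_Ioc_lt_top.ne
      (measurable_const.sub hF.measurable).aestronglyMeasurable (.of_forall fun y => by
        rw [Real.norm_of_nonneg (sub_nonneg.2 (hF.le_one y))]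
        linarith [hF.nonneg y])
  refine hIoc.of_forall_sdiff_eq_zero measurableSet_Ioi fun y hy => ?_
  rw [hF.eq_one y (not_le.1 fun h => hy.2 ⟨hy.1, h⟩).le, sub_self]

lemma integral_one_sub_nonneg (hF : IsCostCDF U F) (z : ℝ) :
    0 ≤ ∫ y in Set.Ioi z, (1 - F y) :=
  integral_nonneg fun y => sub_nonneg.2 (hF.le_one y)

lemma neg_sub_le_integral_one_sub (hF : IsCostCDF U F) (z : ℝ) :
    -U - z ≤ ∫ y in Set.Ioi z, (1 - F y) := by
  calc -U - z ≤ volume.real (Set.Ioo z (-U)) := by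
        rw [Real.volume_real_Ioo]; exact le_max_left _ _
    _ = ∫ y in Set.Ioo z (-U), (1 - F y) := by
        rw [setIntegral_congr_fun measurableSet_Ioo (g := fun _ => (1 : ℝ))
          fun y hy => by simp only [hF.eq_zero y hy.2, sub_zero]]
        simp
    _ ≤ ∫ y in Set.Ioi z, (1 - F y) :=
        setIntegral_mono_set (hF.integrableOn_one_sub z)
          (.of_forall fun y => sub_nonneg.2 (hF.le_one y)) Set.Ioo_subset_Ioi_self.eventuallyLE

lemma neg_le_cvar_objective (hF : IsCostCDF U F) (h0 : 0 < α) (h1 : α ≤ 1) (z : ℝ) :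
    -U ≤ z + α⁻¹ * ∫ y in Set.Ioi z, (1 - F y) := by
  have htail := hF.neg_sub_le_integral_one_sub z
  have hscale := le_mul_of_one_le_left (hF.integral_one_sub_nonneg z) ((one_le_inv₀ h0).2 h1)
  linarith

lemma bddBelow_cvar_objective (hF : IsCostCDF U F) (h0 : 0 < α) (h1 : α ≤ 1) :
    BddBelow (Set.range fun z : ℝ => z + α⁻¹ * ∫ y in Set.Ioi z, (1 - F y)) :=
  ⟨-U, by rintro _ ⟨z, rfl⟩; exact hF.neg_le_cvar_objective h0 h1 z⟩

lemma abs_cvar_le (hF : IsCostCDF U F) (h0 : 0 < α) (h1 : α ≤ 1) : |cvar α F| ≤ U := by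
  rw [abs_le]
  refine ⟨le_ciInf fun z => hF.neg_le_cvar_objective h0 h1 z,
    (ciInf_le (hF.bddBelow_cvar_objective h0 h1) U).trans_eq ?_⟩
  rw [setIntegral_congr_fun measurableSet_Ioi (g := fun _ => (0 : ℝ))
    fun y hy => by simp only [hF.eq_one y (le_of_lt hy), sub_self]]
  simp

lemma integral_one_sub_le_add (hF : IsCostCDF U F) (hF' : IsCostCDF U F') (z : ℝ) :
    ∫ y in Set.Ioi z, (1 - F y) ≤ (∫ y in Set.Ioi z, (1 - F' y)) + ∫ y, |F y - F' y| := by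
  have hF_int := hF.integrableOn_one_sub z
  have hF'_int := hF'.integrableOn_one_sub z
  have habs_int := (hF.integrable_sub hF').abs
  calc ∫ y in Set.Ioi z, (1 - F y)
      ≤ ∫ y in Set.Ioi z, ((1 - F' y) + |F y - F' y|) :=
        integral_mono hF_int (hF'_int.add habs_int.integrableOn) fun y => by
          linarith [neg_abs_le (F y - F' y)]
    _ = (∫ y in Set.Ioi z, (1 - F' y)) + ∫ y in Set.Ioi z, |F y - F' y| :=
        integral_add hF'_int habs_int.integrableOn
    _ ≤ _ := add_le_add le_rfl
        (setIntegral_le_integral habs_int (.of_forall fun y => abs_nonneg _))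

lemma cvar_le_cvar_add (hF : IsCostCDF U F) (hF' : IsCostCDF U F') (h0 : 0 < α) (h1 : α ≤ 1) :
    cvar α F ≤ cvar α F' + α⁻¹ * ∫ y, |F y - F' y| := by
  rw [← sub_le_iff_le_add]
  refine le_ciInf fun z => ?_
  rw [sub_le_iff_le_add]
  refine (ciInf_le (hF.bddBelow_cvar_objective h0 h1) z).trans ?_
  rw [add_assoc, ← mul_add]
  gcongr
  exact hF.integral_one_sub_le_add hF' z

lemma abs_cvar_sub_cvar_le (hF : IsCostCDF U F) (hF' : IsCostCDF U F') (h0 : 0 < α)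
    (h1 : α ≤ 1) : |cvar α F - cvar α F'| ≤ α⁻¹ * ∫ y, |F y - F' y| := by
  have hle := hF.cvar_le_cvar_add hF' h0 h1
  have hge := hF'.cvar_le_cvar_add hF h0 h1
  simp_rw [abs_sub_comm (F' _) (F _)] at hge
  exact abs_sub_le_iff.2 ⟨by linarith, by linarith⟩

lemma of_abs_le {Ξ : Type*} [MeasurableSpace Ξ] {P : Measure Ξ} [IsProbabilityMeasure P]
    {Z : Ξ → ℝ} (hZ : ∀ ξ, |Z ξ| ≤ U) : IsCostCDF U fun y => P.real {ξ | Z ξ ≤ y} where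
  measurable := Monotone.measurable fun _ _ hab => measureReal_mono fun _ hξ => le_trans hξ hab
  nonneg _ := measureReal_nonneg
  le_one _ := measureReal_le_one
  eq_zero y hy := by
    have hempty : {ξ | Z ξ ≤ y} = ∅ :=
      Set.eq_empty_of_forall_notMem fun ξ hξ => (hξ.trans_lt hy).not_ge (abs_le.1 (hZ ξ)).1
    rw [hempty, measureReal_empty]
  eq_one y hy := by
    have huniv : {ξ | Z ξ ≤ y} = Set.univ :=
      Set.eq_univ_of_forall fun ξ => (abs_le.1 (hZ ξ)).2.trans hy
    rw [huniv, probReal_univ]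

end IsCostCDF

section RandomVariable

variable {Ξ : Type*} [MeasurableSpace Ξ] {P : Measure Ξ} {α : ℝ} {Z Z₁ Z₂ : Ξ → ℝ}

/-- The conditional value at risk at level `α` of the random variable `Z` under `P`. -/
def cvarOf (P : Measure Ξ) (α : ℝ) (Z : Ξ → ℝ) : ℝ := cvar α fun y => P.real {ξ | Z ξ ≤ y}

variable [IsProbabilityMeasure P]

lemma integrable_posPart_sub (hZ : Integrable Z P) (z : ℝ) :
    Integrable (fun ξ => max (Z ξ - z) 0) P :=
  (hZ.sub (integrable_const z)).pos_part

lemma integral_one_sub_measureReal_le (hZ : Integrable Z P) (z : ℝ) :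
    ∫ y in Set.Ioi z, (1 - P.real {ξ | Z ξ ≤ y}) = ∫ ξ, max (Z ξ - z) 0 ∂P := by
  have hshift := (measurePreserving_add_right volume z).setIntegral_preimage_emb
    (measurableEmbedding_addRight z) (fun y => 1 - P.real {ξ | Z ξ ≤ y}) (Set.Ioi z)
  rw [Set.preimage_add_const_Ioi, sub_self] at hshift
  rw [(integrable_posPart_sub hZ z).integral_eq_integral_meas_lt
    (.of_forall fun ξ => le_max_right _ _), ← hshift]
  refine setIntegral_congr_fun measurableSet_Ioi fun s (hs : 0 < s) => ?_
  have hcompl : {ξ | s < max (Z ξ - z) 0} = {ξ | Z ξ ≤ s + z}ᶜ := by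
    ext ξ
    simp only [Set.mem_ofPred_eq, Set.mem_compl_iff, not_le, lt_max_iff, hs.not_gt, or_false,
      lt_sub_iff_add_lt]
  simp only [hcompl]
  rw [probReal_compl_eq_one_sub₀ (nullMeasurableSet_le hZ.aemeasurable aemeasurable_const)]

lemma cvarOf_eq_iInf (hZ : Integrable Z P) :
    cvarOf P α Z = ⨅ z : ℝ, (z + α⁻¹ * ∫ ξ, max (Z ξ - z) 0 ∂P) := by
  simp only [cvarOf, cvar, integral_one_sub_measureReal_le hZ]

lemma integral_le_cvarOf_objective (hZ : Integrable Z P) (h0 : 0 < α) (h1 : α ≤ 1) (z : ℝ) :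
    ∫ ξ, Z ξ ∂P ≤ z + α⁻¹ * ∫ ξ, max (Z ξ - z) 0 ∂P := by
  have hexcess : (∫ ξ, Z ξ ∂P) - z ≤ ∫ ξ, max (Z ξ - z) 0 ∂P := by
    calc (∫ ξ, Z ξ ∂P) - z = ∫ ξ, (Z ξ - z) ∂P := by
          rw [integral_sub hZ (integrable_const z)]; simp
      _ ≤ _ := integral_mono (hZ.sub (integrable_const z)) (integrable_posPart_sub hZ z)
          fun ξ => le_max_left _ _
  have hscale := le_mul_of_one_le_left
    (integral_nonneg (μ := P) fun ξ => le_max_right (Z ξ - z) 0) ((one_le_inv₀ h0).2 h1)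
  linarith

lemma cvarOf_le (hZ : Integrable Z P) (h0 : 0 < α) (h1 : α ≤ 1) (z : ℝ) :
    cvarOf P α Z ≤ z + α⁻¹ * ∫ ξ, max (Z ξ - z) 0 ∂P := by
  rw [cvarOf_eq_iInf hZ]
  refine ciInf_le ⟨∫ ξ, Z ξ ∂P, ?_⟩ z
  rintro _ ⟨w, rfl⟩
  exact integral_le_cvarOf_objective hZ h0 h1 w

lemma cvarOf_le_cvarOf_add (hZ₁ : Integrable Z₁ P) (hZ₂ : Integrable Z₂ P) (h0 : 0 < α)
    (h1 : α ≤ 1) {c : ℝ} (hc : ∀ ξ, Z₁ ξ ≤ Z₂ ξ + c) :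
    cvarOf P α Z₁ ≤ cvarOf P α Z₂ + c := by
  rw [← sub_le_iff_le_add, cvarOf_eq_iInf hZ₂]
  refine le_ciInf fun z => ?_
  have hmono : ∫ ξ, max (Z₁ ξ - (z + c)) 0 ∂P ≤ ∫ ξ, max (Z₂ ξ - z) 0 ∂P :=
    integral_mono (integrable_posPart_sub hZ₁ _) (integrable_posPart_sub hZ₂ _)
      fun ξ => max_le_max (by linarith [hc ξ]) le_rfl
  have hscale := mul_le_mul_of_nonneg_left hmono (inv_nonneg.2 h0.le)
  linarith [cvarOf_le hZ₁ h0 h1 (z + c)]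

lemma abs_cvarOf_sub_cvarOf_le (hZ₁ : Integrable Z₁ P) (hZ₂ : Integrable Z₂ P) (h0 : 0 < α)
    (h1 : α ≤ 1) {c : ℝ} (hc : ∀ ξ, |Z₁ ξ - Z₂ ξ| ≤ c) :
    |cvarOf P α Z₁ - cvarOf P α Z₂| ≤ c := by
  have hle := cvarOf_le_cvarOf_add (c := c) hZ₁ hZ₂ h0 h1 fun ξ => by linarith [(abs_le.1 (hc ξ)).2]
  have hge := cvarOf_le_cvarOf_add (c := c) hZ₂ hZ₁ h0 h1 fun ξ => by linarith [(abs_le.1 (hc ξ)).1]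
  exact abs_sub_le_iff.2 ⟨by linarith, by linarith⟩

lemma integral_posPart_sub_combination_le (hZ : Integrable Z P) (hZ₁ : Integrable Z₁ P)
    (hZ₂ : Integrable Z₂ P) {p q : ℝ} (hp : 0 ≤ p) (hq : 0 ≤ q)
    (hc : ∀ ξ, Z ξ ≤ p * Z₁ ξ + q * Z₂ ξ) (z₁ z₂ : ℝ) :
    ∫ ξ, max (Z ξ - (p * z₁ + q * z₂)) 0 ∂P ≤
      p * (∫ ξ, max (Z₁ ξ - z₁) 0 ∂P) + q * ∫ ξ, max (Z₂ ξ - z₂) 0 ∂P := by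
  have hint₁ := (integrable_posPart_sub hZ₁ z₁).const_mul p
  have hint₂ := (integrable_posPart_sub hZ₂ z₂).const_mul q
  rw [← integral_const_mul, ← integral_const_mul, ← integral_add hint₁ hint₂]
  refine integral_mono (integrable_posPart_sub hZ _) (hint₁.add hint₂) fun ξ => ?_
  refine max_le ?_ (add_nonneg (mul_nonneg hp (le_max_right _ _))
    (mul_nonneg hq (le_max_right _ _)))
  have hle₁ := mul_le_mul_of_nonneg_left (le_max_left (Z₁ ξ - z₁) 0) hp
  have hle₂ := mul_le_mul_of_nonneg_left (le_max_left (Z₂ ξ - z₂) 0) hq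
  linarith [hc ξ]

lemma cvarOf_le_combination (hZ : Integrable Z P) (hZ₁ : Integrable Z₁ P)
    (hZ₂ : Integrable Z₂ P) (h0 : 0 < α) (h1 : α ≤ 1) {p q : ℝ} (hp : 0 ≤ p) (hq : 0 ≤ q)
    (hc : ∀ ξ, Z ξ ≤ p * Z₁ ξ + q * Z₂ ξ) :
    cvarOf P α Z ≤ p * cvarOf P α Z₁ + q * cvarOf P α Z₂ := by
  rw [cvarOf_eq_iInf hZ₁, cvarOf_eq_iInf hZ₂, Real.mul_iInf_of_nonneg hp,
    Real.mul_iInf_of_nonneg hq]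
  refine le_ciInf_add_ciInf fun z₁ z₂ => (cvarOf_le hZ h0 h1 (p * z₁ + q * z₂)).trans ?_
  have hscale := mul_le_mul_of_nonneg_left
    (integral_posPart_sub_combination_le hZ hZ₁ hZ₂ hp hq hc z₁ z₂) (inv_nonneg.2 h0.le)
  linarith

end RandomVariable

section ReplaceAction

variable {N : ℕ} {d : Fin N → ℕ} (x : Profile d) (i : Fin N)

@[simp] lemma replaceAction_same (y : Act (d i)) : replaceAction x i y i = y := by
  simp [replaceAction]

variable {i} in
lemma replaceAction_of_ne {k : Fin N} (h : k ≠ i) (y : Act (d i)) :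
    replaceAction x i y k = x k := by
  simp [replaceAction, h]

lemma replaceAction_self : replaceAction x i (x i) = x := by
  simp [replaceAction]

lemma replaceAction_replaceAction (y z : Act (d i)) :
    replaceAction (replaceAction x i y) i z = replaceAction x i z := by
  simp [replaceAction]

lemma norm_replaceAction_sub (y y' : Act (d i)) :
    ‖replaceAction x i y - replaceAction x i y'‖ = ‖y - y'‖ := by
  have hsingle : replaceAction x i y - replaceAction x i y' =
      PiLp.single 2 (β := fun k => Act (d k)) i (y - y') := by
    ext k : 1
    by_cases h : k = i
    · subst h; simp
    · simp [replaceAction_of_ne, h]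
  rw [hsingle, PiLp.norm_single]

end ReplaceAction

namespace RiskGame

variable {N : ℕ} {G : RiskGame N} {Dx U L₀ : ℝ}

lemma replaceAction_mem_joint {x : Profile G.d} (hx : x ∈ G.joint) {i : Fin N} {y : Act (G.d i)}
    (hy : y ∈ G.X i) : replaceAction x i y ∈ G.joint := by
  intro k
  by_cases h : k = i
  · subst h; simpa using hy
  · rw [replaceAction_of_ne _ h]; exact hx k

lemma isCostCDF_cdf (hS : G.Standing Dx) (hJ : G.ConvexBounded U) (i : Fin N) {x : Profile G.d}
    (hx : x ∈ G.joint) : IsCostCDF U (G.cdf i x) :=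
  have := hS.law_prob i
  .of_abs_le fun ξ => (hJ i ξ).2 x hx

lemma abs_C_le (hS : G.Standing Dx) (hJ : G.ConvexBounded U) (i : Fin N) {x : Profile G.d}
    (hx : x ∈ G.joint) : |G.C i x| ≤ U :=
  (isCostCDF_cdf hS hJ i hx).abs_cvar_le (hS.level_pos i) (hS.level_le_one i)

lemma integrable_J (hS : G.Standing Dx) (hJ : G.ConvexBounded U) (i : Fin N) {x : Profile G.d}
    (hx : x ∈ G.joint) : Integrable (G.J i x) (G.law i) :=
  have := hS.law_prob i
  .of_bound (hS.measurable_cost i x hx).aestronglyMeasurable U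
    (.of_forall fun ξ => (hJ i ξ).2 x hx)

lemma abs_C_sub_C_le (hS : G.Standing Dx) (hJ : G.ConvexBounded U) (hL : G.LipschitzCost L₀)
    (i : Fin N) {x y : Profile G.d} (hx : x ∈ G.joint) (hy : y ∈ G.joint) :
    |G.C i x - G.C i y| ≤ L₀ * ‖x - y‖ :=
  have := hS.law_prob i
  abs_cvarOf_sub_cvarOf_le (integrable_J hS hJ i hx) (integrable_J hS hJ i hy) (hS.level_pos i)
    (hS.level_le_one i) fun ξ => hL i ξ x hx y hy

lemma convexOn_C (hS : G.Standing Dx) (hJ : G.ConvexBounded U) (i : Fin N) {x : Profile G.d}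
    (hx : x ∈ G.joint) : ConvexOn ℝ (G.X i) fun y => G.C i (replaceAction x i y) := by
  have := hS.law_prob i
  have hint : ∀ y ∈ G.X i, Integrable (G.J i (replaceAction x i y)) (G.law i) := fun y hy =>
    integrable_J hS hJ i (replaceAction_mem_joint hx hy)
  refine ⟨hS.convex i, fun y₁ h₁ y₂ h₂ p q hp hq hpq => ?_⟩
  exact cvarOf_le_combination (hint _ (hS.convex i h₁ h₂ hp hq hpq)) (hint _ h₁) (hint _ h₂)
    (hS.level_pos i) (hS.level_le_one i) hp hq fun ξ => ((hJ i ξ).1 x hx).2 h₁ h₂ hp hq hpq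

end RiskGame

section ShrunkSet

open Metric
open scoped Pointwise

lemma closedBall_combination_subset {E : Type*} [NormedAddCommGroup E] [NormedSpace ℝ E]
    [ProperSpace E] {X : Set E} (hX : Convex ℝ X) {x y : E} {r s p q : ℝ} (hr : 0 ≤ r)
    (hs : 0 ≤ s) (hx : closedBall x r ⊆ X) (hy : closedBall y s ⊆ X) (hp : 0 ≤ p) (hq : 0 ≤ q)
    (hpq : p + q = 1) : closedBall (p • x + q • y) (p * r + q * s) ⊆ X := by
  have hsum : closedBall (p • x + q • y) (p * r + q * s) =
      p • closedBall x r + q • closedBall y s := by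
    rw [smul_closedBall p x hr, smul_closedBall q y hs, closedBall_add_closedBall (by positivity)
      (by positivity), Real.norm_of_nonneg hp, Real.norm_of_nonneg hq]
  rw [hsum]
  rintro _ ⟨_, ⟨v, hv, rfl⟩, _, ⟨w, hw, rfl⟩, rfl⟩
  exact hX (hx hv) (hy hw) hp hq hpq

variable {n : ℕ} {X : Set (Act n)} {δ : ℝ} {x : Act n}

lemma closedBall_subset_of_mem_shrink (hX : IsClosed X) (hx : x ∈ shrink X δ) :
    closedBall x δ ⊆ X := by
  rcases eq_or_ne X Set.univ with rfl | hne
  · exact Set.subset_univ _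
  obtain ⟨p, hp, hdist⟩ := exists_mem_frontier_infDist_compl_eq_dist hx.1 hne
  have hδ : δ ≤ infDist x Xᶜ := hdist ▸ hx.2.trans (infDist_le_dist_of_mem hp)
  exact (closedBall_subset_closedBall hδ).trans
    ((closedBall_infDist_compl_subset_closure hx.1).trans hX.closure_eq.subset)

lemma frontier_nonempty_of_mem_shrink (hδ : 0 < δ) (hx : x ∈ shrink X δ) :
    (frontier X).Nonempty := by
  by_contra! hempty
  have hdist := hx.2
  rw [hempty, infDist_empty] at hdist
  linarith

lemma mem_shrink_of_closedBall_subset (hδ : 0 < δ) (hne : (frontier X).Nonempty)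
    (hx : closedBall x δ ⊆ X) : x ∈ shrink X δ := by
  refine ⟨hx (mem_closedBall_self hδ.le), (le_infDist hne).2 fun p hp => ?_⟩
  by_contra! hpδ
  have hball : ball x δ ⊆ interior X :=
    isOpen_ball.subset_interior_iff.2 (ball_subset_closedBall.trans hx)
  exact hp.2 (hball (mem_ball'.2 hpδ))

lemma convex_shrink (hX : Convex ℝ X) (hc : IsClosed X) (hδ : 0 < δ) :
    Convex ℝ (shrink X δ) := by
  intro x hx y hy p q hp hq hpq
  refine mem_shrink_of_closedBall_subset hδ (frontier_nonempty_of_mem_shrink hδ hx) ?_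
  have hball := closedBall_combination_subset hX hδ.le hδ.le
    (closedBall_subset_of_mem_shrink hc hx) (closedBall_subset_of_mem_shrink hc hy) hp hq hpq
  rwa [← add_mul, hpq, one_mul] at hball

lemma isClosed_shrink (hc : IsClosed X) : IsClosed (shrink X δ) :=
  hc.inter (isClosed_le continuous_const (continuous_infDist_pt _))

end ShrunkSet

section NearestPoint

variable {n : ℕ} {S : Set (Act n)}

lemma nearestPoint_spec (hne : S.Nonempty) (hc : IsClosed S) (x : Act n) :
    nearestPoint S x ∈ S ∧ ∀ q ∈ S, dist x (nearestPoint S x) ≤ dist x q := by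
  have hex : ∃ p ∈ S, ∀ q ∈ S, dist x p ≤ dist x q := by
    obtain ⟨p, hp, hdist⟩ := hc.exists_infDist_eq_dist hne x
    exact ⟨p, hp, fun q hq => hdist ▸ Metric.infDist_le_dist_of_mem hq⟩
  rw [nearestPoint, dif_pos hex]
  exact hex.choose_spec

lemma nearestPoint_eq_self (hne : S.Nonempty) (hc : IsClosed S) {x : Act n} (hx : x ∈ S) :
    nearestPoint S x = x := by
  have hdist := (nearestPoint_spec hne hc x).2 x hx
  rw [dist_self] at hdist
  exact (dist_le_zero.1 hdist).symm

lemma inner_sub_nearestPoint_nonpos (hne : S.Nonempty) (hc : IsClosed S) (hS : Convex ℝ S)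
    (x : Act n) {q : Act n} (hq : q ∈ S) :
    inner ℝ (x - nearestPoint S x) (q - nearestPoint S x) ≤ 0 := by
  obtain ⟨hmem, hmin⟩ := nearestPoint_spec hne hc x
  refine (norm_eq_iInf_iff_real_inner_le_zero hS hmem).1 ?_ q hq
  have : Nonempty S := ⟨⟨_, hmem⟩⟩
  refine le_antisymm (le_ciInf fun w => ?_) (ciInf_le ⟨0, ?_⟩ (⟨_, hmem⟩ : S))
  · simpa only [dist_eq_norm] using hmin w w.2
  · rintro _ ⟨w, rfl⟩; exact norm_nonneg _

lemma lipschitzWith_nearestPoint (hne : S.Nonempty) (hc : IsClosed S) (hS : Convex ℝ S) :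
    LipschitzWith 1 (nearestPoint S) := by
  refine .mk_one fun x y => ?_
  set p := nearestPoint S x
  set q := nearestPoint S y
  have hx : inner ℝ (x - p) (q - p) ≤ 0 :=
    inner_sub_nearestPoint_nonpos hne hc hS x (nearestPoint_spec hne hc y).1
  have hy : inner ℝ (y - q) (p - q) ≤ 0 :=
    inner_sub_nearestPoint_nonpos hne hc hS y (nearestPoint_spec hne hc x).1
  have hmul : ‖p - q‖ * ‖p - q‖ ≤ ‖x - y‖ * ‖p - q‖ := by
    calc ‖p - q‖ * ‖p - q‖ = inner ℝ (p - q) (p - q) := (real_inner_self_eq_norm_mul_norm _).symm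
      _ = inner ℝ (x - y) (p - q) + (inner ℝ (x - p) (q - p) + inner ℝ (y - q) (p - q)) := by
          simp only [inner_sub_left, inner_sub_right]; ring
      _ ≤ inner ℝ (x - y) (p - q) := by linarith
      _ ≤ ‖x - y‖ * ‖p - q‖ := real_inner_le_norm _ _
  rw [dist_eq_norm, dist_eq_norm]
  rcases (norm_nonneg (p - q)).eq_or_lt with hzero | hpos
  · exact hzero ▸ norm_nonneg _
  · exact le_of_mul_le_mul_right hmul hpos

lemma norm_nearestPoint_sub_le (hne : S.Nonempty) (hc : IsClosed S) (hS : Convex ℝ S)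
    (x : Act n) {q : Act n} (hq : q ∈ S) : ‖nearestPoint S x - q‖ ≤ ‖x - q‖ := by
  simpa only [nearestPoint_eq_self hne hc hq, dist_eq_norm, NNReal.coe_one, one_mul] using
    (lipschitzWith_nearestPoint hne hc hS).dist_le_mul x q

end NearestPoint

section ProjectedDescent

variable {E : Type*} [NormedAddCommGroup E] [InnerProductSpace ℝ E] {x g : ℕ → E} {y : E}
  {η D B : ℝ} {T : ℕ}

lemma two_mul_mul_inner_le_of_projected_step {x x' g y : E} {η : ℝ}
    (hstep : ‖x' - y‖ ≤ ‖x - η • g - y‖) :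
    2 * η * inner ℝ g (x - y) ≤ ‖x - y‖ ^ 2 - ‖x' - y‖ ^ 2 + η ^ 2 * ‖g‖ ^ 2 := by
  have hexpand : ‖x - η • g - y‖ ^ 2 =
      ‖x - y‖ ^ 2 - 2 * η * inner ℝ g (x - y) + η ^ 2 * ‖g‖ ^ 2 := by
    rw [sub_right_comm, norm_sub_sq_real, inner_smul_right, norm_smul, mul_pow,
      Real.norm_eq_abs, sq_abs, real_inner_comm]
    ring
  have hsq := pow_le_pow_left₀ (norm_nonneg _) hstep 2
  linarith

lemma sum_inner_le_of_projected_steps (hη : 0 < η)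
    (hstep : ∀ t < T, ‖x (t + 1) - y‖ ≤ ‖x t - η • g t - y‖) (hg : ∀ t < T, ‖g t‖ ≤ B)
    (hD : ‖x 0 - y‖ ≤ D) :
    ∑ t ∈ Finset.range T, inner ℝ (g t) (x t - y) ≤ D ^ 2 / (2 * η) + η * T * B ^ 2 / 2 := by
  have hsum : ∑ t ∈ Finset.range T, 2 * η * inner ℝ (g t) (x t - y) ≤
      D ^ 2 + T * (η ^ 2 * B ^ 2) := by
    calc ∑ t ∈ Finset.range T, 2 * η * inner ℝ (g t) (x t - y)
        ≤ ∑ t ∈ Finset.range T, (‖x t - y‖ ^ 2 - ‖x (t + 1) - y‖ ^ 2 + η ^ 2 * B ^ 2) := by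
          refine Finset.sum_le_sum fun t ht => ?_
          rw [Finset.mem_range] at ht
          refine (two_mul_mul_inner_le_of_projected_step (hstep t ht)).trans ?_
          gcongr
          exact hg t ht
      _ = ‖x 0 - y‖ ^ 2 - ‖x T - y‖ ^ 2 + T * (η ^ 2 * B ^ 2) := by
          rw [Finset.sum_add_distrib, Finset.sum_range_sub' fun t => ‖x t - y‖ ^ 2]
          simp
      _ ≤ D ^ 2 + T * (η ^ 2 * B ^ 2) := by
          have hD2 := pow_le_pow_left₀ (norm_nonneg _) hD 2
          linarith [sq_nonneg ‖x T - y‖]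
  rw [← Finset.mul_sum, ← le_div_iff₀' (by positivity)] at hsum
  refine hsum.trans_eq ?_
  field_simp

end ProjectedDescent

section Azuma

variable {Ω : Type*} [MeasurableSpace Ω] {μ : Measure Ω}

-- By convexity `exp (l * V)` lies below its chord over `[-c, c]`, and `hneg` discards the linear
-- term.
lemma integral_exp_mul_add_le {W V : Ω → ℝ} {c l : ℝ} (hc : 0 < c) (hl : 0 < l)
    (hW : Integrable (fun ω => Real.exp (l * W ω)) μ) (hV : Measurable V)
    (hVc : ∀ ω, |V ω| ≤ c) (hneg : ∫ ω, Real.exp (l * W ω) * V ω ∂μ ≤ 0) :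
    Integrable (fun ω => Real.exp (l * (W ω + V ω))) μ ∧
      ∫ ω, Real.exp (l * (W ω + V ω)) ∂μ ≤
        Real.exp ((l * c) ^ 2 / 2) * ∫ ω, Real.exp (l * W ω) ∂μ := by
  have hWV : Integrable (fun ω => Real.exp (l * W ω) * V ω) μ :=
    hW.mul_bdd (c := c) hV.aestronglyMeasurable (.of_forall hVc)
  have hsum : Integrable (fun ω => Real.exp (l * (W ω + V ω))) μ := by
    simp only [mul_add, Real.exp_add]
    refine hW.mul_bdd (c := Real.exp (l * c)) (hV.const_mul l).exp.aestronglyMeasurable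
      (.of_forall fun ω => ?_)
    rw [Real.norm_of_nonneg (Real.exp_pos _).le]
    gcongr
    exact (le_abs_self _).trans (hVc ω)
  have hchord : ∀ ω, Real.exp (l * (W ω + V ω)) ≤ Real.cosh (l * c) * Real.exp (l * W ω) +
      Real.sinh (l * c) / c * (Real.exp (l * W ω) * V ω) := fun ω => by
    have hVc' : |V ω / c| ≤ 1 := by
      rw [abs_div, abs_of_pos hc]
      exact div_le_one_of_le₀ (hVc ω) hc.le
    calc Real.exp (l * (W ω + V ω))
        = Real.exp (l * W ω) * Real.exp (V ω / c * (l * c)) := by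
          rw [← Real.exp_add]; field_simp
      _ ≤ Real.exp (l * W ω) * (Real.cosh (l * c) + V ω / c * Real.sinh (l * c)) := by
          gcongr
          exact Real.exp_mul_le_cosh_add_mul_sinh hVc' _
      _ = _ := by ring
  have hslope : 0 ≤ Real.sinh (l * c) / c :=
    div_nonneg (Real.sinh_nonneg_iff.2 (by positivity)) hc.le
  refine ⟨hsum, ?_⟩
  calc ∫ ω, Real.exp (l * (W ω + V ω)) ∂μ
      ≤ Real.cosh (l * c) * (∫ ω, Real.exp (l * W ω) ∂μ) +
          Real.sinh (l * c) / c * ∫ ω, Real.exp (l * W ω) * V ω ∂μ := by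
        rw [← integral_const_mul, ← integral_const_mul,
          ← integral_add (hW.const_mul _) (hWV.const_mul _)]
        exact integral_mono hsum ((hW.const_mul _).add (hWV.const_mul _)) hchord
    _ ≤ Real.cosh (l * c) * ∫ ω, Real.exp (l * W ω) ∂μ := by
        linarith [mul_nonpos_of_nonneg_of_nonpos hslope hneg]
    _ ≤ _ := by
        gcongr
        exact Real.cosh_le_exp_half_sq _

variable [IsProbabilityMeasure μ]

lemma integral_exp_mul_sum_le {V : ℕ → Ω → ℝ} {c l : ℝ} (hc : 0 < c) (hl : 0 < l) {T : ℕ}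
    (hV : ∀ t < T, Measurable (V t)) (hVc : ∀ t < T, ∀ ω, |V t ω| ≤ c)
    (hneg : ∀ t < T, ∫ ω, Real.exp (l * ∑ s ∈ Finset.range t, V s ω) * V t ω ∂μ ≤ 0) :
    Integrable (fun ω => Real.exp (l * ∑ s ∈ Finset.range T, V s ω)) μ ∧
      ∫ ω, Real.exp (l * ∑ s ∈ Finset.range T, V s ω) ∂μ ≤
        Real.exp (T * ((l * c) ^ 2 / 2)) := by
  induction T with
  | zero => simp
  | succ T ih =>
    obtain ⟨hint, hle⟩ := ih (fun t ht => hV t (by omega)) (fun t ht => hVc t (by omega))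
      fun t ht => hneg t (by omega)
    obtain ⟨hint', hle'⟩ := integral_exp_mul_add_le hc hl hint (hV T T.lt_succ_self)
      (hVc T T.lt_succ_self) (hneg T T.lt_succ_self)
    simp only [Finset.sum_range_succ]
    refine ⟨hint', hle'.trans ?_⟩
    calc _ ≤ Real.exp ((l * c) ^ 2 / 2) * Real.exp (T * ((l * c) ^ 2 / 2)) := by gcongr
      _ = _ := by rw [← Real.exp_add]; push_cast; ring_nf

-- Azuma–Hoeffding, with the martingale property weakened to what its proof uses: the increments
-- are not positively correlated with the exponentials of the past sums. This avoids conditional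
-- expectations.
lemma measure_sum_gt_le_of_integral_exp_mul_nonpos {V : ℕ → Ω → ℝ} {c γ : ℝ} (hc : 0 < c)
    {T : ℕ} (hT : 0 < T) (hγ : 0 < γ) (hγ1 : γ < 1)
    (hV : ∀ t < T, Measurable (V t)) (hVc : ∀ t < T, ∀ ω, |V t ω| ≤ c)
    (hneg : ∀ t < T, ∀ l : ℝ, 0 < l →
      ∫ ω, Real.exp (l * ∑ s ∈ Finset.range t, V s ω) * V t ω ∂μ ≤ 0) :
    μ {ω | c * √(2 * T * Real.log (1 / γ)) < ∑ s ∈ Finset.range T, V s ω} ≤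
      ENNReal.ofReal γ := by
  have : (0 : ℝ) < T := by exact_mod_cast hT
  have hlog : 0 < Real.log (1 / γ) := Real.log_pos ((one_lt_div₀ hγ).2 hγ1)
  set R := √(2 * T * Real.log (1 / γ))
  have hR : 0 < R := Real.sqrt_pos.2 (by positivity)
  have hR_sq : R ^ 2 = 2 * T * Real.log (1 / γ) := Real.sq_sqrt (by positivity)
  -- minimizes the exponent in Chernoff's bound
  set l : ℝ := R / (T * c) with hl_def
  have hl : 0 < l := by positivity
  obtain ⟨hint, hmgf⟩ := integral_exp_mul_sum_le hc hl hV hVc fun t ht => hneg t ht l hl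
  have hchernoff := measure_ge_le_exp_mul_mgf (X := fun ω => ∑ s ∈ Finset.range T, V s ω)
    (c * R) hl.le hint
  have hexponent : -l * (c * R) + T * ((l * c) ^ 2 / 2) = Real.log γ := by
    calc -l * (c * R) + T * ((l * c) ^ 2 / 2) = -(R ^ 2 / (2 * T)) := by
          rw [hl_def]; field_simp; ring
      _ = Real.log γ := by
          rw [hR_sq, mul_div_cancel_left₀ _ (by positivity), one_div, Real.log_inv, neg_neg]
  have hbound : μ.real {ω | c * R ≤ ∑ s ∈ Finset.range T, V s ω} ≤ γ := by
    refine hchernoff.trans ((mul_le_mul_of_nonneg_left hmgf (Real.exp_pos _).le).trans_eq ?_)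
    rw [← Real.exp_add, hexponent, Real.exp_log hγ]
  rw [← ofReal_measureReal]
  refine ENNReal.ofReal_le_ofReal (le_trans (measureReal_mono fun ω hω => ?_) hbound)
  rw [Set.mem_ofPred_eq] at hω ⊢
  exact hω.le

end Azuma

section Independence

variable {Ω : Type*} {mΩ : MeasurableSpace Ω} {μ : Measure Ω}

lemma iIndep_sumElim {ι κ : Type*} {m : ι → MeasurableSpace Ω} {m' : κ → MeasurableSpace Ω}
    (h : iIndep m μ) (h' : iIndep m' μ) (hi : Indep (⨆ k, m k) (⨆ k, m' k) μ) :
    iIndep (Sum.elim m m') μ := by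
  rw [iIndep_iff] at h h' ⊢
  intro s f hf
  have hleft : ∀ k ∈ s.toLeft, MeasurableSet[m k] (f (.inl k)) := fun k hk =>
    hf (.inl k) (Finset.mem_toLeft.1 hk)
  have hright : ∀ k ∈ s.toRight, MeasurableSet[m' k] (f (.inr k)) := fun k hk =>
    hf (.inr k) (Finset.mem_toRight.1 hk)
  have hsplit : ⋂ k ∈ s, f k =
      (⋂ k ∈ s.toLeft, f (.inl k)) ∩ ⋂ k ∈ s.toRight, f (.inr k) := by
    ext ω
    simp only [Set.mem_iInter, Set.mem_inter_iff, Finset.mem_toLeft, Finset.mem_toRight,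
      Sum.forall]
  have hindep := (Indep_iff _ _ _).1 hi _ _
    (Finset.measurableSet_biInter _ fun k hk => le_iSup m k _ (hleft k hk))
    (Finset.measurableSet_biInter _ fun k hk => le_iSup m' k _ (hright k hk))
  rw [hsplit, hindep, h _ hleft, h' _ hright]
  conv_rhs => rw [← s.toLeft_disjSum_toRight, Finset.prod_disjSum]

lemma integral_comp_eq_of_indepFun [IsFiniteMeasure μ] {α β : Type*} [MeasurableSpace α]
    [MeasurableSpace β] {A : Ω → α} {B : Ω → β} (hA : Measurable A) (hB : Measurable B)
    (h : IndepFun A B μ) {f : α → β → ℝ} (hf : Measurable (Function.uncurry f))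
    (hint : Integrable (fun ω => f (A ω) (B ω)) μ) :
    ∫ ω, f (A ω) (B ω) ∂μ = ∫ ω, ∫ ω', f (A ω) (B ω') ∂μ ∂μ := by
  have hAB : Measurable fun ω => (A ω, B ω) := hA.prodMk hB
  have hmap : μ.map (fun ω => (A ω, B ω)) = (μ.map A).prod (μ.map B) :=
    (indepFun_iff_map_prod_eq_prod_map_map hA.aemeasurable hB.aemeasurable).1 h
  have hint' : Integrable (Function.uncurry f) ((μ.map A).prod (μ.map B)) := by
    rwa [← hmap, integrable_map_measure hf.aestronglyMeasurable hAB.aemeasurable]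
  calc ∫ ω, f (A ω) (B ω) ∂μ = ∫ q, Function.uncurry f q ∂((μ.map A).prod (μ.map B)) := by
        rw [← hmap, integral_map hAB.aemeasurable hf.aestronglyMeasurable]; rfl
    _ = ∫ a, ∫ b, f a b ∂μ.map B ∂μ.map A := integral_prod _ hint'
    _ = ∫ ω, ∫ b, f (A ω) b ∂μ.map B ∂μ :=
        integral_map hA.aemeasurable
          hf.stronglyMeasurable.integral_prod_right.aestronglyMeasurable
    _ = ∫ ω, ∫ ω', f (A ω) (B ω') ∂μ ∂μ := by
        congr 1 with ω
        exact integral_map hB.aemeasurable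
          (hf.comp measurable_prodMk_left).aestronglyMeasurable

lemma indepFun_of_iIndep_of_measurable {ι : Type*} {m : ι → MeasurableSpace Ω}
    (hle : ∀ k, m k ≤ mΩ) (hm : iIndep m μ) {S S' : Set ι} (hd : Disjoint S S') {α β : Type*}
    [MeasurableSpace α] [MeasurableSpace β] {A : Ω → α} {B : Ω → β}
    (hA : Measurable[⨆ k ∈ S, m k] A) (hB : Measurable[⨆ k ∈ S', m k] B) : IndepFun A B μ :=
  (IndepFun_iff_Indep _ _ _).2 <| indep_of_indep_of_le_left
    (indep_of_indep_of_le_right (indep_iSup_of_disjoint hle hm hd) hB.comap_le) hA.comap_le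

end Independence

section RadialCutoff

open Metric Filter Topology

variable {E : Type*} [NormedAddCommGroup E]

/-- The open spherical shell with radii `r` and `1`. -/
def openShell (E : Type*) [NormedAddCommGroup E] (r : ℝ) : Set E := ball 0 1 \ closedBall 0 r

lemma mem_openShell {r : ℝ} {w : E} : w ∈ openShell E r ↔ r < ‖w‖ ∧ ‖w‖ < 1 := by
  simp only [openShell, Set.mem_sdiff, mem_ball_zero_iff, mem_closedBall_zero_iff, not_le, and_comm]

lemma measurableSet_openShell [MeasurableSpace E] [OpensMeasurableSpace E] {r : ℝ} :
    MeasurableSet (openShell E r) :=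
  measurableSet_ball.diff measurableSet_closedBall

/-- The radial cutoff that is `1` for `‖w‖ ≤ 1 - ε`, `0` for `‖w‖ ≥ 1`, and affine in between: a
Lipschitz approximation of the indicator of the unit ball. -/
def radialCutoff (ε : ℝ) (w : E) : ℝ := max 0 (min 1 (ε⁻¹ * (1 - ‖w‖)))

lemma radialCutoff_nonneg (ε : ℝ) (w : E) : 0 ≤ radialCutoff ε w := le_max_left _ _

lemma radialCutoff_le_one (ε : ℝ) (w : E) : radialCutoff ε w ≤ 1 :=
  max_le zero_le_one (min_le_left _ _)

variable {ε : ℝ} {w : E}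

lemma radialCutoff_eq_zero (hε : 0 < ε) (hw : 1 ≤ ‖w‖) : radialCutoff ε w = 0 :=
  max_eq_left <| (min_le_right _ _).trans <|
    mul_nonpos_of_nonneg_of_nonpos (inv_nonneg.2 hε.le) (by linarith)

lemma radialCutoff_eq_one (hε : 0 < ε) (hw : ‖w‖ ≤ 1 - ε) : radialCutoff ε w = 1 := by
  have hslope : 1 ≤ ε⁻¹ * (1 - ‖w‖) := by
    rw [inv_mul_eq_div, le_div_iff₀ hε]; linarith
  rw [radialCutoff, min_eq_left hslope, max_eq_right zero_le_one]

lemma radialCutoff_eq_of_mem_openShell (hε : 0 < ε) (hw : w ∈ openShell E (1 - ε)) :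
    radialCutoff ε w = ε⁻¹ * (1 - ‖w‖) := by
  obtain ⟨hlow, hupp⟩ := mem_openShell.1 hw
  rw [radialCutoff, min_eq_right, max_eq_right]
  · exact mul_nonneg (inv_nonneg.2 hε.le) (by linarith)
  · rw [inv_mul_eq_div, div_le_iff₀ hε]; linarith

lemma lipschitzWith_radialCutoff (hε : 0 < ε) :
    LipschitzWith (Real.toNNReal ε⁻¹) (radialCutoff (E := E) ε) := by
  have haffine : LipschitzWith (Real.toNNReal ε⁻¹) fun w : E => ε⁻¹ * (1 - ‖w‖) := by
    refine .of_dist_le' fun x y => ?_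
    rw [Real.dist_eq, ← mul_sub, abs_mul, abs_of_pos (inv_pos.2 hε), dist_eq_norm,
      sub_sub_sub_cancel_left, abs_sub_comm]
    gcongr
    exact abs_norm_sub_norm_le x y
  exact (haffine.const_min 1).const_max 0

lemma hasCompactSupport_radialCutoff [ProperSpace E] (hε : 0 < ε) :
    HasCompactSupport (radialCutoff (E := E) ε) := by
  refine .intro (isCompact_closedBall 0 1) fun w hw => radialCutoff_eq_zero hε ?_
  exact (not_le.1 fun h => hw (mem_closedBall_zero_iff.2 h)).le

lemma integrable_radialCutoff [ProperSpace E] [MeasurableSpace E] [OpensMeasurableSpace E]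
    {μ : Measure E} [IsFiniteMeasureOnCompacts μ] (hε : 0 < ε) :
    Integrable (radialCutoff (E := E) ε) μ :=
  (lipschitzWith_radialCutoff hε).continuous.integrable_of_hasCompactSupport
    (hasCompactSupport_radialCutoff hε)

lemma tendsto_integral_radialCutoff [ProperSpace E] [MeasurableSpace E] [BorelSpace E]
    {μ : Measure E} [IsFiniteMeasureOnCompacts μ] :
    Tendsto (fun ε => ∫ w : E, radialCutoff ε w ∂μ) (𝓝[>] 0) (𝓝 (μ.real (ball 0 1))) := by
  rw [← integral_indicator_one measurableSet_ball]
  have hε_pos : ∀ᶠ ε : ℝ in 𝓝[>] 0, 0 < ε := self_mem_nhdsWithin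
  refine tendsto_integral_filter_of_dominated_convergence ((ball 0 1).indicator 1) ?_ ?_
    ((integrable_indicator_iff measurableSet_ball).2 (integrableOn_const measure_ball_lt_top.ne))
    (.of_forall fun w => tendsto_const_nhds.congr' ?_)
  · filter_upwards [hε_pos] with ε hε
    exact (integrable_radialCutoff hε).aestronglyMeasurable
  · filter_upwards [hε_pos] with ε hε
    refine .of_forall fun w => ?_
    rw [Real.norm_of_nonneg (radialCutoff_nonneg _ _)]
    by_cases hw : w ∈ ball 0 1
    · rw [Set.indicator_of_mem hw]
      exact radialCutoff_le_one _ _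
    · rw [Set.indicator_of_notMem hw, radialCutoff_eq_zero hε (by simpa using hw)]
  · by_cases hw : w ∈ ball 0 1
    · rw [mem_ball_zero_iff] at hw
      filter_upwards [Ioo_mem_nhdsGT (sub_pos.2 hw)] with ε hε
      rw [Set.indicator_of_mem (mem_ball_zero_iff.2 hw),
        radialCutoff_eq_one hε.1 (by linarith [hε.2]), Pi.one_apply]
    · filter_upwards [hε_pos] with ε hε
      rw [Set.indicator_of_notMem hw, radialCutoff_eq_zero hε (by simpa using hw)]

end RadialCutoff

section LineDerivative

open Metric Filter Topology

lemma sub_le_lineDeriv_of_convex_segment {E : Type*} [NormedAddCommGroup E] [NormedSpace ℝ E]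
    {h : E → ℝ} {w v : E} (hd : LineDifferentiableAt ℝ h w v)
    (hc : ∀ s ∈ Set.Icc (0 : ℝ) 1, h (w - s • v) ≤ (1 - s) * h w + s * h (w - v)) :
    h w - h (w - v) ≤ lineDeriv ℝ h w v := by
  refine ge_of_tendsto hd.hasLineDerivAt.tendsto_slope_zero_left ?_
  filter_upwards [Ioo_mem_nhdsLT (show (-1 : ℝ) < 0 by norm_num)] with t ht
  have hchord := hc (-t) ⟨by linarith [ht.2], by linarith [ht.1]⟩
  rw [neg_smul, sub_neg_eq_add] at hchord
  rw [smul_eq_mul, inv_mul_eq_div, le_div_iff_of_neg ht.2]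
  linarith

variable {E : Type*} [NormedAddCommGroup E] [InnerProductSpace ℝ E] {w : E}

lemma hasLineDerivAt_norm (hw : w ≠ 0) (v : E) :
    HasLineDerivAt ℝ (fun w => ‖w‖) (inner ℝ (‖w‖⁻¹ • w) v) w v := by
  have hline : HasDerivAt (fun s : ℝ => w + s • v) v 0 := by
    simpa using ((hasDerivAt_id (0 : ℝ)).smul_const v).const_add w
  have hsqrt := hline.norm_sq.sqrt (by simpa using hw)
  simp only [Real.sqrt_sq (norm_nonneg _), zero_smul, add_zero] at hsqrt
  have hslope : inner ℝ (‖w‖⁻¹ • w) v = 2 * inner ℝ w v / (2 * ‖w‖) := by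
    rw [real_inner_smul_left]
    field_simp
  rw [hslope]
  exact hsqrt

variable {ε : ℝ}

lemma lineDeriv_radialCutoff_neg (hε : 0 < ε) (hε1 : ε < 1) (v : E) (hw₁ : ‖w‖ ≠ 1)
    (hw₂ : ‖w‖ ≠ 1 - ε) :
    lineDeriv ℝ (radialCutoff ε) w (-v) =
      (openShell E (1 - ε)).indicator (fun w => ε⁻¹ * inner ℝ (‖w‖⁻¹ • w) v) w := by
  have hnorm : ContinuousAt (fun w : E => ‖w‖) w := continuous_norm.continuousAt
  by_cases hshell : w ∈ openShell E (1 - ε)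
  · have hw : w ≠ 0 := by
      rintro rfl
      linarith [(mem_openShell.1 hshell).1, norm_zero (E := E)]
    have hlocal : radialCutoff ε =ᶠ[𝓝 w] fun w => ε⁻¹ * (1 - ‖w‖) := by
      filter_upwards [(isOpen_ball.sdiff isClosed_closedBall).mem_nhds hshell] with w' hw'
      exact radialCutoff_eq_of_mem_openShell hε hw'
    have hderiv := ((hasLineDerivAt_norm hw (-v)).const_sub 1).const_mul ε⁻¹
    rw [hlocal.lineDeriv_eq, Set.indicator_of_mem hshell, lineDeriv, hderiv.deriv]
    simp
  · have hlocal : ∃ c : ℝ, radialCutoff ε =ᶠ[𝓝 w] fun _ => c := by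
      rcases lt_or_gt_of_ne hw₁ with hlt | hgt
      · have hlow : ‖w‖ < 1 - ε := lt_of_le_of_ne
          (not_lt.1 fun h => hshell (mem_openShell.2 ⟨h, hlt⟩)) hw₂
        exact ⟨1, (hnorm.eventually_lt_const hlow).mono fun w' h => radialCutoff_eq_one hε h.le⟩
      · exact ⟨0, (hnorm.eventually_const_lt hgt).mono fun w' h => radialCutoff_eq_zero hε h.le⟩
    obtain ⟨c, hc⟩ := hlocal
    rw [hc.lineDeriv_eq, Set.indicator_of_notMem hshell, lineDeriv, deriv_const]

end LineDerivative

section ShellIntegrals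

open Metric
open scoped NNReal

variable {E : Type*} [NormedAddCommGroup E] [NormedSpace ℝ E] [FiniteDimensional ℝ E]
  [MeasurableSpace E] [BorelSpace E] (μ : Measure E) [μ.IsAddHaarMeasure]

lemma measureReal_openShell {r : ℝ} (hr : 0 ≤ r) (hr1 : r < 1) :
    μ.real (openShell E r) = μ.real (ball 0 1) * (1 - r ^ Module.finrank ℝ E) := by
  rw [openShell, measureReal_sdiff (closedBall_subset_ball hr1) measurableSet_closedBall
    measure_ball_lt_top.ne, Measure.addHaar_real_closedBall μ 0 hr]
  ring

variable [Nontrivial E]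

lemma setIntegral_openShell_comp_direction_eq_mul (g : E → ℝ) (r : ℝ) :
    ∫ w in openShell E r, g (‖w‖⁻¹ • w) ∂μ =
      (∫ u : sphere (0 : E) 1, g u ∂μ.toSphere) *
        ∫ t : Set.Ioi (0 : ℝ), (Set.Ioo r 1).indicator 1 t.1
          ∂(Measure.volumeIoiPow (Module.finrank ℝ E - 1)) := by
  rw [← integral_indicator measurableSet_openShell]
  calc ∫ w, (openShell E r).indicator (fun w => g (‖w‖⁻¹ • w)) w ∂μ
      = ∫ w : ({0}ᶜ : Set E), (openShell E r).indicator (fun w => g (‖w‖⁻¹ • w)) w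
          ∂(μ.comap (↑)) := by
        rw [integral_subtype_comap (measurableSet_singleton _).compl
          fun w => (openShell E r).indicator (fun w => g (‖w‖⁻¹ • w)) w, restrict_compl_singleton]
    _ = ∫ p, g p.1 * (Set.Ioo r 1).indicator 1 p.2.1
          ∂μ.toSphere.prod (.volumeIoiPow (Module.finrank ℝ E - 1)) := by
        rw [← μ.measurePreserving_homeomorphUnitSphereProd.integral_comp
          (Homeomorph.measurableEmbedding _)]
        refine integral_congr_ae (.of_forall fun w => ?_)
        by_cases hw : w.1 ∈ openShell E r
        · simp [hw, mem_openShell.1 hw]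
        · simp [hw, mt mem_openShell.2 hw, Set.indicator]
    _ = _ := integral_prod_mul (fun u : sphere (0 : E) 1 => g u)
        (fun t : Set.Ioi (0 : ℝ) => (Set.Ioo r 1).indicator 1 t.1)

lemma toSphere_mul_setIntegral_openShell_comp_direction (g : E → ℝ) (r : ℝ) :
    μ.toSphere.real Set.univ * ∫ w in openShell E r, g (‖w‖⁻¹ • w) ∂μ =
      μ.real (openShell E r) * ∫ u : sphere (0 : E) 1, g u ∂μ.toSphere := by
  have hvolume := setIntegral_openShell_comp_direction_eq_mul μ (fun _ => 1) r
  simp only [integral_const, smul_eq_mul, mul_one, measureReal_restrict_apply_univ] at hvolume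
  rw [setIntegral_openShell_comp_direction_eq_mul, hvolume]
  ring

end ShellIntegrals

section DivergenceOnBall

open Metric
open scoped NNReal

variable {E : Type*} [NormedAddCommGroup E]

lemma norm_inv_norm_smul_le [NormedSpace ℝ E] (w : E) : ‖‖w‖⁻¹ • w‖ ≤ 1 := by
  rw [norm_smul, norm_inv, norm_norm]
  exact inv_mul_le_one

lemma norm_sub_inv_norm_smul [NormedSpace ℝ E] {w : E} (hw : 0 < ‖w‖) :
    ‖w - ‖w‖⁻¹ • w‖ = |‖w‖ - 1| := by
  calc ‖w - ‖w‖⁻¹ • w‖ = ‖(1 - ‖w‖⁻¹) • w‖ := by rw [sub_smul, one_smul]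
    _ = |(1 - ‖w‖⁻¹) * ‖w‖| := by rw [norm_smul, Real.norm_eq_abs, abs_mul, abs_norm]
    _ = |‖w‖ - 1| := by rw [sub_mul, one_mul, inv_mul_cancel₀ hw.ne']

variable {K : ℝ≥0} {h : E → ℝ}

lemma abs_le_of_lipschitzWith_of_norm_le_one (hL : LipschitzWith K h) {w : E} (hw : ‖w‖ ≤ 1) :
    |h w| ≤ |h 0| + K := by
  have hdist := hL.dist_le_mul w 0
  rw [Real.dist_eq, dist_zero_right] at hdist
  have hK : (K : ℝ) * ‖w‖ ≤ K := mul_le_of_le_one_right K.2 hw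
  linarith [abs_sub_abs_le_abs_sub (h w) (h 0)]

section Normed

variable [NormedSpace ℝ E] [FiniteDimensional ℝ E] [MeasurableSpace E] [BorelSpace E]
  {μ : Measure E} [μ.IsAddHaarMeasure] {v : E} {ε : ℝ}

-- Rademacher's theorem and an integration by parts along `v` against the cutoff replace the
-- divergence theorem on the unit ball, which is recovered as `ε → 0`.
lemma integral_radialCutoff_mul_le_integral_lineDeriv_mul (hL : LipschitzWith K h)
    (hc : ∀ w, ‖w‖ < 1 → ∀ s ∈ Set.Icc (0 : ℝ) 1,
      h (w - s • v) ≤ (1 - s) * h w + s * h (w - v)) (hε : 0 < ε) :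
    (∫ w, radialCutoff ε w ∂μ) * (h 0 - h (-v) - 2 * K) ≤
      ∫ w, lineDeriv ℝ h w v * radialCutoff ε w ∂μ := by
  have hcutoff : Integrable (radialCutoff (E := E) ε) μ := integrable_radialCutoff hε
  rw [mul_comm, ← integral_const_mul]
  refine integral_mono_ae (hcutoff.const_mul _)
    (hcutoff.bdd_mul (aestronglyMeasurable_lineDeriv hL.continuous _)
      (.of_forall fun w => norm_lineDeriv_le_of_lipschitz ℝ hL)) ?_
  filter_upwards [hL.ae_lineDifferentiableAt v] with w hdiff
  rcases lt_or_ge ‖w‖ 1 with hw | hw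
  · refine mul_le_mul_of_nonneg_right ?_ (radialCutoff_nonneg _ _)
    have hderiv := sub_le_lineDeriv_of_convex_segment hdiff (hc w hw)
    have hstart := (abs_le.1 (hL.dist_le_mul w 0)).1
    have hend := (abs_le.1 (hL.dist_le_mul (w - v) (-v))).2
    rw [dist_zero_right] at hstart
    rw [dist_eq_norm, sub_neg_eq_add, sub_add_cancel] at hend
    have hK : (K : ℝ) * ‖w‖ ≤ K := mul_le_of_le_one_right K.2 hw.le
    linarith
  · rw [radialCutoff_eq_zero hε hw, mul_zero, mul_zero]

end Normed

variable [InnerProductSpace ℝ E] {v : E} {ε : ℝ}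

lemma abs_inner_mul_le_of_lipschitzWith (hL : LipschitzWith K h) {u w : E} (hu : ‖u‖ ≤ 1)
    (hw : ‖w‖ ≤ 1) : |inner ℝ u v * h w| ≤ ‖v‖ * (|h 0| + K) := by
  rw [abs_mul]
  refine mul_le_mul ?_ (abs_le_of_lipschitzWith_of_norm_le_one hL hw) (abs_nonneg _)
    (norm_nonneg _)
  exact (abs_real_inner_le_norm u v).trans (mul_le_of_le_one_left (norm_nonneg v) hu)

lemma inner_direction_mul_le_of_mem_openShell (hL : LipschitzWith K h) (hε1 : ε < 1) {w : E}
    (hw : w ∈ openShell E (1 - ε)) :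
    inner ℝ (‖w‖⁻¹ • w) v * h w ≤
      inner ℝ (‖w‖⁻¹ • w) v * h (‖w‖⁻¹ • w) + K * ε * ‖v‖ := by
  obtain ⟨hlow, hupp⟩ := mem_openShell.1 hw
  have hdirection : |h w - h (‖w‖⁻¹ • w)| ≤ K * ε := by
    refine (hL.dist_le_mul _ _).trans (mul_le_mul_of_nonneg_left ?_ K.2)
    rw [dist_eq_norm, norm_sub_inv_norm_smul (by linarith), abs_le]
    constructor <;> linarith
  have hinner : |inner ℝ (‖w‖⁻¹ • w) v| ≤ ‖v‖ :=
    (abs_real_inner_le_norm _ _).trans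
      (mul_le_of_le_one_left (norm_nonneg v) (norm_inv_norm_smul_le w))
  have hproduct : |inner ℝ (‖w‖⁻¹ • w) v * (h w - h (‖w‖⁻¹ • w))| ≤ ‖v‖ * (K * ε) := by
    rw [abs_mul]
    gcongr
  linarith [(abs_le.1 hproduct).2]

variable [FiniteDimensional ℝ E] [MeasurableSpace E] [BorelSpace E] {μ : Measure E}
  [μ.IsAddHaarMeasure]

lemma integral_lineDeriv_mul_radialCutoff [Nontrivial E] (hL : LipschitzWith K h) (v : E)
    (hε : 0 < ε) (hε1 : ε < 1) :
    ∫ w, lineDeriv ℝ h w v * radialCutoff ε w ∂μ =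
      ε⁻¹ * ∫ w in openShell E (1 - ε), inner ℝ (‖w‖⁻¹ • w) v * h w ∂μ := by
  rw [hL.integral_lineDeriv_mul_eq (lipschitzWith_radialCutoff hε)
    (hasCompactSupport_radialCutoff hε) v, ← integral_const_mul,
    ← integral_indicator measurableSet_openShell]
  have hsphere (r : ℝ) : ∀ᵐ w ∂μ, w ∉ sphere (0 : E) r :=
    measure_eq_zero_iff_ae_notMem.1 (Measure.addHaar_sphere _ _ _)
  refine integral_congr_ae ?_
  filter_upwards [hsphere 1, hsphere (1 - ε)] with w hw₁ hw₂
  rw [lineDeriv_radialCutoff_neg hε hε1 v (by simpa using hw₁) (by simpa using hw₂),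
    ← Set.indicator_mul_left]
  simp only [mul_assoc]

lemma setIntegral_openShell_inner_mul_le (hL : LipschitzWith K h) (v : E) (hε1 : ε < 1) :
    ∫ w in openShell E (1 - ε), inner ℝ (‖w‖⁻¹ • w) v * h w ∂μ ≤
      ∫ w in openShell E (1 - ε),
        (inner ℝ (‖w‖⁻¹ • w) v * h (‖w‖⁻¹ • w) + K * ε * ‖v‖) ∂μ := by
  have hcont := hL.continuous
  have hfinite : μ (openShell E (1 - ε)) ≠ ⊤ :=
    measure_ne_top_of_subset Set.sdiff_subset measure_ball_lt_top.ne
  have hmem : ∀ᵐ w ∂μ.restrict (openShell E (1 - ε)), w ∈ openShell E (1 - ε) :=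
    ae_restrict_mem measurableSet_openShell
  refine setIntegral_mono_on (.of_bound hfinite.lt_top (by fun_prop) (‖v‖ * (|h 0| + K)) ?_)
    (.add (.of_bound hfinite.lt_top (by fun_prop) (‖v‖ * (|h 0| + K)) ?_)
      (integrableOn_const hfinite))
    measurableSet_openShell fun w hw => inner_direction_mul_le_of_mem_openShell hL hε1 hw
  · filter_upwards [hmem] with w hw
    exact abs_inner_mul_le_of_lipschitzWith hL (norm_inv_norm_smul_le w) (mem_openShell.1 hw).2.le
  · exact .of_forall fun w =>
      abs_inner_mul_le_of_lipschitzWith hL (norm_inv_norm_smul_le w) (norm_inv_norm_smul_le w)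

end DivergenceOnBall

section Sphere

open Metric Filter Topology
open scoped NNReal

variable {n : ℕ}

lemma integral_uniformSphere (g : Act n → ℝ) :
    ∫ u, g u ∂uniformSphere n =
      ((volume : Measure (Act n)).toSphere.real Set.univ)⁻¹ *
        ∫ u : sphere (0 : Act n) 1, g u ∂(volume : Measure (Act n)).toSphere := by
  rw [uniformSphere, (MeasurableEmbedding.subtype_coe isClosed_sphere.measurableSet).integral_map,
    integral_smul_measure, ENNReal.toReal_inv, measureReal_def, smul_eq_mul]

lemma ae_uniformSphere_norm_eq_one : ∀ᵐ u ∂uniformSphere n, ‖u‖ = 1 := by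
  rw [uniformSphere, ae_map_iff measurable_subtype_coe.aemeasurable
    (measurableSet_eq_fun measurable_norm measurable_const)]
  exact .of_forall fun u => by simp

lemma add_smul_mem_of_closedBall_subset {X : Set (Act n)} {δ : ℝ} {p w : Act n} (hδ : 0 ≤ δ)
    (hp : closedBall p δ ⊆ X) (hw : ‖w‖ ≤ 1) : p + δ • w ∈ X := by
  refine hp ?_
  rw [mem_closedBall_iff_norm, add_sub_cancel_left, norm_smul, Real.norm_of_nonneg hδ]
  exact mul_le_of_le_one_right hδ hw

lemma add_smul_sub_smul_eq {δ : ℝ} (hδ : δ ≠ 0) (x y w : Act n) (s : ℝ) :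
    x + δ • (w - s • δ⁻¹ • (x - y)) = (1 - s) • (x + δ • w) + s • (y + δ • w) := by
  rw [smul_sub, smul_comm δ s, smul_inv_smul₀ hδ]
  module

variable [Nontrivial (Act n)]

lemma toSphere_univ_ne_zero : (volume : Measure (Act n)).toSphere Set.univ ≠ 0 :=
  Measure.measure_univ_ne_zero.2 (Measure.toSphere_ne_zero _)

instance isProbabilityMeasure_uniformSphere : IsProbabilityMeasure (uniformSphere n) where
  measure_univ := by
    rw [uniformSphere, Measure.map_apply measurable_subtype_coe MeasurableSet.univ,
      Set.preimage_univ, Measure.smul_apply, smul_eq_mul]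
    exact ENNReal.inv_mul_cancel toSphere_univ_ne_zero (measure_ne_top _ _)

lemma setIntegral_openShell_comp_direction (g : Act n → ℝ) (r : ℝ) :
    ∫ w in openShell (Act n) r, g (‖w‖⁻¹ • w) =
      volume.real (openShell (Act n) r) * ∫ u, g u ∂uniformSphere n := by
  have hpos : (volume : Measure (Act n)).toSphere.real Set.univ ≠ 0 :=
    ENNReal.toReal_ne_zero.2 ⟨toSphere_univ_ne_zero, measure_ne_top _ _⟩
  rw [integral_uniformSphere, mul_left_comm,
    ← toSphere_mul_setIntegral_openShell_comp_direction, inv_mul_cancel_left₀ hpos]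

variable {K : ℝ≥0} {h : Act n → ℝ} {v : Act n}

lemma integrable_inner_mul_uniformSphere (hL : LipschitzWith K h) (v : Act n) :
    Integrable (fun u => inner ℝ u v * h u) (uniformSphere n) := by
  have hcont := hL.continuous
  refine .of_bound (by fun_prop) (‖v‖ * (|h 0| + K)) ?_
  filter_upwards [ae_uniformSphere_norm_eq_one] with u hu
  exact abs_inner_mul_le_of_lipschitzWith hL hu.le hu.le

lemma integral_radialCutoff_mul_le_integral_uniformSphere (hL : LipschitzWith K h)
    (hc : ∀ w, ‖w‖ < 1 → ∀ s ∈ Set.Icc (0 : ℝ) 1,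
      h (w - s • v) ≤ (1 - s) * h w + s * h (w - v)) {ε : ℝ} (hε : 0 < ε) (hε1 : ε < 1) :
    (∫ w : Act n, radialCutoff ε w) * (h 0 - h (-v) - 2 * K) ≤
      volume.real (ball (0 : Act n) 1) * ((∑ k ∈ Finset.range n, (1 - ε) ^ k) *
        ((∫ u, inner ℝ u v * h u ∂uniformSphere n) + K * ε * ‖v‖)) := by
  set I := ∫ u, inner ℝ u v * h u ∂uniformSphere n
  have hgeom : 1 - (1 - ε) ^ n = ε * ∑ k ∈ Finset.range n, (1 - ε) ^ k := by
    rw [← mul_neg_geom_sum, sub_sub_cancel]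
  calc (∫ w : Act n, radialCutoff ε w) * (h 0 - h (-v) - 2 * K)
      ≤ ∫ w, lineDeriv ℝ h w v * radialCutoff ε w :=
        integral_radialCutoff_mul_le_integral_lineDeriv_mul hL hc hε
    _ = ε⁻¹ * ∫ w in openShell (Act n) (1 - ε), inner ℝ (‖w‖⁻¹ • w) v * h w :=
        integral_lineDeriv_mul_radialCutoff hL v hε hε1
    _ ≤ ε⁻¹ * ∫ w in openShell (Act n) (1 - ε),
          (inner ℝ (‖w‖⁻¹ • w) v * h (‖w‖⁻¹ • w) + K * ε * ‖v‖) :=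
        mul_le_mul_of_nonneg_left (setIntegral_openShell_inner_mul_le hL v hε1)
          (inv_nonneg.2 hε.le)
    _ = ε⁻¹ * (volume.real (openShell (Act n) (1 - ε)) * (I + K * ε * ‖v‖)) := by
        rw [setIntegral_openShell_comp_direction (fun u => inner ℝ u v * h u + K * ε * ‖v‖),
          integral_add (integrable_inner_mul_uniformSphere hL v) (integrable_const _),
          integral_const, probReal_univ, one_smul]
    _ = _ := by
        rw [measureReal_openShell _ (sub_nonneg.2 hε1.le) (sub_lt_self _ hε),
          finrank_euclideanSpace_fin, hgeom]
        field_simp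

lemma sub_le_integral_uniformSphere_of_convex_segment (hL : LipschitzWith K h)
    (hc : ∀ w, ‖w‖ < 1 → ∀ s ∈ Set.Icc (0 : ℝ) 1,
      h (w - s • v) ≤ (1 - s) * h w + s * h (w - v)) :
    h 0 - h (-v) - 2 * K ≤ n * ∫ u, inner ℝ u v * h u ∂uniformSphere n := by
  set ω := volume.real (ball (0 : Act n) 1)
  set I := ∫ u, inner ℝ u v * h u ∂uniformSphere n
  have hω : 0 < ω := ENNReal.toReal_pos (measure_ball_pos _ _ one_pos).ne' measure_ball_lt_top.ne
  have hleft : Tendsto (fun ε => (∫ w : Act n, radialCutoff ε w) * (h 0 - h (-v) - 2 * K))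
      (𝓝[>] 0) (𝓝 (ω * (h 0 - h (-v) - 2 * K))) :=
    tendsto_integral_radialCutoff.mul_const _
  have hright : Tendsto
      (fun ε : ℝ => ω * ((∑ k ∈ Finset.range n, (1 - ε) ^ k) * (I + K * ε * ‖v‖)))
      (𝓝[>] 0) (𝓝 (ω * (n * I))) := by
    have hcont : Continuous fun ε : ℝ =>
        ω * ((∑ k ∈ Finset.range n, (1 - ε) ^ k) * (I + K * ε * ‖v‖)) := by fun_prop
    simpa using (hcont.tendsto 0).mono_left nhdsWithin_le_nhds
  refine le_of_mul_le_mul_left (le_of_tendsto_of_tendsto hleft hright ?_) hω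
  filter_upwards [Ioo_mem_nhdsGT (zero_lt_one' ℝ)] with ε hε
  exact integral_radialCutoff_mul_le_integral_uniformSphere hL hc hε.1 hε.2

lemma sub_le_integral_uniformSphere_of_lipschitzWith {X : Set (Act n)} {f : Act n → ℝ} {δ : ℝ}
    (hδ : 0 < δ) (hf : ConvexOn ℝ X f) (hL : LipschitzWith K f) {x y : Act n}
    (hx : closedBall x δ ⊆ X) (hy : closedBall y δ ⊆ X) :
    f x - f y ≤ n / δ * (∫ u, f (x + δ • u) * inner ℝ u (x - y) ∂uniformSphere n) + 2 * K * δ := by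
  set v := δ⁻¹ • (x - y) with hv
  set h : Act n → ℝ := fun w => f (x + δ • w)
  have hshift (w : Act n) : x + δ • (w - v) = y + δ • w := by
    simpa using add_smul_sub_smul_eq hδ.ne' x y w 1
  have hLip : LipschitzWith (K * Real.toNNReal δ) h := hL.comp <| .of_dist_le' fun a b => by
    rw [dist_add_left, dist_smul₀, Real.norm_of_nonneg hδ.le]
  have hconvex : ∀ w, ‖w‖ < 1 → ∀ s ∈ Set.Icc (0 : ℝ) 1,
      h (w - s • v) ≤ (1 - s) * h w + s * h (w - v) := fun w hw s hs => by
    simp only [h]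
    rw [hshift, hv, add_smul_sub_smul_eq hδ.ne']
    exact hf.2 (add_smul_mem_of_closedBall_subset hδ.le hx hw.le)
      (add_smul_mem_of_closedBall_subset hδ.le hy hw.le) (sub_nonneg.2 hs.2) hs.1 (by ring)
  have hzero : h 0 = f x := by simp only [h, smul_zero, add_zero]
  have hneg : h (-v) = f y := by
    rw [← zero_sub]
    simp only [h, hshift, smul_zero, add_zero]
  have hintegral : ∫ u, inner ℝ u v * h u ∂uniformSphere n =
      δ⁻¹ * ∫ u, f (x + δ • u) * inner ℝ u (x - y) ∂uniformSphere n := by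
    rw [← integral_const_mul]
    refine integral_congr_ae (.of_forall fun u => ?_)
    simp only [h, hv, real_inner_smul_right]
    ring
  have hsphere := sub_le_integral_uniformSphere_of_convex_segment hLip hconvex
  rw [hzero, hneg, hintegral, NNReal.coe_mul, Real.coe_toNNReal _ hδ.le] at hsphere
  rw [div_eq_mul_inv, mul_assoc]
  linarith

lemma sub_le_integral_uniformSphere {X : Set (Act n)} {f : Act n → ℝ} {L δ : ℝ}
    (hL0 : 0 ≤ L) (hδ : 0 < δ) (hf : ConvexOn ℝ X f)
    (hL : ∀ x ∈ X, ∀ y ∈ X, |f x - f y| ≤ L * ‖x - y‖) {x y : Act n}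
    (hx : closedBall x δ ⊆ X) (hy : closedBall y δ ⊆ X) :
    f x - f y ≤ n / δ * (∫ u, f (x + δ • u) * inner ℝ u (x - y) ∂uniformSphere n) + 2 * L * δ := by
  have hLip : LipschitzOnWith (Real.toNNReal L) f X := .of_dist_le_mul fun a ha b hb => by
    rw [Real.coe_toNNReal _ hL0, Real.dist_eq, dist_eq_norm]
    exact hL a ha b hb
  obtain ⟨F, hF, hfF⟩ := hLip.extend_real
  have hintegral : ∫ u, f (x + δ • u) * inner ℝ u (x - y) ∂uniformSphere n =
      ∫ u, F (x + δ • u) * inner ℝ u (x - y) ∂uniformSphere n := by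
    refine integral_congr_ae ?_
    filter_upwards [ae_uniformSphere_norm_eq_one] with u hu
    rw [hfF (add_smul_mem_of_closedBall_subset hδ.le hx hu.le)]
  have hextension := sub_le_integral_uniformSphere_of_lipschitzWith hδ (hf.congr hfF) hF hx hy
  rwa [hfF (hx (mem_closedBall_self hδ.le)), hfF (hy (mem_closedBall_self hδ.le)), hintegral,
    ← Real.coe_toNNReal L hL0]

end Sphere

namespace RiskGame

variable {N : ℕ} {G : RiskGame N} {Dx U L₀ : ℝ}

/-- The projection onto the joint action space. Composing with it extends functions that are only
controlled on the action space to all profiles, which keeps measurability questions trivial. -/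
def retract (G : RiskGame N) (x : Profile G.d) : Profile G.d :=
  WithLp.toLp 2 fun i => nearestPoint (G.X i) (x i)

lemma retract_mem_joint (hS : G.Standing Dx) (hne : ∀ i, (G.X i).Nonempty) (x : Profile G.d) :
    G.retract x ∈ G.joint := fun i => (nearestPoint_spec (hne i) (hS.closed i) (x i)).1

lemma retract_eq_self (hS : G.Standing Dx) {x : Profile G.d} (hx : x ∈ G.joint) :
    G.retract x = x := by
  ext i : 1
  exact nearestPoint_eq_self ⟨_, hx i⟩ (hS.closed i) (hx i)

lemma continuous_retract (hS : G.Standing Dx) (hne : ∀ i, (G.X i).Nonempty) :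
    Continuous G.retract := by
  refine (PiLp.continuous_toLp 2 _).comp (continuous_pi fun i => ?_)
  exact (lipschitzWith_nearestPoint (hne i) (hS.closed i) (hS.convex i)).continuous.comp
    (PiLp.continuous_apply 2 _ i)

lemma continuous_comp_retract (hS : G.Standing Dx) (hne : ∀ i, (G.X i).Nonempty)
    {f : Profile G.d → ℝ} (hf : ∀ x ∈ G.joint, ∀ y ∈ G.joint, |f x - f y| ≤ L₀ * ‖x - y‖) :
    Continuous fun x => f (G.retract x) := by
  have hlip : LipschitzOnWith (Real.toNNReal L₀) f G.joint := .of_dist_le' fun x hx y hy => by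
    rw [Real.dist_eq, dist_eq_norm]
    exact hf x hx y hy
  exact hlip.continuousOn.comp_continuous (continuous_retract hS hne) (retract_mem_joint hS hne)

lemma continuous_C_retract (hS : G.Standing Dx) (hne : ∀ i, (G.X i).Nonempty)
    (hJ : G.ConvexBounded U) (hL : G.LipschitzCost L₀) (i : Fin N) :
    Continuous fun x => G.C i (G.retract x) :=
  continuous_comp_retract hS hne fun _ hx _ hy => abs_C_sub_C_le hS hJ hL i hx hy

lemma measurable_J_retract (hS : G.Standing Dx) (hne : ∀ i, (G.X i).Nonempty)
    (hL : G.LipschitzCost L₀) (i : Fin N) :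
    Measurable fun q : Profile G.d × G.Ξ i => G.J i (G.retract q.1) q.2 :=
  measurable_uncurry_of_continuous_of_measurable (u := fun x ξ => G.J i (G.retract x) ξ)
    (fun ξ => continuous_comp_retract hS hne (hL i ξ))
    (fun x => hS.measurable_cost i _ (retract_mem_joint hS hne x))

lemma edf_eq_sum_indicator_Ici (i : Fin N) (n : ℕ) (x : Profile G.d) (ξ : ℕ → G.Ξ i) (y : ℝ) :
    G.edf i n x ξ y =
      (1 / (n : ℝ)) * ∑ j ∈ Finset.range n, (Set.Ici (G.J i x (ξ j))).indicator 1 y := by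
  simp only [edf, Set.indicator_apply, Set.mem_ofPred_eq, Set.mem_Ici, Pi.one_apply]

lemma isCostCDF_edf (hJ : G.ConvexBounded U) (i : Fin N) {n : ℕ} (hn : 0 < n) {x : Profile G.d}
    (hx : x ∈ G.joint) (ξ : ℕ → G.Ξ i) : IsCostCDF U (G.edf i n x ξ) := by
  have hn' : (0 : ℝ) < n := by exact_mod_cast hn
  have hcost (j : ℕ) := abs_le.1 ((hJ i (ξ j)).2 x hx)
  simp only [funext (edf_eq_sum_indicator_Ici i n x ξ)]
  refine ⟨?_, fun y => ?_, fun y => ?_, fun y hy => ?_, fun y hy => ?_⟩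
  · exact (Finset.measurable_fun_sum _ fun j _ =>
      measurable_one.indicator measurableSet_Ici).const_mul _
  · exact mul_nonneg (by positivity)
      (Finset.sum_nonneg fun j _ => Set.indicator_nonneg (fun _ _ => zero_le_one) _)
  · rw [one_div, inv_mul_eq_div, div_le_one hn']
    refine (Finset.sum_le_card_nsmul _ _ 1 fun j _ => ?_).trans_eq (by simp)
    exact Set.indicator_le' (fun _ _ => le_rfl) (fun _ _ => zero_le_one) _
  · rw [Finset.sum_eq_zero, mul_zero]
    exact fun j _ => Set.indicator_of_notMem (fun h => by linarith [Set.mem_Ici.1 h, hcost j]) _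
  · have hind (j : ℕ) : (Set.Ici (G.J i x (ξ j))).indicator (1 : ℝ → ℝ) y = 1 :=
      Set.indicator_of_mem (Set.mem_Ici.2 ((hcost j).2.trans hy)) _
    simp [hind, hn'.ne']

end RiskGame

/-- Parameters for which `T` episodes of the algorithm make sense: positive step sizes, positive
perturbation, momentum in `[0, 1]`, and at least one sample in each episode. -/
structure Params.Admissible {N : ℕ} (p : Params N) (T : ℕ) : Prop where
  step_pos : ∀ i, 0 < p.η i
  radius_pos : 0 < p.δ
  momentum_nonneg : 0 ≤ p.β
  momentum_le_one : p.β ≤ 1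
  sampleSize_pos : ∀ t, 1 ≤ t → t ≤ T → 0 < p.n t

namespace RiskGame

variable {N : ℕ} {G : RiskGame N} {Dx U L₀ C₀ : ℝ}

section Trajectory

variable {p : Params N} {x₁ : Profile G.d} {v₀ : Fin N → ℝ} {u : (i : Fin N) → ℕ → Act (G.d i)}
  {ξ : (i : Fin N) → ℕ → ℕ → G.Ξ i} {T : ℕ}

lemma state_x_mem (hS : G.Standing Dx) (hx₁ : ∀ i, x₁ i ∈ shrink (G.X i) p.δ) (t : ℕ) (i : Fin N) :
    (G.state p x₁ v₀ u ξ t).x i ∈ shrink (G.X i) p.δ := by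
  cases t with
  | zero => exact hx₁ i
  | succ t => exact (nearestPoint_spec ⟨_, hx₁ i⟩ (isClosed_shrink (hS.closed i)) _).1

lemma played_apply (t : ℕ) (i : Fin N) : G.played p x₁ v₀ u ξ (t + 1) i =
    (G.state p x₁ v₀ u ξ t).x i + p.δ • u i (t + 1) := by
  simp [played, perturb]

lemma played_mem_joint (hS : G.Standing Dx) (hδ : 0 ≤ p.δ)
    (hx₁ : ∀ i, x₁ i ∈ shrink (G.X i) p.δ) (hu : ∀ i t, ‖u i t‖ = 1) (t : ℕ) :
    G.played p x₁ v₀ u ξ t ∈ G.joint := fun i =>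
  add_smul_mem_of_closedBall_subset hδ
    (closedBall_subset_of_mem_shrink (hS.closed i) (state_x_mem hS hx₁ _ i)) (hu i t).le

lemma state_one_Fbar (i : Fin N) : (G.state p x₁ v₀ u ξ 1).Fbar i =
    G.edf i (p.n 1) (G.played p x₁ v₀ u ξ 1) (ξ i 1) := by
  ext y
  simp [state, episode, momentumEdf, played]

lemma state_succ_succ_Fbar (t : ℕ) (i : Fin N) :
    (G.state p x₁ v₀ u ξ (t + 1 + 1)).Fbar i = fun y =>
      p.β * (G.state p x₁ v₀ u ξ (t + 1)).Fbar i y + (1 - p.β) *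
        G.edf i (p.n (t + 1 + 1)) (G.played p x₁ v₀ u ξ (t + 1 + 1)) (ξ i (t + 1 + 1)) y := by
  ext y
  rw [state]
  simp [episode, momentumEdf, played]

lemma isCostCDF_edf_played (hS : G.Standing Dx) (hJ : G.ConvexBounded U) (hp : p.Admissible T)
    (hx₁ : ∀ i, x₁ i ∈ shrink (G.X i) p.δ) (hu : ∀ i t, ‖u i t‖ = 1) (i : Fin N) {t : ℕ}
    (ht : t < T) : IsCostCDF U
      (G.edf i (p.n (t + 1)) (G.played p x₁ v₀ u ξ (t + 1)) (ξ i (t + 1))) :=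
  isCostCDF_edf hJ i (hp.sampleSize_pos _ t.succ_pos ht)
    (played_mem_joint hS hp.radius_pos.le hx₁ hu _) _

lemma isCostCDF_Fbar (hS : G.Standing Dx) (hJ : G.ConvexBounded U) (hp : p.Admissible T)
    (hx₁ : ∀ i, x₁ i ∈ shrink (G.X i) p.δ) (hu : ∀ i t, ‖u i t‖ = 1) (i : Fin N) {t : ℕ}
    (ht : t < T) : IsCostCDF U ((G.state p x₁ v₀ u ξ (t + 1)).Fbar i) := by
  have hedf := isCostCDF_edf_played (v₀ := v₀) (ξ := ξ) hS hJ hp hx₁ hu i ht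
  induction t with
  | zero => rwa [state_one_Fbar]
  | succ t ih =>
    rw [state_succ_succ_Fbar]
    exact (ih (by omega) (isCostCDF_edf_played hS hJ hp hx₁ hu i (by omega))).convexCombination
      hedf hp.momentum_nonneg hp.momentum_le_one

lemma abs_est_le (hS : G.Standing Dx) (hJ : G.ConvexBounded U) (hp : p.Admissible T)
    (hx₁ : ∀ i, x₁ i ∈ shrink (G.X i) p.δ) (hv₀ : ∀ i, |v₀ i| ≤ U) (hu : ∀ i t, ‖u i t‖ = 1)
    (i : Fin N) {t : ℕ} (ht : t ≤ T) : |(G.state p x₁ v₀ u ξ t).est i| ≤ U := by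
  cases t with
  | zero => exact hv₀ i
  | succ t =>
    exact (isCostCDF_Fbar hS hJ hp hx₁ hu i ht).abs_cvar_le (hS.level_pos i) (hS.level_le_one i)

end Trajectory

section GradientNoise

variable (G)

/-- The gradient estimate in expectation over the direction of agent `i`, at the profile `q`: the
gradient of a smoothing of `C i`. The residual does not appear, as directions have mean zero. -/
def smoothGrad (δ : ℝ) (i : Fin N) (q : Profile G.d) : Act (G.d i) :=
  ((G.d i : ℝ) / δ) •
    ∫ b, G.C i (G.retract (replaceAction q i (q i + δ • b))) • b ∂uniformSphere (G.d i)

/-- The noise of the gradient estimate with direction `b` and residual `c`, computed with the true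
conditional value at risk. -/
def gradNoise (δ : ℝ) (i : Fin N) (q : Profile G.d) (c : ℝ) (b : Act (G.d i)) :
    Act (G.d i) :=
  G.smoothGrad δ i q -
    ((G.d i : ℝ) / δ * (G.C i (G.retract (replaceAction q i (q i + δ • b))) - c)) • b

variable (p : Params N) (x₁ : Profile G.d) (v₀ : Fin N → ℝ)
  (u : (i : Fin N) → ℕ → Act (G.d i)) (ξ : (i : Fin N) → ℕ → ℕ → G.Ξ i)

/-- The gradient estimate of agent `i` in episode `t + 1`. -/
def gradAt (i : Fin N) (t : ℕ) : Act (G.d i) :=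
  G.gradEstimate p (t + 1) (G.state p x₁ v₀ u ξ t) (fun k => u k (t + 1)) (fun k => ξ k (t + 1)) i

/-- The profile of episode `t + 1` before agent `i` perturbs its action. -/
def baseProfile (i : Fin N) (t : ℕ) : Profile G.d :=
  replaceAction (G.played p x₁ v₀ u ξ (t + 1)) i ((G.state p x₁ v₀ u ξ t).x i)

/-- The gradient noise of agent `i` in episode `t + 1`. -/
def noiseAt (i : Fin N) (t : ℕ) : Act (G.d i) :=
  G.gradNoise p.δ i (G.baseProfile p x₁ v₀ u ξ i t) ((G.state p x₁ v₀ u ξ t).est i) (u i (t + 1))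

/-- Projected gradient descent driven by the gradient noise instead of the gradient estimates. The
comparator in the regret may depend on the whole run; following this sequence in its place leaves a
martingale, up to the regret of the sequence itself. -/
def ghost (i : Fin N) : ℕ → Act (G.d i)
  | 0 => x₁ i
  | t + 1 => nearestPoint (shrink (G.X i) p.δ)
      (ghost i t - p.η i • G.noiseAt p x₁ v₀ u ξ i t)

/-- The scalar martingale increment of the gradient noise. -/
def noiseIncrement (i : Fin N) (t : ℕ) : ℝ :=
  inner ℝ (G.noiseAt p x₁ v₀ u ξ i t)
    ((G.state p x₁ v₀ u ξ t).x i - G.ghost p x₁ v₀ u ξ i t)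

end GradientNoise

section SmoothGradient

variable {δ : ℝ} (i : Fin N) (q : Profile G.d)

lemma nontrivial_act (hS : G.Standing Dx) : Nontrivial (Act (G.d i)) := by
  have : Nonempty (Fin (G.d i)) := ⟨⟨0, hS.dim_pos i⟩⟩
  infer_instance

lemma continuous_replaceAction {d : Fin N → ℕ} (i : Fin N) :
    Continuous fun q : Profile d × Act (d i) => replaceAction q.1 i q.2 := by
  refine (PiLp.continuous_toLp 2 _).comp (Continuous.update ?_ i continuous_snd)
  exact continuous_pi fun k => (PiLp.continuous_apply 2 _ k).comp continuous_fst

lemma continuous_C_perturbed (hS : G.Standing Dx) (hne : ∀ i, (G.X i).Nonempty)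
    (hJ : G.ConvexBounded U) (hL : G.LipschitzCost L₀) (δ : ℝ) :
    Continuous fun q : Profile G.d × Act (G.d i) =>
      G.C i (G.retract (replaceAction q.1 i (q.1 i + δ • q.2))) := by
  have haction : Continuous fun q : Profile G.d × Act (G.d i) => q.1 i + δ • q.2 :=
    ((PiLp.continuous_apply 2 _ i).comp continuous_fst).add (continuous_snd.const_smul δ)
  have hprofile : Continuous fun q : Profile G.d × Act (G.d i) =>
      replaceAction q.1 i (q.1 i + δ • q.2) :=
    Continuous.comp (g := fun q : Profile G.d × Act (G.d i) => replaceAction q.1 i q.2)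
      (f := fun q : Profile G.d × Act (G.d i) => (q.1, q.1 i + δ • q.2))
      (continuous_replaceAction i) (continuous_fst.prodMk haction)
  exact (continuous_C_retract hS hne hJ hL i).comp hprofile

lemma norm_smoothGrad_le (hS : G.Standing Dx) (hne : ∀ i, (G.X i).Nonempty)
    (hJ : G.ConvexBounded U) (hδ : 0 < δ) : ‖G.smoothGrad δ i q‖ ≤ G.d i / δ * U := by
  have := nontrivial_act i hS
  rw [smoothGrad, norm_smul, Real.norm_of_nonneg (by positivity)]
  refine mul_le_mul_of_nonneg_left ?_ (by positivity)
  refine (norm_integral_le_of_norm_le_const (C := U) ?_).trans_eq (by simp)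
  filter_upwards [ae_uniformSphere_norm_eq_one] with b hb
  rw [norm_smul, hb, mul_one]
  exact abs_C_le hS hJ i (retract_mem_joint hS hne _)

lemma norm_gradNoise_le (hS : G.Standing Dx) (hne : ∀ i, (G.X i).Nonempty)
    (hJ : G.ConvexBounded U) (hδ : 0 < δ) {c : ℝ} (hc : |c| ≤ U) {b : Act (G.d i)}
    (hb : ‖b‖ = 1) : ‖G.gradNoise δ i q c b‖ ≤ G.d i / δ * (3 * U) := by
  calc ‖G.gradNoise δ i q c b‖ ≤ G.d i / δ * U + G.d i / δ * (U + U) := by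
        refine (norm_sub_le _ _).trans (add_le_add (norm_smoothGrad_le i q hS hne hJ hδ) ?_)
        rw [norm_smul, hb, mul_one, norm_mul, Real.norm_of_nonneg (by positivity)]
        refine mul_le_mul_of_nonneg_left ((norm_sub_le _ _).trans ?_) (by positivity)
        exact add_le_add (abs_C_le hS hJ i (retract_mem_joint hS hne _)) hc
    _ = G.d i / δ * (3 * U) := by ring

lemma integrable_C_smul (hS : G.Standing Dx) (hne : ∀ i, (G.X i).Nonempty)
    (hJ : G.ConvexBounded U) (hL : G.LipschitzCost L₀) (δ : ℝ) :
    Integrable (fun b => G.C i (G.retract (replaceAction q i (q i + δ • b))) • b)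
      (uniformSphere (G.d i)) := by
  have := nontrivial_act i hS
  have hcont : Continuous fun b => G.C i (G.retract (replaceAction q i (q i + δ • b))) :=
    Continuous.comp (g := fun q : Profile G.d × Act (G.d i) =>
        G.C i (G.retract (replaceAction q.1 i (q.1 i + δ • q.2)))) (f := fun b => (q, b))
      (continuous_C_perturbed i hS hne hJ hL δ) (Continuous.prodMk_right q)
  refine Integrable.of_bound (hcont.smul continuous_id).aestronglyMeasurable U ?_
  filter_upwards [ae_uniformSphere_norm_eq_one] with b hb
  rw [norm_smul, hb, mul_one]
  exact abs_C_le hS hJ i (retract_mem_joint hS hne _)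

lemma inner_smoothGrad (hS : G.Standing Dx) (hne : ∀ i, (G.X i).Nonempty)
    (hJ : G.ConvexBounded U) (hL : G.LipschitzCost L₀) (δ : ℝ) (w : Act (G.d i)) :
    inner ℝ (G.smoothGrad δ i q) w = G.d i / δ *
      ∫ b, G.C i (G.retract (replaceAction q i (q i + δ • b))) * inner ℝ b w
        ∂uniformSphere (G.d i) := by
  rw [smoothGrad, real_inner_smul_left, real_inner_comm,
    ← integral_inner (integrable_C_smul i q hS hne hJ hL δ)]
  simp_rw [inner_smul_right, real_inner_comm]

variable {q} in
lemma C_sub_C_le_inner_smoothGrad (hS : G.Standing Dx) (hJ : G.ConvexBounded U) (hL0 : 0 ≤ L₀)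
    (hL : G.LipschitzCost L₀) (hδ : 0 < δ) (hq : q ∈ G.joint) (hqi : q i ∈ shrink (G.X i) δ)
    {y : Act (G.d i)} (hy : y ∈ shrink (G.X i) δ) :
    G.C i q - G.C i (replaceAction q i y) ≤
      inner ℝ (G.smoothGrad δ i q) (q i - y) + 2 * L₀ * δ := by
  have := nontrivial_act i hS
  have hball := closedBall_subset_of_mem_shrink (hS.closed i) hqi
  have hlip : ∀ a ∈ G.X i, ∀ b ∈ G.X i,
      |G.C i (replaceAction q i a) - G.C i (replaceAction q i b)| ≤ L₀ * ‖a - b‖ := by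
    intro a ha b hb
    rw [← norm_replaceAction_sub q i]
    exact abs_C_sub_C_le hS hJ hL i (replaceAction_mem_joint hq ha) (replaceAction_mem_joint hq hb)
  have hretract : ∫ b, G.C i (G.retract (replaceAction q i (q i + δ • b))) * inner ℝ b (q i - y)
        ∂uniformSphere (G.d i) =
      ∫ b, G.C i (replaceAction q i (q i + δ • b)) * inner ℝ b (q i - y)
        ∂uniformSphere (G.d i) := by
    refine integral_congr_ae ?_
    filter_upwards [ae_uniformSphere_norm_eq_one] with b hb
    rw [retract_eq_self hS (replaceAction_mem_joint hq
      (add_smul_mem_of_closedBall_subset hδ.le hball hb.le))]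
  have hsphere := sub_le_integral_uniformSphere hL0 hδ (convexOn_C hS hJ i hq) hlip hball
    (closedBall_subset_of_mem_shrink (hS.closed i) hy)
  rwa [replaceAction_self, ← hretract, ← inner_smoothGrad i q hS (fun i => ⟨_, hq i⟩) hJ hL]
    at hsphere

end SmoothGradient

section TrajectoryBounds

variable {p : Params N} {x₁ : Profile G.d} {v₀ : Fin N → ℝ} {u : (i : Fin N) → ℕ → Act (G.d i)}
  {ξ : (i : Fin N) → ℕ → ℕ → G.Ξ i} {T : ℕ}

lemma ghost_mem (hS : G.Standing Dx) (hx₁ : ∀ i, x₁ i ∈ shrink (G.X i) p.δ) (i : Fin N) (t : ℕ) :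
    G.ghost p x₁ v₀ u ξ i t ∈ shrink (G.X i) p.δ := by
  cases t with
  | zero => exact hx₁ i
  | succ t => exact (nearestPoint_spec ⟨_, hx₁ i⟩ (isClosed_shrink (hS.closed i)) _).1

@[simp] lemma baseProfile_apply (t : ℕ) (i : Fin N) :
    G.baseProfile p x₁ v₀ u ξ i t i = (G.state p x₁ v₀ u ξ t).x i := by
  simp [baseProfile]

lemma replaceAction_baseProfile (t : ℕ) (i : Fin N) :
    replaceAction (G.baseProfile p x₁ v₀ u ξ i t) i
      ((G.state p x₁ v₀ u ξ t).x i + p.δ • u i (t + 1)) = G.played p x₁ v₀ u ξ (t + 1) := by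
  rw [baseProfile, replaceAction_replaceAction, ← played_apply, replaceAction_self]

lemma norm_noiseAt_le (hS : G.Standing Dx) (hJ : G.ConvexBounded U) (hp : p.Admissible T)
    (hx₁ : ∀ i, x₁ i ∈ shrink (G.X i) p.δ) (hv₀ : ∀ i, |v₀ i| ≤ U) (hu : ∀ i t, ‖u i t‖ = 1)
    (i : Fin N) {t : ℕ} (ht : t < T) :
    ‖G.noiseAt p x₁ v₀ u ξ i t‖ ≤ G.d i / p.δ * (3 * U) :=
  norm_gradNoise_le i _ hS (fun i => ⟨_, (hx₁ i).1⟩) hJ hp.radius_pos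
    (abs_est_le hS hJ hp hx₁ hv₀ hu i ht.le) (hu i _)

lemma abs_noiseIncrement_le (hS : G.Standing Dx) (hJ : G.ConvexBounded U) (hp : p.Admissible T)
    (hx₁ : ∀ i, x₁ i ∈ shrink (G.X i) p.δ) (hv₀ : ∀ i, |v₀ i| ≤ U) (hu : ∀ i t, ‖u i t‖ = 1)
    (i : Fin N) {t : ℕ} (ht : t < T) :
    |G.noiseIncrement p x₁ v₀ u ξ i t| ≤ G.d i / p.δ * (3 * U) * Dx := by
  have hnoise := norm_noiseAt_le (ξ := ξ) hS hJ hp hx₁ hv₀ hu i ht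
  have hdist := hS.diam_le i _ (state_x_mem (v₀ := v₀) (u := u) (ξ := ξ) hS hx₁ t i).1 _
    (ghost_mem (v₀ := v₀) (u := u) (ξ := ξ) hS hx₁ i t).1
  rw [dist_eq_norm] at hdist
  exact (abs_real_inner_le_norm _ _).trans
    (mul_le_mul hnoise hdist (norm_nonneg _) ((norm_nonneg _).trans hnoise))

lemma norm_gradAt_le (hS : G.Standing Dx) (hJ : G.ConvexBounded U) (hp : p.Admissible T)
    (hx₁ : ∀ i, x₁ i ∈ shrink (G.X i) p.δ) (hv₀ : ∀ i, |v₀ i| ≤ U) (hu : ∀ i t, ‖u i t‖ = 1)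
    (i : Fin N) {t : ℕ} (ht : t < T) :
    ‖G.gradAt p x₁ v₀ u ξ i t‖ ≤ G.d i / p.δ * (2 * U) := by
  have hδ := hp.radius_pos
  have hest := abs_est_le (ξ := ξ) hS hJ hp hx₁ hv₀ hu i ht.le
  have hest' := abs_est_le (ξ := ξ) hS hJ hp hx₁ hv₀ hu i (t := t + 1) ht
  rw [gradAt, gradEstimate, norm_smul, hu, mul_one, norm_mul,
    Real.norm_of_nonneg (by positivity), two_mul]
  exact mul_le_mul_of_nonneg_left ((norm_sub_le _ _).trans (add_le_add hest' hest)) (by positivity)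

lemma norm_state_succ_x_sub_le (hS : G.Standing Dx) (hJ : G.ConvexBounded U) (hp : p.Admissible T)
    (hx₁ : ∀ i, x₁ i ∈ shrink (G.X i) p.δ) (hv₀ : ∀ i, |v₀ i| ≤ U) (hu : ∀ i t, ‖u i t‖ = 1)
    (i : Fin N) {t : ℕ} (ht : t < T) :
    ‖(G.state p x₁ v₀ u ξ (t + 1)).x i - (G.state p x₁ v₀ u ξ t).x i‖ ≤
      p.η i * (G.d i / p.δ * (2 * U)) := by
  refine (norm_nearestPoint_sub_le ⟨_, hx₁ i⟩ (isClosed_shrink (hS.closed i))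
    (convex_shrink (hS.convex i) (hS.closed i) hp.radius_pos) _ (state_x_mem hS hx₁ t i)).trans ?_
  rw [sub_sub_cancel_left, norm_neg, norm_smul, Real.norm_of_nonneg (hp.step_pos i).le]
  exact mul_le_mul_of_nonneg_left (norm_gradAt_le hS hJ hp hx₁ hv₀ hu i ht) (hp.step_pos i).le

lemma norm_le_sqrt_mul_of_forall_norm_le {d : Fin N → ℕ} {x : Profile d} {r : ℝ} (hr : 0 ≤ r)
    (hx : ∀ i, ‖x i‖ ≤ r) : ‖x‖ ≤ √N * r := by
  rw [PiLp.norm_eq_of_L2, ← Real.sqrt_sq hr, ← Real.sqrt_mul (Nat.cast_nonneg _)]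
  refine Real.sqrt_le_sqrt ((Finset.sum_le_card_nsmul _ _ (r ^ 2) fun i _ => ?_).trans_eq (by simp))
  exact pow_le_pow_left₀ (norm_nonneg _) (hx i) 2

lemma norm_played_sub_played_le (hS : G.Standing Dx) (hJ : G.ConvexBounded U)
    (hp : p.Admissible T) (hx₁ : ∀ i, x₁ i ∈ shrink (G.X i) p.δ) (hv₀ : ∀ i, |v₀ i| ≤ U)
    (hu : ∀ i t, ‖u i t‖ = 1) {k : ℝ} (hk0 : 0 ≤ k)
    (hk : ∀ i, p.η i * (G.d i / p.δ * (2 * U)) ≤ k) {t : ℕ} (ht : t < T) :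
    ‖G.played p x₁ v₀ u ξ (t + 1 + 1) - G.played p x₁ v₀ u ξ (t + 1)‖ ≤
      √N * (2 * p.δ + k) := by
  have hδ := hp.radius_pos
  refine norm_le_sqrt_mul_of_forall_norm_le (by positivity) fun i => ?_
  have hstep := (norm_state_succ_x_sub_le (ξ := ξ) hS hJ hp hx₁ hv₀ hu i ht).trans (hk i)
  have hdir : ‖p.δ • u i (t + 1 + 1) - p.δ • u i (t + 1)‖ ≤ 2 * p.δ := by
    refine (norm_sub_le _ _).trans_eq ?_
    rw [norm_smul, norm_smul, hu, hu, Real.norm_of_nonneg hδ.le]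
    ring
  rw [PiLp.sub_apply, played_apply, played_apply, add_sub_add_comm]
  linarith [norm_add_le ((G.state p x₁ v₀ u ξ (t + 1)).x i - (G.state p x₁ v₀ u ξ t).x i)
    (p.δ • u i (t + 1 + 1) - p.δ • u i (t + 1))]

end TrajectoryBounds

end RiskGame

lemma sum_le_of_geometric_recursion {e W : ℕ → ℝ} {β k : ℝ} (hβ : β ≤ 1 / 2)
    (hk : 0 ≤ k) {T : ℕ} (he : ∀ t < T, 0 ≤ e t) (h0 : 0 < T → e 0 ≤ W 0)
    (hs : ∀ t, t + 1 < T → e (t + 1) ≤ β * e t + k + W (t + 1)) :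
    ∑ t ∈ Finset.range T, e t ≤ 2 * ∑ t ∈ Finset.range T, W t + 2 * T * k := by
  have hpartial : ∀ m, m + 1 ≤ T → ∑ t ∈ Finset.range (m + 1), e t + e m ≤
      2 * ∑ t ∈ Finset.range (m + 1), W t + 2 * (m + 1) * k := by
    intro m hm
    induction m with
    | zero =>
      simp only [zero_add, Finset.sum_range_one, Nat.cast_zero]
      linarith [h0 hm]
    | succ m ih =>
      have hdecay : β * e m ≤ 1 / 2 * e m := mul_le_mul_of_nonneg_right hβ (he m (by omega))
      rw [Finset.sum_range_succ, Finset.sum_range_succ (f := W)]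
      push_cast
      linarith [ih (by omega), hs m hm]
  rcases T with _ | m
  · simp
  · push_cast
    linarith [hpartial m le_rfl, he m (by omega)]

lemma IsCostCDF.integral_abs_convexCombination_sub_le {U β c : ℝ} {F E B C : ℝ → ℝ}
    (hF : IsCostCDF U F) (hE : IsCostCDF U E) (hB : IsCostCDF U B) (hC : IsCostCDF U C)
    (hβ0 : 0 ≤ β) (hβ1 : β ≤ 1) (hc : ∀ y, |B y - C y| ≤ c) :
    ∫ y, |β * F y + (1 - β) * E y - C y| ≤
      β * (∫ y, |F y - B y|) + β * (2 * U * c) + ∫ y, |E y - C y| := by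
  have hFB := (hF.integrable_sub hB).abs.const_mul β
  have hBC := (hB.integrable_sub hC).abs.const_mul β
  have hEC := (hE.integrable_sub hC).abs
  have hFBC : Integrable fun y => β * |F y - B y| + β * |B y - C y| := hFB.add hBC
  have hpointwise (y : ℝ) : |β * F y + (1 - β) * E y - C y| ≤
      β * |F y - B y| + β * |B y - C y| + |E y - C y| := by
    calc |β * F y + (1 - β) * E y - C y|
        = |β * (F y - B y) + β * (B y - C y) + (1 - β) * (E y - C y)| := by ring_nf
      _ ≤ β * |F y - B y| + β * |B y - C y| + (1 - β) * |E y - C y| := by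
          refine (abs_add_three _ _ _).trans_eq ?_
          rw [abs_mul, abs_mul, abs_mul, abs_of_nonneg hβ0, abs_of_nonneg (sub_nonneg.2 hβ1)]
      _ ≤ β * |F y - B y| + β * |B y - C y| + |E y - C y| := by
          gcongr
          exact mul_le_of_le_one_left (abs_nonneg _) (by linarith)
  calc ∫ y, |β * F y + (1 - β) * E y - C y|
      ≤ ∫ y, (β * |F y - B y| + β * |B y - C y| + |E y - C y|) :=
        integral_mono ((hF.convexCombination hE hβ0 hβ1).integrable_sub hC).abs
          (hFBC.add hEC) hpointwise
    _ = β * (∫ y, |F y - B y|) + β * (∫ y, |B y - C y|) + ∫ y, |E y - C y| := by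
        rw [integral_add hFBC hEC, integral_add hFB hBC, integral_const_mul,
          integral_const_mul]
    _ ≤ _ := by gcongr; exact hB.integral_abs_sub_le hC hc

namespace RiskGame

variable {N : ℕ} {G : RiskGame N} {Dx U L₀ C₀ : ℝ}

section TrackingError

variable (G)

/-- The `L¹` error of the empirical distribution function of the costs of agent `i`. -/
def cdfError (i : Fin N) (n : ℕ) (x : Profile G.d) (ξ : ℕ → G.Ξ i) : ℝ :=
  ∫ y, |G.edf i n x ξ y - G.cdf i x y|

/-- The `L¹` error of the distribution estimate of agent `i` after episode `t + 1`. -/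
def trackingError (p : Params N) (x₁ : Profile G.d) (v₀ : Fin N → ℝ)
    (u : (i : Fin N) → ℕ → Act (G.d i)) (ξ : (i : Fin N) → ℕ → ℕ → G.Ξ i) (i : Fin N) (t : ℕ) :
    ℝ :=
  ∫ y, |(G.state p x₁ v₀ u ξ (t + 1)).Fbar i y - G.cdf i (G.played p x₁ v₀ u ξ (t + 1)) y|

variable {G} {p : Params N} {x₁ : Profile G.d} {v₀ : Fin N → ℝ}
  {u : (i : Fin N) → ℕ → Act (G.d i)} {ξ : (i : Fin N) → ℕ → ℕ → G.Ξ i} {T : ℕ}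

lemma trackingError_succ_le (hS : G.Standing Dx) (hJ : G.ConvexBounded U)
    (hC0 : 0 ≤ C₀) (hC : G.LipschitzCDF C₀) (hp : p.Admissible T)
    (hx₁ : ∀ i, x₁ i ∈ shrink (G.X i) p.δ) (hu : ∀ i t, ‖u i t‖ = 1) {k : ℝ} {t : ℕ}
    (ht : t + 1 < T)
    (hk : ‖G.played p x₁ v₀ u ξ (t + 1 + 1) - G.played p x₁ v₀ u ξ (t + 1)‖ ≤ k) (i : Fin N) :
    G.trackingError p x₁ v₀ u ξ i (t + 1) ≤
      p.β * G.trackingError p x₁ v₀ u ξ i t + p.β * (2 * U * (C₀ * k)) +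
        G.cdfError i (p.n (t + 1 + 1)) (G.played p x₁ v₀ u ξ (t + 1 + 1)) (ξ i (t + 1 + 1)) := by
  have hmem := played_mem_joint (v₀ := v₀) (ξ := ξ) hS hp.radius_pos.le hx₁ hu
  have hcdf := fun t => isCostCDF_cdf hS hJ i (hmem t)
  rw [trackingError, state_succ_succ_Fbar]
  refine (isCostCDF_Fbar hS hJ hp hx₁ hu i (by omega)).integral_abs_convexCombination_sub_le
    (isCostCDF_edf_played hS hJ hp hx₁ hu i ht) (hcdf _) (hcdf _) hp.momentum_nonneg
    hp.momentum_le_one fun y => (hC i _ (hmem _) _ (hmem _) y).trans ?_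
  rw [norm_sub_rev]
  exact mul_le_mul_of_nonneg_left hk hC0

lemma sum_trackingError_le (hS : G.Standing Dx) (hJ : G.ConvexBounded U)
    (hC0 : 0 ≤ C₀) (hC : G.LipschitzCDF C₀) (hp : p.Admissible T) (hβ : p.β ≤ 1 / 2)
    (hx₁ : ∀ i, x₁ i ∈ shrink (G.X i) p.δ) (hu : ∀ i t, ‖u i t‖ = 1) {k : ℝ} (hk0 : 0 ≤ k)
    (hk : ∀ t, t + 1 < T →
      ‖G.played p x₁ v₀ u ξ (t + 1 + 1) - G.played p x₁ v₀ u ξ (t + 1)‖ ≤ k) (i : Fin N) :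
    ∑ t ∈ Finset.range T, G.trackingError p x₁ v₀ u ξ i t ≤
      2 * ∑ t ∈ Finset.range T, G.cdfError i (p.n (t + 1)) (G.played p x₁ v₀ u ξ (t + 1))
        (ξ i (t + 1)) + 2 * T * (p.β * (2 * U * (C₀ * k))) := by
  have hβ0 := hp.momentum_nonneg
  have hU : 0 ≤ U := (isCostCDF_cdf hS hJ i
    (played_mem_joint (v₀ := v₀) (ξ := ξ) hS hp.radius_pos.le hx₁ hu 1)).bound_nonneg
  refine sum_le_of_geometric_recursion hβ (by positivity)
    (fun t _ => integral_nonneg fun y => abs_nonneg _) (fun _ => ?_)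
    fun t ht => trackingError_succ_le hS hJ hC0 hC hp hx₁ hu ht (hk t ht) i
  simp [trackingError, cdfError, state_one_Fbar]

end TrackingError

end RiskGame

namespace RiskGame

variable {N : ℕ} {G : RiskGame N} {Dx U L₀ : ℝ} {p : Params N} {x₁ : Profile G.d} {v₀ : Fin N → ℝ}
  {u : (i : Fin N) → ℕ → Act (G.d i)} {ξ : (i : Fin N) → ℕ → ℕ → G.Ξ i} {T : ℕ}

lemma exists_mem_shrink_norm_sub_le (hS : G.Standing Dx) {ρ δ : ℝ} (hρ : 0 < ρ) (hδ : 0 < δ)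
    (hδρ : δ * ρ ≤ Dx) {i : Fin N} (hne : (shrink (G.X i) δ).Nonempty)
    (hball : ∃ c, Metric.closedBall c (Dx / ρ) ⊆ G.X i) {y : Act (G.d i)} (hy : y ∈ G.X i) :
    ∃ y' ∈ shrink (G.X i) δ, ‖y' - y‖ ≤ δ * ρ := by
  obtain ⟨c, hc⟩ := hball
  have hDx : 0 < Dx := lt_of_lt_of_le (by positivity) hδρ
  set s := δ * ρ / Dx
  have hs0 : 0 ≤ s := by positivity
  have hs1 : s ≤ 1 := (div_le_one hDx).2 hδρ
  have hcX : c ∈ G.X i := hc (Metric.mem_closedBall_self (by positivity))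
  refine ⟨(1 - s) • y + s • c, ?_, ?_⟩
  · refine mem_shrink_of_closedBall_subset hδ
      (frontier_nonempty_of_mem_shrink hδ hne.some_mem) ?_
    have hsub := closedBall_combination_subset (hS.convex i) le_rfl (by positivity : 0 ≤ Dx / ρ)
      (by simpa using hy) hc (sub_nonneg.2 hs1) hs0 (by ring)
    have hradius : (1 - s) * 0 + s * (Dx / ρ) = δ := by
      simp only [s]; field_simp; ring
    rwa [hradius] at hsub
  · have hdist := hS.diam_le i c hcX y hy
    rw [dist_eq_norm] at hdist
    calc ‖(1 - s) • y + s • c - y‖ = ‖s • (c - y)‖ := by congr 1; module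
      _ ≤ s * Dx := by
          rw [norm_smul, Real.norm_of_nonneg hs0]
          exact mul_le_mul_of_nonneg_left hdist hs0
      _ = δ * ρ := div_mul_cancel₀ _ hDx.ne'

lemma smoothGrad_baseProfile_eq (hS : G.Standing Dx) (hδ : 0 ≤ p.δ)
    (hx₁ : ∀ i, x₁ i ∈ shrink (G.X i) p.δ) (hu : ∀ i t, ‖u i t‖ = 1) (i : Fin N) (t : ℕ) :
    G.smoothGrad p.δ i (G.baseProfile p x₁ v₀ u ξ i t) =
      G.noiseAt p x₁ v₀ u ξ i t + G.gradAt p x₁ v₀ u ξ i t +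
        ((G.d i : ℝ) / p.δ * (G.C i (G.played p x₁ v₀ u ξ (t + 1)) -
          (G.state p x₁ v₀ u ξ (t + 1)).est i)) • u i (t + 1) := by
  have hgrad : G.gradAt p x₁ v₀ u ξ i t = ((G.d i : ℝ) / p.δ *
      ((G.state p x₁ v₀ u ξ (t + 1)).est i - (G.state p x₁ v₀ u ξ t).est i)) • u i (t + 1) := rfl
  rw [hgrad, noiseAt, gradNoise, baseProfile_apply, replaceAction_baseProfile,
    retract_eq_self hS (played_mem_joint hS hδ hx₁ hu (t + 1))]
  module

lemma C_played_sub_C_baseProfile_le (hS : G.Standing Dx) (hJ : G.ConvexBounded U)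
    (hL : G.LipschitzCost L₀) (hδ : 0 ≤ p.δ) (hx₁ : ∀ i, x₁ i ∈ shrink (G.X i) p.δ)
    (hu : ∀ i t, ‖u i t‖ = 1) (i : Fin N) (t : ℕ) :
    G.C i (G.played p x₁ v₀ u ξ (t + 1)) - G.C i (G.baseProfile p x₁ v₀ u ξ i t) ≤ L₀ * p.δ := by
  have hmem := played_mem_joint (v₀ := v₀) (ξ := ξ) hS hδ hx₁ hu (t + 1)
  have hdist : ‖G.played p x₁ v₀ u ξ (t + 1) - G.baseProfile p x₁ v₀ u ξ i t‖ = p.δ := by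
    conv_lhs => rw [← replaceAction_self (G.played p x₁ v₀ u ξ (t + 1)) i, baseProfile]
    rw [norm_replaceAction_sub, played_apply, add_sub_cancel_left, norm_smul, hu, mul_one,
      Real.norm_of_nonneg hδ]
  rw [← hdist]
  exact (le_abs_self _).trans (abs_C_sub_C_le hS hJ hL i hmem
    (replaceAction_mem_joint hmem (state_x_mem hS hx₁ t i).1))

lemma abs_C_played_sub_est_le (hS : G.Standing Dx) (hJ : G.ConvexBounded U) (hp : p.Admissible T)
    (hx₁ : ∀ i, x₁ i ∈ shrink (G.X i) p.δ) (hu : ∀ i t, ‖u i t‖ = 1) (i : Fin N) {t : ℕ}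
    (ht : t < T) :
    |G.C i (G.played p x₁ v₀ u ξ (t + 1)) - (G.state p x₁ v₀ u ξ (t + 1)).est i| ≤
      (G.α i)⁻¹ * G.trackingError p x₁ v₀ u ξ i t := by
  rw [abs_sub_comm]
  exact (isCostCDF_Fbar hS hJ hp hx₁ hu i ht).abs_cvar_sub_cvar_le
    (isCostCDF_cdf hS hJ i (played_mem_joint hS hp.radius_pos.le hx₁ hu _)) (hS.level_pos i)
    (hS.level_le_one i)

lemma inner_estimation_error_le (hS : G.Standing Dx) (hJ : G.ConvexBounded U)
    (hp : p.Admissible T) (hx₁ : ∀ i, x₁ i ∈ shrink (G.X i) p.δ) (hu : ∀ i t, ‖u i t‖ = 1)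
    (i : Fin N) {t : ℕ} (ht : t < T) {y : Act (G.d i)} (hy : y ∈ G.X i) :
    inner ℝ (((G.d i : ℝ) / p.δ * (G.C i (G.played p x₁ v₀ u ξ (t + 1)) -
        (G.state p x₁ v₀ u ξ (t + 1)).est i)) • u i (t + 1)) ((G.state p x₁ v₀ u ξ t).x i - y) ≤
      G.d i / p.δ * Dx * ((G.α i)⁻¹ * G.trackingError p x₁ v₀ u ξ i t) := by
  have hδ := hp.radius_pos
  have hest := abs_C_played_sub_est_le (v₀ := v₀) (ξ := ξ) hS hJ hp hx₁ hu i ht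
  have hdiam := hS.diam_le i _ (state_x_mem (v₀ := v₀) (u := u) (ξ := ξ) hS hx₁ t i).1 _ hy
  rw [dist_eq_norm] at hdiam
  refine (real_inner_le_norm _ _).trans ?_
  rw [norm_smul, hu, mul_one, norm_mul, Real.norm_of_nonneg (by positivity), Real.norm_eq_abs,
    mul_assoc, mul_assoc, mul_comm Dx]
  exact mul_le_mul_of_nonneg_left
    (mul_le_mul hest hdiam (norm_nonneg _) ((abs_nonneg _).trans hest)) (by positivity)

lemma C_played_sub_le (hS : G.Standing Dx) (hJ : G.ConvexBounded U) (hL0 : 0 ≤ L₀)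
    (hL : G.LipschitzCost L₀) (hp : p.Admissible T) (hx₁ : ∀ i, x₁ i ∈ shrink (G.X i) p.δ)
    (hu : ∀ i t, ‖u i t‖ = 1) (i : Fin N) {t : ℕ} (ht : t < T) {y : Act (G.d i)}
    (hy : y ∈ shrink (G.X i) p.δ) :
    G.C i (G.played p x₁ v₀ u ξ (t + 1)) -
        G.C i (replaceAction (G.played p x₁ v₀ u ξ (t + 1)) i y) ≤
      inner ℝ (G.gradAt p x₁ v₀ u ξ i t) ((G.state p x₁ v₀ u ξ t).x i - y) +
      G.noiseIncrement p x₁ v₀ u ξ i t +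
      inner ℝ (G.noiseAt p x₁ v₀ u ξ i t) (G.ghost p x₁ v₀ u ξ i t - y) +
      G.d i / p.δ * Dx * ((G.α i)⁻¹ * G.trackingError p x₁ v₀ u ξ i t) + 3 * (L₀ * p.δ) := by
  have hδ := hp.radius_pos
  have hx := state_x_mem (v₀ := v₀) (u := u) (ξ := ξ) hS hx₁ t i
  have hbase : G.baseProfile p x₁ v₀ u ξ i t ∈ G.joint :=
    replaceAction_mem_joint (played_mem_joint hS hδ.le hx₁ hu _) hx.1
  have hsmooth := C_sub_C_le_inner_smoothGrad i hS hJ hL0 hL hδ hbase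
    (by rwa [baseProfile_apply]) hy
  rw [baseProfile_apply, smoothGrad_baseProfile_eq hS hδ.le hx₁ hu, inner_add_left,
    inner_add_left, baseProfile, replaceAction_replaceAction, ← baseProfile] at hsmooth
  have hplayed := C_played_sub_C_baseProfile_le (v₀ := v₀) (ξ := ξ) hS hJ hL hδ.le hx₁ hu i t
  have herror := inner_estimation_error_le (v₀ := v₀) (ξ := ξ) hS hJ hp hx₁ hu i ht hy.1
  have hnoise : inner ℝ (G.noiseAt p x₁ v₀ u ξ i t) ((G.state p x₁ v₀ u ξ t).x i - y) =
      G.noiseIncrement p x₁ v₀ u ξ i t +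
        inner ℝ (G.noiseAt p x₁ v₀ u ξ i t) (G.ghost p x₁ v₀ u ξ i t - y) := by
    rw [noiseIncrement, ← inner_add_right, sub_add_sub_cancel]
  linarith

lemma C_played_sub_le_of_norm_sub_le (hS : G.Standing Dx) (hJ : G.ConvexBounded U) (hL0 : 0 ≤ L₀)
    (hL : G.LipschitzCost L₀) (hp : p.Admissible T) (hx₁ : ∀ i, x₁ i ∈ shrink (G.X i) p.δ)
    (hu : ∀ i t, ‖u i t‖ = 1) (i : Fin N) {t : ℕ} (ht : t < T) {ρ : ℝ} {y y' : Act (G.d i)}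
    (hy : y ∈ G.X i) (hy' : y' ∈ shrink (G.X i) p.δ) (hyy' : ‖y' - y‖ ≤ p.δ * ρ) :
    G.C i (G.played p x₁ v₀ u ξ (t + 1)) -
        G.C i (replaceAction (G.played p x₁ v₀ u ξ (t + 1)) i y) ≤
      inner ℝ (G.gradAt p x₁ v₀ u ξ i t) ((G.state p x₁ v₀ u ξ t).x i - y') +
      G.noiseIncrement p x₁ v₀ u ξ i t +
      inner ℝ (G.noiseAt p x₁ v₀ u ξ i t) (G.ghost p x₁ v₀ u ξ i t - y') +
      G.d i / p.δ * Dx * ((G.α i)⁻¹ * G.trackingError p x₁ v₀ u ξ i t) +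
      (3 + ρ) * (L₀ * p.δ) := by
  have hmem := played_mem_joint (v₀ := v₀) (ξ := ξ) hS hp.radius_pos.le hx₁ hu (t + 1)
  have hshrunk := C_played_sub_le (v₀ := v₀) (ξ := ξ) hS hJ hL0 hL hp hx₁ hu i ht hy'
  have hmove := (abs_le.1 (abs_C_sub_C_le hS hJ hL i (replaceAction_mem_joint hmem hy'.1)
    (replaceAction_mem_joint hmem hy))).2
  rw [norm_replaceAction_sub] at hmove
  linarith [mul_le_mul_of_nonneg_left hyy' hL0]

lemma sum_inner_gradAt_le (hS : G.Standing Dx) (hJ : G.ConvexBounded U) (hp : p.Admissible T)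
    (hx₁ : ∀ i, x₁ i ∈ shrink (G.X i) p.δ) (hv₀ : ∀ i, |v₀ i| ≤ U) (hu : ∀ i t, ‖u i t‖ = 1)
    (i : Fin N) {y : Act (G.d i)} (hy : y ∈ shrink (G.X i) p.δ) :
    ∑ t ∈ Finset.range T,
        inner ℝ (G.gradAt p x₁ v₀ u ξ i t) ((G.state p x₁ v₀ u ξ t).x i - y) ≤
      Dx ^ 2 / (2 * p.η i) + p.η i * T * (G.d i / p.δ * (2 * U)) ^ 2 / 2 :=
  sum_inner_le_of_projected_steps (x := fun t => (G.state p x₁ v₀ u ξ t).x i) (hp.step_pos i)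
    (fun _ _ => norm_nearestPoint_sub_le ⟨_, hx₁ i⟩ (isClosed_shrink (hS.closed i))
      (convex_shrink (hS.convex i) (hS.closed i) hp.radius_pos) _ hy)
    (fun _ ht => norm_gradAt_le hS hJ hp hx₁ hv₀ hu i ht)
    ((dist_eq_norm _ _).symm.trans_le (hS.diam_le i _ (hx₁ i).1 _ hy.1))

lemma sum_inner_noiseAt_le (hS : G.Standing Dx) (hJ : G.ConvexBounded U) (hp : p.Admissible T)
    (hx₁ : ∀ i, x₁ i ∈ shrink (G.X i) p.δ) (hv₀ : ∀ i, |v₀ i| ≤ U) (hu : ∀ i t, ‖u i t‖ = 1)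
    (i : Fin N) {y : Act (G.d i)} (hy : y ∈ shrink (G.X i) p.δ) :
    ∑ t ∈ Finset.range T,
        inner ℝ (G.noiseAt p x₁ v₀ u ξ i t) (G.ghost p x₁ v₀ u ξ i t - y) ≤
      Dx ^ 2 / (2 * p.η i) + p.η i * T * (G.d i / p.δ * (3 * U)) ^ 2 / 2 :=
  sum_inner_le_of_projected_steps (hp.step_pos i)
    (fun _ _ => norm_nearestPoint_sub_le ⟨_, hx₁ i⟩ (isClosed_shrink (hS.closed i))
      (convex_shrink (hS.convex i) (hS.closed i) hp.radius_pos) _ hy)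
    (fun _ ht => norm_noiseAt_le hS hJ hp hx₁ hv₀ hu i ht)
    ((dist_eq_norm _ _).symm.trans_le (hS.diam_le i _ (hx₁ i).1 _ hy.1))

lemma regret_le_of_forall_sum_le {i : Fin N} {xhat : ℕ → Profile G.d} {B : ℝ}
    (hne : (G.X i).Nonempty)
    (hB : ∀ y ∈ G.X i, ∑ t ∈ Finset.range T,
      (G.C i (xhat (t + 1)) - G.C i (replaceAction (xhat (t + 1)) i y)) ≤ B) :
    G.regret i T xhat ≤ B := by
  have : Nonempty (G.X i) := hne.to_subtype
  rw [regret, sub_le_comm]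
  refine le_ciInf fun y => ?_
  rw [sub_le_comm, ← Finset.sum_sub_distrib, ← Finset.Ico_add_one_right_eq_Icc,
    Finset.sum_Ico_eq_sum_range]
  simpa only [add_comm 1, Nat.add_sub_cancel] using hB y y.2

lemma regret_le (hS : G.Standing Dx) (hJ : G.ConvexBounded U) (hL0 : 0 ≤ L₀)
    (hL : G.LipschitzCost L₀) (hp : p.Admissible T) (hx₁ : ∀ i, x₁ i ∈ shrink (G.X i) p.δ)
    (hv₀ : ∀ i, |v₀ i| ≤ U) (hu : ∀ i t, ‖u i t‖ = 1) {ρ : ℝ} (hρ : 0 < ρ)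
    (hδρ : p.δ * ρ ≤ Dx) (i : Fin N) (hball : ∃ c, Metric.closedBall c (Dx / ρ) ⊆ G.X i) :
    G.regret i T (G.played p x₁ v₀ u ξ) ≤
      Dx ^ 2 / p.η i + p.η i * T * (G.d i / p.δ * (3 * U)) ^ 2 +
      ∑ t ∈ Finset.range T, G.noiseIncrement p x₁ v₀ u ξ i t +
      G.d i / p.δ * Dx * ((G.α i)⁻¹ * ∑ t ∈ Finset.range T, G.trackingError p x₁ v₀ u ξ i t) +
      T * ((3 + ρ) * (L₀ * p.δ)) := by
  refine regret_le_of_forall_sum_le ⟨_, (hx₁ i).1⟩ fun y hy => ?_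
  obtain ⟨y', hy', hyy'⟩ :=
    exists_mem_shrink_norm_sub_le hS hρ hp.radius_pos hδρ ⟨_, hx₁ i⟩ hball hy
  have hgrad := sum_inner_gradAt_le (ξ := ξ) hS hJ hp hx₁ hv₀ hu i hy'
  have hnoise := sum_inner_noiseAt_le (ξ := ξ) hS hJ hp hx₁ hv₀ hu i hy'
  have hsteps := Finset.sum_le_sum fun t ht => C_played_sub_le_of_norm_sub_le (v₀ := v₀) (ξ := ξ)
    hS hJ hL0 hL hp hx₁ hu i (Finset.mem_range.1 ht) hy hy' hyy'
  simp only [Finset.sum_add_distrib, ← Finset.mul_sum, Finset.sum_const, Finset.card_range,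
    nsmul_eq_mul] at hsteps
  have hη := hp.step_pos i
  have hhalf : Dx ^ 2 / (2 * p.η i) = Dx ^ 2 / p.η i / 2 := by rw [mul_comm, div_div]
  have hsq : p.η i * T * (G.d i / p.δ * (2 * U)) ^ 2 ≤
      p.η i * T * (G.d i / p.δ * (3 * U)) ^ 2 := by
    simp only [mul_pow]
    gcongr
    norm_num
  linarith

lemma regret_le_two_mul (hS : G.Standing Dx) (hJ : G.ConvexBounded U) (hδ : 0 ≤ p.δ)
    (hx₁ : ∀ i, x₁ i ∈ shrink (G.X i) p.δ) (hu : ∀ i t, ‖u i t‖ = 1) (i : Fin N) :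
    G.regret i T (G.played p x₁ v₀ u ξ) ≤ 2 * U * T := by
  have hmem := played_mem_joint (v₀ := v₀) (ξ := ξ) hS hδ hx₁ hu
  refine regret_le_of_forall_sum_le ⟨_, (hx₁ i).1⟩ fun y hy => ?_
  refine (Finset.sum_le_card_nsmul _ _ (2 * U) fun t _ => ?_).trans_eq
    (by rw [Finset.card_range, nsmul_eq_mul, mul_comm])
  linarith [(abs_le.1 (abs_C_le hS hJ i (hmem (t + 1)))).2,
    (abs_le.1 (abs_C_le hS hJ i (replaceAction_mem_joint (hmem (t + 1)) hy))).1]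

end RiskGame

section MeasurableCVaR

variable {U α : ℝ}

lemma cvar_eq_iInf_rat {F : ℝ → ℝ} (hF : IsCostCDF U F) (h0 : 0 < α) (h1 : α ≤ 1) :
    cvar α F = ⨅ q : ℚ, ((q : ℝ) + α⁻¹ * ∫ y in Set.Ioi (q : ℝ), (1 - F y)) := by
  have hbdd := hF.bddBelow_cvar_objective h0 h1
  have hbdd_rat : BddBelow (Set.range fun q : ℚ =>
      ((q : ℝ) + α⁻¹ * ∫ y in Set.Ioi (q : ℝ), (1 - F y))) :=
    hbdd.mono (by rintro _ ⟨q, rfl⟩; exact ⟨(q : ℝ), rfl⟩)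
  refine le_antisymm (le_ciInf fun q => ciInf_le hbdd (q : ℝ)) (le_ciInf fun z => ?_)
  refine le_of_forall_pos_le_add fun ε hε => ?_
  obtain ⟨q, hzq, hqz⟩ := exists_rat_btwn (lt_add_of_pos_right z hε)
  have htail : ∫ y in Set.Ioi (q : ℝ), (1 - F y) ≤ ∫ y in Set.Ioi z, (1 - F y) :=
    setIntegral_mono_set (hF.integrableOn_one_sub z)
      (.of_forall fun y => sub_nonneg.2 (hF.le_one y)) (Set.Ioi_subset_Ioi hzq.le).eventuallyLE
  refine (ciInf_le hbdd_rat q).trans ?_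
  linarith [mul_le_mul_of_nonneg_left htail (inv_nonneg.2 h0.le)]

lemma measurable_cvar {Ω : Type*} {mΩ : MeasurableSpace Ω} {F : Ω → ℝ → ℝ}
    (hm : Measurable (Function.uncurry F)) (hF : ∀ ω, IsCostCDF U (F ω)) (h0 : 0 < α)
    (h1 : α ≤ 1) : Measurable fun ω => cvar α (F ω) := by
  simp_rw [fun ω => cvar_eq_iInf_rat (hF ω) h0 h1]
  refine Measurable.iInf fun q => (Measurable.const_mul ?_ _).const_add _
  exact (measurable_const.sub hm).stronglyMeasurable.integral_prod_right.measurable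

end MeasurableCVaR

namespace RiskGame

variable {N : ℕ} {G : RiskGame N} {Dx U L₀ : ℝ} {Ω : Type*} {mΩ : MeasurableSpace Ω}

section MeasurableGame

variable {d : Fin N → ℕ}

lemma measurable_profile {f : Ω → (i : Fin N) → Act (d i)} (hf : ∀ i, Measurable fun ω => f ω i) :
    Measurable fun ω => (WithLp.toLp 2 (f ω) : Profile d) :=
  (WithLp.measurable_toLp 2 _).comp (measurable_pi_lambda _ hf)

lemma measurable_profile_apply {f : Ω → Profile d} (hf : Measurable f) (i : Fin N) :
    Measurable fun ω => f ω i :=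
  (PiLp.continuous_apply 2 _ i).measurable.comp hf

lemma measurable_edf (hS : G.Standing Dx) (hL : G.LipschitzCost L₀) (i : Fin N)
    (n : ℕ) {x : Ω → Profile G.d} (hx : Measurable x) (hmem : ∀ ω, x ω ∈ G.joint)
    {ζ : Ω → ℕ → G.Ξ i} (hζ : ∀ j, Measurable fun ω => ζ ω j) :
    Measurable fun q : Ω × ℝ => G.edf i n (x q.1) (ζ q.1) q.2 := by
  have hcost (j : ℕ) : Measurable fun ω => G.J i (x ω) (ζ ω j) := by
    cases isEmpty_or_nonempty Ω
    · exact measurable_of_empty _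
    · have hne (k : Fin N) : (G.X k).Nonempty := ⟨_, hmem (Classical.arbitrary Ω) k⟩
      simpa only [Function.comp_def, retract_eq_self hS (hmem _)] using
        (measurable_J_retract hS hne hL i).comp (hx.prodMk (hζ j))
  simp only [edf_eq_sum_indicator_Ici]
  refine (Finset.measurable_fun_sum _ fun j _ => ?_).const_mul _
  exact measurable_one.indicator (s := {q : Ω × ℝ | G.J i (x q.1) (ζ q.1 j) ≤ q.2})
    (measurableSet_le ((hcost j).comp measurable_fst) measurable_snd)

lemma measurable_cdf_retract (hS : G.Standing Dx) (hne : ∀ i, (G.X i).Nonempty)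
    (hL : G.LipschitzCost L₀) (i : Fin N) :
    Measurable fun q : Profile G.d × ℝ => G.cdf i (G.retract q.1) q.2 := by
  have := hS.law_prob i
  have hcost : Measurable fun w : (Profile G.d × ℝ) × G.Ξ i => G.J i (G.retract w.1.1) w.2 :=
    Measurable.comp (g := fun q : Profile G.d × G.Ξ i => G.J i (G.retract q.1) q.2)
      (f := fun w : (Profile G.d × ℝ) × G.Ξ i => (w.1.1, w.2)) (measurable_J_retract hS hne hL i)
      ((measurable_fst.comp measurable_fst).prodMk measurable_snd)
  have hsublevel : MeasurableSet
      {w : (Profile G.d × ℝ) × G.Ξ i | G.J i (G.retract w.1.1) w.2 ≤ w.1.2} :=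
    measurableSet_le hcost (measurable_snd.comp measurable_fst)
  exact (measurable_measure_prodMk_left hsublevel).ennreal_toReal

lemma measurable_cdfError_retract (hS : G.Standing Dx) (hne : ∀ i, (G.X i).Nonempty)
    (hL : G.LipschitzCost L₀) (i : Fin N) (n : ℕ) :
    Measurable fun q : Profile G.d × (ℕ → G.Ξ i) => G.cdfError i n (G.retract q.1) q.2 := by
  have hedf := measurable_edf (Ω := Profile G.d × (ℕ → G.Ξ i)) hS hL i n
    (x := fun q => G.retract q.1) (ζ := fun q => q.2)
    ((continuous_retract hS hne).measurable.comp measurable_fst)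
    (fun q => retract_mem_joint hS hne _) fun j => (measurable_pi_apply j).comp measurable_snd
  have hcdf : Measurable fun w : (Profile G.d × (ℕ → G.Ξ i)) × ℝ =>
      G.cdf i (G.retract w.1.1) w.2 :=
    Measurable.comp (g := fun q : Profile G.d × ℝ => G.cdf i (G.retract q.1) q.2)
      (f := fun w : (Profile G.d × (ℕ → G.Ξ i)) × ℝ => (w.1.1, w.2))
      (measurable_cdf_retract hS hne hL i)
      ((measurable_fst.comp measurable_fst).prodMk measurable_snd)
  exact (hedf.sub hcdf).norm.stronglyMeasurable.integral_prod_right'.measurable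

lemma measurable_cdfError (hS : G.Standing Dx) (hne : ∀ i, (G.X i).Nonempty)
    (hL : G.LipschitzCost L₀) (i : Fin N) (n : ℕ) {x : Ω → Profile G.d} (hx : Measurable x)
    (hmem : ∀ ω, x ω ∈ G.joint) {ζ : Ω → ℕ → G.Ξ i} (hζ : ∀ j, Measurable fun ω => ζ ω j) :
    Measurable fun ω => G.cdfError i n (x ω) (ζ ω) := by
  simpa only [Function.comp_def, retract_eq_self hS (hmem _)] using
    (measurable_cdfError_retract hS hne hL i n).comp (hx.prodMk (measurable_pi_lambda _ hζ))

lemma measurable_smoothGrad (hS : G.Standing Dx) (hne : ∀ i, (G.X i).Nonempty)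
    (hJ : G.ConvexBounded U) (hL : G.LipschitzCost L₀) (δ : ℝ) (i : Fin N) :
    Measurable (G.smoothGrad δ i) := by
  have := nontrivial_act i hS
  have hintegrand : Measurable fun q : Profile G.d × Act (G.d i) =>
      G.C i (G.retract (replaceAction q.1 i (q.1 i + δ • q.2))) • q.2 :=
    (continuous_C_perturbed i hS hne hJ hL δ).measurable.smul measurable_snd
  exact (hintegrand.stronglyMeasurable.integral_prod_right'
    (ν := uniformSphere (G.d i))).measurable.const_smul ((G.d i : ℝ) / δ)

lemma measurable_gradNoise (hS : G.Standing Dx) (hne : ∀ i, (G.X i).Nonempty)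
    (hJ : G.ConvexBounded U) (hL : G.LipschitzCost L₀) (δ : ℝ) (i : Fin N)
    {q : Ω → Profile G.d} (hq : Measurable q) {c : Ω → ℝ} (hc : Measurable c)
    {b : Ω → Act (G.d i)} (hb : Measurable b) :
    Measurable fun ω => G.gradNoise δ i (q ω) (c ω) (b ω) := by
  have hcost : Measurable fun ω =>
      G.C i (G.retract (replaceAction (q ω) i (q ω i + δ • b ω))) :=
    Measurable.comp (g := fun q : Profile G.d × Act (G.d i) =>
        G.C i (G.retract (replaceAction q.1 i (q.1 i + δ • q.2)))) (f := fun ω => (q ω, b ω))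
      (continuous_C_perturbed i hS hne hJ hL δ).measurable (hq.prodMk hb)
  exact ((measurable_smoothGrad hS hne hJ hL δ i).comp hq).sub
    (((hcost.sub hc).const_mul _).smul hb)

end MeasurableGame

section MeasurableTrajectory

variable {p : Params N} {x₁ : Profile G.d} {v₀ : Fin N → ℝ} {T : ℕ}
  {u : Ω → (i : Fin N) → ℕ → Act (G.d i)} {ξ : Ω → (i : Fin N) → ℕ → ℕ → G.Ξ i}

lemma measurable_played {t : ℕ} (hx : Measurable fun ω => (G.state p x₁ v₀ (u ω) (ξ ω) t).x)
    (hmu : ∀ i, Measurable fun ω => u ω i (t + 1)) :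
    Measurable fun ω => G.played p x₁ v₀ (u ω) (ξ ω) (t + 1) :=
  measurable_profile fun i => (measurable_profile_apply hx i).add ((hmu i).const_smul p.δ)

lemma measurable_state_succ_Fbar (hS : G.Standing Dx) (hL : G.LipschitzCost L₀) (hδ : 0 ≤ p.δ)
    (hx₁ : ∀ i, x₁ i ∈ shrink (G.X i) p.δ) (hu : ∀ ω i t, ‖u ω i t‖ = 1) (i : Fin N) {t : ℕ}
    (hplayed : Measurable fun ω => G.played p x₁ v₀ (u ω) (ξ ω) (t + 1))
    (hFbar : Measurable fun q : Ω × ℝ => (G.state p x₁ v₀ (u q.1) (ξ q.1) t).Fbar i q.2)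
    (hmξ : ∀ j, Measurable fun ω => ξ ω i (t + 1) j) :
    Measurable fun q : Ω × ℝ => (G.state p x₁ v₀ (u q.1) (ξ q.1) (t + 1)).Fbar i q.2 := by
  have hedf := measurable_edf hS hL i (p.n (t + 1)) hplayed
    (fun ω => played_mem_joint hS hδ hx₁ (hu ω) (t + 1)) hmξ
  cases t with
  | zero => simpa only [zero_add, state_one_Fbar] using hedf
  | succ t =>
    simp only [state_succ_succ_Fbar]
    exact (hFbar.const_mul _).add (hedf.const_mul _)

lemma measurable_projected_step (hS : G.Standing Dx) (hδ : 0 < p.δ) {i : Fin N}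
    (hx₁ : x₁ i ∈ shrink (G.X i) p.δ) {x g : Ω → Act (G.d i)} (hx : Measurable x)
    (hg : Measurable g) :
    Measurable fun ω => nearestPoint (shrink (G.X i) p.δ) (x ω - p.η i • g ω) :=
  (lipschitzWith_nearestPoint ⟨_, hx₁⟩ (isClosed_shrink (hS.closed i))
    (convex_shrink (hS.convex i) (hS.closed i) hδ)).continuous.measurable.comp
      (hx.sub (hg.const_smul (p.η i)))

lemma measurable_state (hS : G.Standing Dx) (hJ : G.ConvexBounded U) (hL : G.LipschitzCost L₀)
    (hp : p.Admissible T) (hx₁ : ∀ i, x₁ i ∈ shrink (G.X i) p.δ) (hu : ∀ ω i t, ‖u ω i t‖ = 1)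
    {t : ℕ} (ht : t ≤ T) (hmu : ∀ i, ∀ s ≤ t, Measurable fun ω => u ω i s)
    (hmξ : ∀ i, ∀ s ≤ t, ∀ j, Measurable fun ω => ξ ω i s j) :
    Measurable (fun ω => (G.state p x₁ v₀ (u ω) (ξ ω) t).x) ∧
      (∀ i, Measurable fun q : Ω × ℝ => (G.state p x₁ v₀ (u q.1) (ξ q.1) t).Fbar i q.2) ∧
      ∀ i, Measurable fun ω => (G.state p x₁ v₀ (u ω) (ξ ω) t).est i := by
  induction t with
  | zero => exact ⟨measurable_const, fun _ => measurable_const, fun _ => measurable_const⟩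
  | succ t ih =>
    obtain ⟨hx, hFbar, hest⟩ := ih (by omega) (fun i s hs => hmu i s (by omega))
      (fun i s hs => hmξ i s (by omega))
    have hplayed := measurable_played hx fun i => hmu i (t + 1) le_rfl
    have hFbar_succ (i : Fin N) := measurable_state_succ_Fbar hS hL hp.radius_pos.le hx₁ hu i
      hplayed (hFbar i) (hmξ i (t + 1) le_rfl)
    have hest_succ (i : Fin N) :
        Measurable fun ω => (G.state p x₁ v₀ (u ω) (ξ ω) (t + 1)).est i :=
      measurable_cvar (hFbar_succ i) (fun ω => isCostCDF_Fbar hS hJ hp hx₁ (hu ω) i ht)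
        (hS.level_pos i) (hS.level_le_one i)
    have hgrad (i : Fin N) : Measurable fun ω => G.gradAt p x₁ v₀ (u ω) (ξ ω) i t :=
      (((hest_succ i).sub (hest i)).const_mul _).smul (hmu i (t + 1) le_rfl)
    exact ⟨measurable_profile fun i => measurable_projected_step hS hp.radius_pos (hx₁ i)
      (measurable_profile_apply hx i) (hgrad i), hFbar_succ, hest_succ⟩

lemma measurable_baseProfile {i : Fin N} {t : ℕ}
    (hx : Measurable fun ω => (G.state p x₁ v₀ (u ω) (ξ ω) t).x)
    (hmu : ∀ k, k ≠ i → Measurable fun ω => u ω k (t + 1)) :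
    Measurable fun ω => G.baseProfile p x₁ v₀ (u ω) (ξ ω) i t := by
  refine measurable_profile fun k => ?_
  rcases eq_or_ne k i with rfl | hk
  · simpa using measurable_profile_apply hx k
  · simp only [Function.update_of_ne hk, played_apply]
    exact (measurable_profile_apply hx k).add ((hmu k hk).const_smul p.δ)

lemma measurable_noiseAt (hS : G.Standing Dx) (hJ : G.ConvexBounded U) (hL : G.LipschitzCost L₀)
    (hp : p.Admissible T) (hx₁ : ∀ i, x₁ i ∈ shrink (G.X i) p.δ) (hu : ∀ ω i t, ‖u ω i t‖ = 1)
    (i : Fin N) {t : ℕ} (ht : t ≤ T) (hmu : ∀ i, ∀ s ≤ t + 1, Measurable fun ω => u ω i s)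
    (hmξ : ∀ i, ∀ s ≤ t, ∀ j, Measurable fun ω => ξ ω i s j) :
    Measurable fun ω => G.noiseAt p x₁ v₀ (u ω) (ξ ω) i t := by
  obtain ⟨hx, -, hest⟩ := measurable_state (v₀ := v₀) hS hJ hL hp hx₁ hu ht
    (fun i s hs => hmu i s (by omega)) hmξ
  exact measurable_gradNoise hS (fun i => ⟨_, (hx₁ i).1⟩) hJ hL p.δ i
    (measurable_baseProfile hx fun k _ => hmu k (t + 1) le_rfl) (hest i) (hmu i (t + 1) le_rfl)

lemma measurable_ghost (hS : G.Standing Dx) (hJ : G.ConvexBounded U) (hL : G.LipschitzCost L₀)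
    (hp : p.Admissible T) (hx₁ : ∀ i, x₁ i ∈ shrink (G.X i) p.δ) (hu : ∀ ω i t, ‖u ω i t‖ = 1)
    (i : Fin N) {t : ℕ} (ht : t ≤ T) (hmu : ∀ i, ∀ s ≤ t, Measurable fun ω => u ω i s)
    (hmξ : ∀ i, ∀ s ≤ t, ∀ j, Measurable fun ω => ξ ω i s j) :
    Measurable fun ω => G.ghost p x₁ v₀ (u ω) (ξ ω) i t := by
  induction t with
  | zero => exact measurable_const
  | succ t ih =>
    have hmξ_lt := fun i s (hs : s ≤ t) => hmξ i s (by omega)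
    exact measurable_projected_step hS hp.radius_pos (hx₁ i)
      (ih (by omega) (fun i s hs => hmu i s (by omega)) hmξ_lt)
      (measurable_noiseAt hS hJ hL hp hx₁ hu i (by omega) hmu hmξ_lt)

lemma measurable_noiseIncrement (hS : G.Standing Dx) (hJ : G.ConvexBounded U)
    (hL : G.LipschitzCost L₀) (hp : p.Admissible T) (hx₁ : ∀ i, x₁ i ∈ shrink (G.X i) p.δ)
    (hu : ∀ ω i t, ‖u ω i t‖ = 1) (i : Fin N) {t : ℕ} (ht : t ≤ T)
    (hmu : ∀ i, ∀ s ≤ t + 1, Measurable fun ω => u ω i s)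
    (hmξ : ∀ i, ∀ s ≤ t, ∀ j, Measurable fun ω => ξ ω i s j) :
    Measurable fun ω => G.noiseIncrement p x₁ v₀ (u ω) (ξ ω) i t := by
  have hmu_le := fun i s (hs : s ≤ t) => hmu i s (by omega)
  obtain ⟨hx, -, -⟩ := measurable_state (v₀ := v₀) hS hJ hL hp hx₁ hu ht hmu_le hmξ
  exact (measurable_noiseAt hS hJ hL hp hx₁ hu i ht hmu hmξ).inner
    ((measurable_profile_apply hx i).sub (measurable_ghost hS hJ hL hp hx₁ hu i ht hmu_le hmξ))

lemma measurable_sum_noiseIncrement (hS : G.Standing Dx) (hJ : G.ConvexBounded U)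
    (hL : G.LipschitzCost L₀) (hp : p.Admissible T) (hx₁ : ∀ i, x₁ i ∈ shrink (G.X i) p.δ)
    (hu : ∀ ω i t, ‖u ω i t‖ = 1) (i : Fin N) {t : ℕ} (ht : t ≤ T)
    (hmu : ∀ i, ∀ s ≤ t, Measurable fun ω => u ω i s)
    (hmξ : ∀ i, ∀ s < t, ∀ j, Measurable fun ω => ξ ω i s j) :
    Measurable fun ω => ∑ s ∈ Finset.range t, G.noiseIncrement p x₁ v₀ (u ω) (ξ ω) i s := by
  refine Finset.measurable_fun_sum _ fun s hs => ?_
  have hst := Finset.mem_range.1 hs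
  exact measurable_noiseIncrement hS hJ hL hp hx₁ hu i (by omega)
    (fun k r hr => hmu k r (by omega)) fun k r hr => hmξ k r (by omega)

end MeasurableTrajectory

end RiskGame

section ExponentialMoment

variable {Ω : Type*} {mΩ : MeasurableSpace Ω} {μ : Measure Ω} [IsProbabilityMeasure μ]

lemma integral_exp_mul_nonpos_of_indepFun {α β : Type*} [MeasurableSpace α] [MeasurableSpace β]
    {W : Ω → ℝ} {A : Ω → α} {B : Ω → β} (hW : Measurable W) (hA : Measurable A)
    (hB : Measurable B) (hind : IndepFun (fun ω => (W ω, A ω)) B μ) {g : α → β → ℝ}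
    (hg : Measurable (Function.uncurry g)) {k c l : ℝ} (hWk : ∀ ω, |W ω| ≤ k)
    (hgc : ∀ ω, |g (A ω) (B ω)| ≤ c) (hneg : ∀ ω, ∫ ω', g (A ω) (B ω') ∂μ ≤ 0) (hl : 0 ≤ l) :
    ∫ ω, Real.exp (l * W ω) * g (A ω) (B ω) ∂μ ≤ 0 := by
  let f : ℝ × α → β → ℝ := fun a b => Real.exp (l * a.1) * g a.2 b
  have hgAB : Measurable fun w : (ℝ × α) × β => g w.1.2 w.2 :=
    hg.comp ((measurable_snd.comp measurable_fst).prodMk measurable_snd)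
  have hf : Measurable (Function.uncurry f) :=
    ((measurable_fst.comp measurable_fst).const_mul l).exp.mul hgAB
  have hint : Integrable (fun ω => f (W ω, A ω) (B ω)) μ := by
    refine Integrable.of_bound
      (hf.comp ((hW.prodMk hA).prodMk hB)).aestronglyMeasurable (Real.exp (l * k) * c)
      (.of_forall fun ω => ?_)
    rw [norm_mul, Real.norm_of_nonneg (Real.exp_pos _).le]
    gcongr
    · exact (le_abs_self _).trans (hWk ω)
    · exact hgc ω
  calc ∫ ω, Real.exp (l * W ω) * g (A ω) (B ω) ∂μ
      = ∫ ω, ∫ ω', f (W ω, A ω) (B ω') ∂μ ∂μ :=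
        integral_comp_eq_of_indepFun (hW.prodMk hA) hB hind hf hint
    _ ≤ 0 := integral_nonpos fun ω => by
        simp only [f, integral_const_mul]
        exact mul_nonpos_of_nonneg_of_nonpos (Real.exp_pos _).le (hneg ω)

end ExponentialMoment

section MeanDeviation

variable {Ω : Type*} {mΩ : MeasurableSpace Ω} {μ : Measure Ω} [IsProbabilityMeasure μ]

lemma integral_abs_sub_integral_le_sqrt_variance {Y : Ω → ℝ} (hY : MemLp Y 2 μ) :
    ∫ ω, |Y ω - μ[Y]| ∂μ ≤ √Var[Y; μ] := by
  have hdev : MemLp (fun ω => |Y ω - μ[Y]|) 2 μ := (hY.sub (memLp_const _)).abs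
  have hvar := variance_nonneg (fun ω => |Y ω - μ[Y]|) μ
  rw [variance_eq_sub hdev] at hvar
  refine Real.le_sqrt_of_sq_le ?_
  rw [variance_eq_integral hY.aemeasurable]
  simpa only [Pi.pow_apply, sq_abs, sub_nonneg] using hvar

lemma integral_abs_average_sub_le {X : ℕ → Ω → ℝ} {m σ : ℝ} {n : ℕ} (hn : 0 < n)
    (hX : ∀ j, MemLp (X j) 2 μ) (hmean : ∀ j, μ[X j] = m) (hσ : 0 ≤ σ)
    (hvar : ∀ j, Var[X j; μ] ≤ σ ^ 2) (hind : Pairwise fun j k => IndepFun (X j) (X k) μ) :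
    ∫ ω, |1 / (n : ℝ) * ∑ j ∈ Finset.range n, X j ω - m| ∂μ ≤ σ / √n := by
  have hn' : (0 : ℝ) < n := by exact_mod_cast hn
  let Y : Ω → ℝ := fun ω => 1 / (n : ℝ) * (∑ j ∈ Finset.range n, X j) ω
  have hY : MemLp Y 2 μ := (memLp_finsetSum' _ fun j _ => hX j).const_mul _
  have hY_mean : μ[Y] = m := by
    simp only [Y, Finset.sum_apply]
    rw [integral_const_mul, integral_finsetSum _ fun j _ => (hX j).integrable one_le_two]
    simp only [hmean, Finset.sum_const, Finset.card_range, nsmul_eq_mul]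
    field_simp
  have hY_var : Var[Y; μ] ≤ (σ / √n) ^ 2 := by
    rw [variance_const_mul, IndepFun.variance_sum (fun j _ => hX j) (hind.set_pairwise _)]
    calc (1 / (n : ℝ)) ^ 2 * ∑ j ∈ Finset.range n, Var[X j; μ]
        ≤ (1 / (n : ℝ)) ^ 2 * (n * σ ^ 2) := by
          gcongr
          exact (Finset.sum_le_card_nsmul _ _ _ fun j _ => hvar j).trans_eq (by simp)
      _ = (σ / √n) ^ 2 := by
          rw [div_pow σ, Real.sq_sqrt hn'.le]
          field_simp
  have hdev := integral_abs_sub_integral_le_sqrt_variance hY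
  rw [hY_mean] at hdev
  simpa only [Y, Finset.sum_apply] using hdev.trans (Real.sqrt_le_iff.2 ⟨by positivity, hY_var⟩)

lemma IsCostCDF.integral_integral_abs_sub_le {U c : ℝ} {F : Ω → ℝ → ℝ} {F' : ℝ → ℝ}
    (hm : Measurable (Function.uncurry F)) (hF : ∀ ω, IsCostCDF U (F ω)) (hF' : IsCostCDF U F')
    (hc : ∀ y, ∫ ω, |F ω y - F' y| ∂μ ≤ c) :
    ∫ ω, (∫ y, |F ω y - F' y|) ∂μ ≤ 2 * U * c := by
  have hbound (ω : Ω) := (hF ω).abs_sub_le_indicator hF' ((hF ω).abs_sub_le_one hF')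
  have hint : Integrable (Function.uncurry fun ω y => |F ω y - F' y|) (μ.prod volume) :=
    ((integrable_indicator_Icc U 1).comp_snd μ).mono'
      (hm.sub (hF'.measurable.comp measurable_snd)).norm.aestronglyMeasurable
      (.of_forall fun q => (Real.norm_eq_abs _).trans_le <|
        (abs_abs _).trans_le (hbound q.1 q.2))
  calc ∫ ω, (∫ y, |F ω y - F' y|) ∂μ
      = ∫ y, (∫ ω, |F ω y - F' y| ∂μ) := integral_integral_swap hint
    _ ≤ ∫ y, (Set.Icc (-U) U).indicator (fun _ => c) y := by
        refine integral_mono hint.integral_prod_right (integrable_indicator_Icc U c) fun y => ?_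
        by_cases hy : y ∈ Set.Icc (-U) U
        · simpa only [Set.indicator_of_mem hy] using hc y
        · have hzero (ω : Ω) : |F ω y - F' y| = 0 :=
            le_antisymm ((hbound ω y).trans_eq (Set.indicator_of_notMem hy _)) (abs_nonneg _)
          simp only [hzero, integral_zero, Set.indicator_of_notMem hy, le_refl]
    _ = 2 * U * c := by
        obtain ⟨ω⟩ := μ.nonempty_of_neZero
        have hU := (hF ω).bound_nonneg
        rw [integral_indicator measurableSet_Icc, setIntegral_const, Real.volume_real_Icc,
          smul_eq_mul, max_eq_left (by linarith)]
        ring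

end MeanDeviation

section SphereMean

variable {n : ℕ} [Nontrivial (Act n)]

lemma integral_inner_uniformSphere (w : Act n) : ∫ b, inner ℝ b w ∂uniformSphere n = 0 := by
  have hn : (0 : ℝ) < n := by
    rcases Nat.eq_zero_or_pos n with rfl | hn
    · exact (not_subsingleton (Act 0) inferInstance).elim
    · exact_mod_cast hn
  have hnonneg (v : Act n) : 0 ≤ ∫ b, inner ℝ b v ∂uniformSphere n := by
    have h := sub_le_integral_uniformSphere_of_convex_segment (K := 0) (h := fun _ => (1 : ℝ))
      (v := v) (LipschitzWith.const 1) fun w _ s _ => by linarith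
    simp only [sub_self, NNReal.coe_zero, mul_zero, mul_one] at h
    exact nonneg_of_mul_nonneg_right h hn
  have hneg := hnonneg (-w)
  simp only [inner_neg_right, integral_neg, Left.nonneg_neg_iff] at hneg
  exact le_antisymm hneg (hnonneg w)

end SphereMean

namespace RiskGame

variable {N : ℕ} {G : RiskGame N} {Dx U L₀ : ℝ}

lemma integral_inner_gradNoise (hS : G.Standing Dx) (hne : ∀ i, (G.X i).Nonempty)
    (hJ : G.ConvexBounded U) (hL : G.LipschitzCost L₀) (δ : ℝ) (i : Fin N) (q : Profile G.d)
    (c : ℝ) (w : Act (G.d i)) :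
    ∫ b, inner ℝ (G.gradNoise δ i q c b) w ∂uniformSphere (G.d i) = 0 := by
  have := nontrivial_act i hS
  set k : ℝ := (G.d i : ℝ) / δ with hk
  have hcost : Integrable (fun b => G.C i (G.retract (replaceAction q i (q i + δ • b))) *
      inner ℝ b w) (uniformSphere (G.d i)) := by
    simpa only [real_inner_smul_left] using
      (integrable_C_smul i q hS hne hJ hL δ).inner_const (𝕜 := ℝ) w
  have hinner : Integrable (fun b => inner ℝ b w) (uniformSphere (G.d i)) := by
    refine Integrable.of_bound (by fun_prop) ‖w‖ ?_
    filter_upwards [ae_uniformSphere_norm_eq_one] with b hb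
    simpa only [hb, one_mul] using norm_inner_le_norm (𝕜 := ℝ) b w
  have hexpand (b : Act (G.d i)) : inner ℝ (G.gradNoise δ i q c b) w =
      inner ℝ (G.smoothGrad δ i q) w -
        k * (G.C i (G.retract (replaceAction q i (q i + δ • b))) * inner ℝ b w) +
        k * c * inner ℝ b w := by
    rw [gradNoise, inner_sub_left, real_inner_smul_left]
    ring
  simp_rw [hexpand]
  rw [integral_add (by exact (integrable_const _).sub (hcost.const_mul k)) (hinner.const_mul _),
    integral_sub (integrable_const _) (hcost.const_mul k), integral_const_mul, integral_const_mul,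
    integral_inner_uniformSphere, inner_smoothGrad i q hS hne hJ hL, integral_const]
  simp [hk]

variable {Ω : Type*} {mΩ : MeasurableSpace Ω} {μ : Measure Ω}
  {u : Ω → (i : Fin N) → ℕ → Act (G.d i)} {ξ : Ω → (i : Fin N) → ℕ → ℕ → G.Ξ i}

lemma integral_inner_gradNoise_dir (hS : G.Standing Dx) (hne : ∀ i, (G.X i).Nonempty)
    (hJ : G.ConvexBounded U) (hL : G.LipschitzCost L₀)
    (hs : G.IsSampling μ (fun i t ω => u ω i t) fun i t j ω => ξ ω i t j) (δ : ℝ) (i : Fin N)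
    (t : ℕ) (q : Profile G.d) (c : ℝ) (w : Act (G.d i)) :
    ∫ ω, inner ℝ (G.gradNoise δ i q c (u ω i t)) w ∂μ = 0 := by
  have hm : Measurable fun b => inner ℝ (G.gradNoise δ i q c b) w :=
    (measurable_gradNoise hS hne hJ hL δ i measurable_const measurable_const
      measurable_id).inner measurable_const
  rw [← integral_inner_gradNoise hS hne hJ hL δ i q c w, ← hs.law_dir i t]
  exact (integral_map (hs.measurable_dir i t).aemeasurable hm.aestronglyMeasurable).symm

section Sources

/-- The σ-algebras generated by the single directions and by the noise vectors: the independent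
sources of randomness of the algorithm. -/
abbrev sources (G : RiskGame N) (u : Ω → (i : Fin N) → ℕ → Act (G.d i))
    (ξ : Ω → (i : Fin N) → ℕ → ℕ → G.Ξ i) : (Fin N × ℕ) ⊕ (ℕ × ℕ) → MeasurableSpace Ω :=
  Sum.elim (fun k => MeasurableSpace.comap (fun ω => u ω k.1 k.2) inferInstance)
    (fun q => MeasurableSpace.comap (fun ω i => ξ ω i q.1 q.2) inferInstance)

lemma sources_le (hs : G.IsSampling μ (fun i t ω => u ω i t) fun i t j ω => ξ ω i t j)
    (k : (Fin N × ℕ) ⊕ (ℕ × ℕ)) : G.sources u ξ k ≤ mΩ := by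
  rcases k with k | q
  · exact (hs.measurable_dir k.1 k.2).comap_le
  · exact (measurable_pi_lambda _ fun i => hs.measurable_noise i q.1 q.2).comap_le

lemma iIndep_sources (hs : G.IsSampling μ (fun i t ω => u ω i t) fun i t j ω => ξ ω i t j) :
    iIndep (G.sources u ξ) μ := by
  refine iIndep_sumElim ((iIndepFun_iff_iIndep _ _ _).1 hs.indep_dir)
    ((iIndepFun_iff_iIndep _ _ _).1 hs.indep_noise) ?_
  refine indep_of_indep_of_le_left (indep_of_indep_of_le_right
    ((IndepFun_iff_Indep _ _ _).1 hs.indep_dir_noise) (iSup_le fun q => ?_)) (iSup_le fun k => ?_)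
  · exact ((measurable_pi_apply q).comp
      (comap_measurable fun ω (q : ℕ × ℕ) (i : Fin N) => ξ ω i q.1 q.2)).comap_le
  · exact ((measurable_pi_apply k).comp
      (comap_measurable fun ω (k : Fin N × ℕ) => u ω k.1 k.2)).comap_le

variable {S : Set ((Fin N × ℕ) ⊕ (ℕ × ℕ))} {t : ℕ}

lemma measurable_dir_sources {i : Fin N} (h : .inl (i, t) ∈ S) :
    Measurable[⨆ k ∈ S, G.sources u ξ k] fun ω => u ω i t :=
  (comap_measurable fun ω => u ω i t).mono
    (le_iSup₂_of_le (f := fun k (_ : k ∈ S) => G.sources u ξ k) (.inl (i, t)) h le_rfl) le_rfl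

lemma measurable_noise_sources {j : ℕ} (h : .inr (t, j) ∈ S) (i : Fin N) :
    Measurable[⨆ k ∈ S, G.sources u ξ k] fun ω => ξ ω i t j :=
  ((measurable_pi_apply i).comp (comap_measurable fun ω i => ξ ω i t j)).mono
    (le_iSup₂_of_le (f := fun k (_ : k ∈ S) => G.sources u ξ k) (.inr (t, j)) h le_rfl) le_rfl

variable {α : Type*} [MeasurableSpace α] {A : Ω → α}

lemma indepFun_dir_of_forall_measurable
    (hs : G.IsSampling μ (fun i t ω => u ω i t) fun i t j ω => ξ ω i t j) (i : Fin N) (t : ℕ)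
    (hA : ∀ m : MeasurableSpace Ω, (∀ k, ∀ s ≤ t, Measurable[m] fun ω => u ω k s) →
      (∀ k, k ≠ i → Measurable[m] fun ω => u ω k (t + 1)) →
      (∀ k, ∀ s ≤ t, ∀ j, Measurable[m] fun ω => ξ ω k s j) → Measurable[m] A) :
    IndepFun A (fun ω => u ω i (t + 1)) μ := by
  let S : Set ((Fin N × ℕ) ⊕ (ℕ × ℕ)) :=
    {k | Sum.elim (fun k => k.2 ≤ t ∨ (k.2 = t + 1 ∧ k.1 ≠ i)) (fun q => q.1 ≤ t) k}
  have hdisj : Disjoint S {.inl (i, t + 1)} := by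
    rw [Set.disjoint_singleton_right]
    simp [S]
  have hA' : Measurable[⨆ k ∈ S, G.sources u ξ k] A :=
    hA _ (fun k s hst => measurable_dir_sources (Or.inl hst))
      (fun k hk => measurable_dir_sources (Or.inr ⟨rfl, hk⟩))
      fun k s hst j => measurable_noise_sources (S := S) hst k
  exact indepFun_of_iIndep_of_measurable (sources_le hs) (iIndep_sources hs) hdisj hA'
    (measurable_dir_sources (Set.mem_singleton _))

lemma indepFun_noise_of_forall_measurable
    (hs : G.IsSampling μ (fun i t ω => u ω i t) fun i t j ω => ξ ω i t j) (i : Fin N) (t : ℕ)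
    (hA : ∀ m : MeasurableSpace Ω, (∀ k, ∀ s ≤ t + 1, Measurable[m] fun ω => u ω k s) →
      (∀ k, ∀ s ≤ t, ∀ j, Measurable[m] fun ω => ξ ω k s j) → Measurable[m] A) :
    IndepFun A (fun ω => ξ ω i (t + 1)) μ := by
  let S : Set ((Fin N × ℕ) ⊕ (ℕ × ℕ)) :=
    {k | Sum.elim (fun k => k.2 ≤ t + 1) (fun q => q.1 ≤ t) k}
  let S' : Set ((Fin N × ℕ) ⊕ (ℕ × ℕ)) :=
    {k | Sum.elim (fun _ => False) (fun q => q.1 = t + 1) k}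
  have hdisj : Disjoint S S' := by
    rw [Set.disjoint_left]
    rintro (k | q) hq hq'
    · exact hq'
    · exact absurd (hq'.symm.trans_le hq) (by omega)
  have hA' : Measurable[⨆ k ∈ S, G.sources u ξ k] A :=
    hA _ (fun k s hst => measurable_dir_sources (S := S) hst)
      fun k s hst j => measurable_noise_sources (S := S) hst k
  have hξ : Measurable[⨆ k ∈ S', G.sources u ξ k] fun ω => ξ ω i (t + 1) :=
    @measurable_pi_lambda _ _ _ (⨆ k ∈ S', G.sources u ξ k) _ _
      fun j => measurable_noise_sources (S := S') (t := t + 1) (j := j) rfl i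
  exact indepFun_of_iIndep_of_measurable (sources_le hs) (iIndep_sources hs) hdisj hA' hξ

end Sources

section SampleMean

variable {i : Fin N} {n : ℕ} {x : Profile G.d} [IsProbabilityMeasure μ]

lemma integral_abs_edf_sub_cdf_le (hS : G.Standing Dx)
    (hs : G.IsSampling μ (fun i t ω => u ω i t) fun i t j ω => ξ ω i t j) (hn : 0 < n)
    (hx : x ∈ G.joint) (t : ℕ) (y : ℝ) :
    ∫ ω, |G.edf i n x (ξ ω i t) y - G.cdf i x y| ∂μ ≤ 1 / 2 / √n := by
  let g : G.Ξ i → ℝ := {z | G.J i x z ≤ y}.indicator 1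
  have hsublevel : MeasurableSet {z | G.J i x z ≤ y} :=
    measurableSet_le (hS.measurable_cost i x hx) measurable_const
  have hg : Measurable g := measurable_one.indicator hsublevel
  have hg_eval : Measurable fun v : (k : Fin N) → G.Ξ k => g (v i) :=
    hg.comp (measurable_pi_apply i)
  have hX (j : ℕ) : Measurable fun ω => g (ξ ω i t j) := hg.comp (hs.measurable_noise i t j)
  have hX_mem (j : ℕ) : ∀ᵐ ω ∂μ, g (ξ ω i t j) ∈ Set.Icc 0 1 := .of_forall fun ω =>
    ⟨Set.indicator_nonneg (fun _ _ => zero_le_one) _, Set.indicator_le_self' (by simp) _⟩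
  refine integral_abs_average_sub_le (X := fun j ω => g (ξ ω i t j)) (σ := 1 / 2) hn
    (fun j => memLp_of_bounded (hX_mem j) (hX j).aestronglyMeasurable 2) (fun j => ?_) (by norm_num)
    (fun j => ?_) fun j k hjk => ?_
  · calc ∫ ω, g (ξ ω i t j) ∂μ = ∫ z, g z ∂μ.map fun ω => ξ ω i t j :=
          (integral_map (hs.measurable_noise i t j).aemeasurable hg.aestronglyMeasurable).symm
      _ = G.cdf i x y := by rw [hs.law_noise, integral_indicator_one hsublevel, cdf]
  · simpa only [sub_zero] using variance_le_sq_of_bounded (hX_mem j) (hX j).aemeasurable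
  · exact (hs.indep_noise.indepFun (i := (t, j)) (j := (t, k)) (by simpa using hjk)).comp
      (φ := fun v => g (v i)) (ψ := fun v => g (v i)) hg_eval hg_eval

lemma integral_cdfError_le (hS : G.Standing Dx) (hJ : G.ConvexBounded U) (hL : G.LipschitzCost L₀)
    (hs : G.IsSampling μ (fun i t ω => u ω i t) fun i t j ω => ξ ω i t j) (hn : 0 < n)
    (hx : x ∈ G.joint) (t : ℕ) : ∫ ω, G.cdfError i n x (ξ ω i t) ∂μ ≤ U / √n := by
  have hedf : Measurable (Function.uncurry fun ω => G.edf i n x (ξ ω i t)) :=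
    measurable_edf hS hL i n measurable_const (fun _ => hx) fun j => hs.measurable_noise i t j
  calc ∫ ω, G.cdfError i n x (ξ ω i t) ∂μ ≤ 2 * U * (1 / 2 / √n) :=
        IsCostCDF.integral_integral_abs_sub_le hedf (fun ω => isCostCDF_edf hJ i hn hx _)
          (isCostCDF_cdf hS hJ i hx) (integral_abs_edf_sub_cdf_le hS hs hn hx t)
    _ = U / √n := by ring

lemma abs_cdfError_le (hS : G.Standing Dx) (hJ : G.ConvexBounded U) (hn : 0 < n) (hx : x ∈ G.joint)
    (ζ : ℕ → G.Ξ i) : |G.cdfError i n x ζ| ≤ 2 * U :=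
  (abs_of_nonneg (integral_nonneg fun _ => abs_nonneg _)).trans_le <|
    ((isCostCDF_edf hJ i hn hx ζ).integral_abs_sub_le (isCostCDF_cdf hS hJ i hx)
      ((isCostCDF_edf hJ i hn hx ζ).abs_sub_le_one (isCostCDF_cdf hS hJ i hx))).trans_eq (mul_one _)

lemma integral_cdfError_sub_nonpos (hS : G.Standing Dx) (hJ : G.ConvexBounded U)
    (hL : G.LipschitzCost L₀)
    (hs : G.IsSampling μ (fun i t ω => u ω i t) fun i t j ω => ξ ω i t j) (hn : 0 < n)
    (hx : x ∈ G.joint) (t : ℕ) : ∫ ω, (G.cdfError i n x (ξ ω i t) - U / √n) ∂μ ≤ 0 := by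
  have hm : Measurable fun ω => G.cdfError i n x (ξ ω i t) :=
    measurable_cdfError hS (fun k => ⟨_, hx k⟩) hL i n measurable_const (fun _ => hx)
      fun j => hs.measurable_noise i t j
  have hint : Integrable (fun ω => G.cdfError i n x (ξ ω i t)) μ :=
    .of_bound hm.aestronglyMeasurable (2 * U) (.of_forall fun ω => abs_cdfError_le hS hJ hn hx _)
  rw [integral_sub hint (integrable_const _), integral_const, probReal_univ, one_smul, sub_nonpos]
  exact integral_cdfError_le hS hJ hL hs hn hx t

end SampleMean

section Increments

variable {p : Params N} {x₁ : Profile G.d} {v₀ : Fin N → ℝ} {T : ℕ} [IsProbabilityMeasure μ]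

lemma integral_exp_mul_noiseIncrement_nonpos (hS : G.Standing Dx) (hJ : G.ConvexBounded U)
    (hL : G.LipschitzCost L₀) (hp : p.Admissible T) (hx₁ : ∀ i, x₁ i ∈ shrink (G.X i) p.δ)
    (hv₀ : ∀ i, |v₀ i| ≤ U)
    (hs : G.IsSampling μ (fun i t ω => u ω i t) fun i t j ω => ξ ω i t j)
    (hu : ∀ ω i t, ‖u ω i t‖ = 1) (i : Fin N) {t : ℕ} (ht : t < T) {l : ℝ} (hl : 0 ≤ l) :
    ∫ ω, Real.exp (l * ∑ s ∈ Finset.range t, G.noiseIncrement p x₁ v₀ (u ω) (ξ ω) i s) *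
      G.noiseIncrement p x₁ v₀ (u ω) (ξ ω) i t ∂μ ≤ 0 := by
  have hne (k : Fin N) : (G.X k).Nonempty := ⟨_, (hx₁ k).1⟩
  let W : Ω → ℝ := fun ω => ∑ s ∈ Finset.range t, G.noiseIncrement p x₁ v₀ (u ω) (ξ ω) i s
  let A : Ω → Profile G.d × ℝ × Act (G.d i) := fun ω =>
    (G.baseProfile p x₁ v₀ (u ω) (ξ ω) i t, (G.state p x₁ v₀ (u ω) (ξ ω) t).est i,
      G.ghost p x₁ v₀ (u ω) (ξ ω) i t)
  let g : Profile G.d × ℝ × Act (G.d i) → Act (G.d i) → ℝ := fun a b =>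
    inner ℝ (G.gradNoise p.δ i a.1 a.2.1 b) (a.1 i - a.2.2)
  have hWA (m : MeasurableSpace Ω) (hmu : ∀ k, ∀ s ≤ t, Measurable[m] fun ω => u ω k s)
      (hmu' : ∀ k, k ≠ i → Measurable[m] fun ω => u ω k (t + 1))
      (hmξ : ∀ k, ∀ s ≤ t, ∀ j, Measurable[m] fun ω => ξ ω k s j) :
      Measurable[m] W ∧ Measurable[m] A := by
    obtain ⟨hx, -, hest⟩ := measurable_state (v₀ := v₀) hS hJ hL hp hx₁ hu ht.le hmu hmξ
    exact ⟨measurable_sum_noiseIncrement hS hJ hL hp hx₁ hu i ht.le hmu fun k s hs => hmξ k s hs.le,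
      (measurable_baseProfile hx hmu').prodMk
        ((hest i).prodMk (measurable_ghost hS hJ hL hp hx₁ hu i ht.le hmu hmξ))⟩
  obtain ⟨hW, hA⟩ := hWA mΩ (fun k s _ => hs.measurable_dir k s)
    (fun k _ => hs.measurable_dir k (t + 1)) fun k s _ j => hs.measurable_noise k s j
  have hind : IndepFun (fun ω => (W ω, A ω)) (fun ω => u ω i (t + 1)) μ :=
    indepFun_dir_of_forall_measurable hs i t fun m hmu hmu' hmξ =>
      (hWA m hmu hmu' hmξ).1.prodMk (hWA m hmu hmu' hmξ).2
  have hg : Measurable (Function.uncurry g) :=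
    (measurable_gradNoise hS hne hJ hL p.δ i measurable_fst.fst (by fun_prop) measurable_snd).inner
      ((measurable_profile_apply measurable_fst.fst i).sub (by fun_prop))
  have hincrement (ω : Ω) :
      G.noiseIncrement p x₁ v₀ (u ω) (ξ ω) i t = g (A ω) (u ω i (t + 1)) := by
    simp only [g, A, baseProfile_apply, noiseIncrement, noiseAt]
  have hbound (ω : Ω) {s : ℕ} (hst : s ≤ t) :
      |G.noiseIncrement p x₁ v₀ (u ω) (ξ ω) i s| ≤ G.d i / p.δ * (3 * U) * Dx :=
    abs_noiseIncrement_le hS hJ hp hx₁ hv₀ (hu ω) i (hst.trans_lt ht)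
  have hWk (ω : Ω) : |W ω| ≤ (Finset.range t).card • (G.d i / p.δ * (3 * U) * Dx) :=
    (Finset.abs_sum_le_sum_abs _ _).trans
      (Finset.sum_le_card_nsmul _ _ _ fun s hst => hbound ω (Finset.mem_range.1 hst).le)
  have hgc (ω : Ω) : |g (A ω) (u ω i (t + 1))| ≤ G.d i / p.δ * (3 * U) * Dx :=
    (congrArg abs (hincrement ω)).symm.trans_le (hbound ω le_rfl)
  simp_rw [hincrement]
  exact integral_exp_mul_nonpos_of_indepFun (g := g) (A := A) hW hA (hs.measurable_dir i (t + 1))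
    hind hg hWk hgc (fun ω =>
      (integral_inner_gradNoise_dir hS hne hJ hL hs p.δ i (t + 1) _ _ _).le) hl

/-- The error of the empirical distribution function of agent `i` in episode `t + 1`, minus an upper
bound for its conditional mean: a supermartingale increment. -/
def errorIncrement (G : RiskGame N) (U : ℝ) (p : Params N) (x₁ : Profile G.d) (v₀ : Fin N → ℝ)
    (u : (i : Fin N) → ℕ → Act (G.d i)) (ξ : (i : Fin N) → ℕ → ℕ → G.Ξ i) (i : Fin N) (t : ℕ) :
    ℝ :=
  G.cdfError i (p.n (t + 1)) (G.played p x₁ v₀ u ξ (t + 1)) (ξ i (t + 1)) - U / √(p.n (t + 1))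

lemma measurable_errorIncrement {m : MeasurableSpace Ω} (hS : G.Standing Dx)
    (hJ : G.ConvexBounded U) (hL : G.LipschitzCost L₀) (hp : p.Admissible T)
    (hx₁ : ∀ i, x₁ i ∈ shrink (G.X i) p.δ) (hu : ∀ ω i t, ‖u ω i t‖ = 1) (i : Fin N) {t : ℕ}
    (ht : t ≤ T) (hmu : ∀ k, ∀ s ≤ t + 1, Measurable[m] fun ω => u ω k s)
    (hmξ : ∀ k, ∀ s ≤ t + 1, ∀ j, Measurable[m] fun ω => ξ ω k s j) :
    Measurable[m] fun ω => G.errorIncrement U p x₁ v₀ (u ω) (ξ ω) i t := by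
  obtain ⟨hx, -, -⟩ := measurable_state (v₀ := v₀) hS hJ hL hp hx₁ hu ht
    (fun k s hs => hmu k s (by omega)) fun k s hs => hmξ k s (by omega)
  exact (measurable_cdfError hS (fun k => ⟨_, (hx₁ k).1⟩) hL i _
    (measurable_played hx fun k => hmu k (t + 1) le_rfl)
    (fun ω => played_mem_joint hS hp.radius_pos.le hx₁ (hu ω) _)
    fun j => hmξ i (t + 1) le_rfl j).sub_const _

lemma abs_errorIncrement_le (hS : G.Standing Dx) (hJ : G.ConvexBounded U) (hp : p.Admissible T)
    (hx₁ : ∀ i, x₁ i ∈ shrink (G.X i) p.δ) {u : (i : Fin N) → ℕ → Act (G.d i)}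
    {ξ : (i : Fin N) → ℕ → ℕ → G.Ξ i} (hu : ∀ i t, ‖u i t‖ = 1) (i : Fin N) {t : ℕ}
    (ht : t < T) : |G.errorIncrement U p x₁ v₀ u ξ i t| ≤ 2 * U := by
  have hn := hp.sampleSize_pos _ t.succ_pos ht
  have hmem := played_mem_joint (v₀ := v₀) (ξ := ξ) hS hp.radius_pos.le hx₁ hu (t + 1)
  have hU := (isCostCDF_cdf hS hJ i hmem).bound_nonneg
  have hone : 1 ≤ √(p.n (t + 1) : ℝ) := Real.one_le_sqrt.2 (by exact_mod_cast hn)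
  exact abs_sub_le_of_nonneg_of_le (integral_nonneg fun _ => abs_nonneg _)
    ((le_abs_self _).trans (abs_cdfError_le hS hJ hn hmem _)) (by positivity)
    ((div_le_self hU hone).trans (by linarith))

lemma integral_exp_mul_errorIncrement_nonpos (hS : G.Standing Dx) (hJ : G.ConvexBounded U)
    (hL : G.LipschitzCost L₀) (hp : p.Admissible T) (hx₁ : ∀ i, x₁ i ∈ shrink (G.X i) p.δ)
    (hs : G.IsSampling μ (fun i t ω => u ω i t) fun i t j ω => ξ ω i t j)
    (hu : ∀ ω i t, ‖u ω i t‖ = 1) (i : Fin N) {t : ℕ} (ht : t < T) {l : ℝ} (hl : 0 ≤ l) :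
    ∫ ω, Real.exp (l * ∑ s ∈ Finset.range t, G.errorIncrement U p x₁ v₀ (u ω) (ξ ω) i s) *
      G.errorIncrement U p x₁ v₀ (u ω) (ξ ω) i t ∂μ ≤ 0 := by
  have hne (k : Fin N) : (G.X k).Nonempty := ⟨_, (hx₁ k).1⟩
  let W : Ω → ℝ := fun ω => ∑ s ∈ Finset.range t, G.errorIncrement U p x₁ v₀ (u ω) (ξ ω) i s
  let A : Ω → Profile G.d := fun ω => G.played p x₁ v₀ (u ω) (ξ ω) (t + 1)
  let g : Profile G.d → (ℕ → G.Ξ i) → ℝ := fun x ζ =>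
    G.cdfError i (p.n (t + 1)) (G.retract x) ζ - U / √(p.n (t + 1))
  have hWA (m : MeasurableSpace Ω) (hmu : ∀ k, ∀ s ≤ t + 1, Measurable[m] fun ω => u ω k s)
      (hmξ : ∀ k, ∀ s ≤ t, ∀ j, Measurable[m] fun ω => ξ ω k s j) :
      Measurable[m] W ∧ Measurable[m] A := by
    obtain ⟨hx, -, -⟩ := measurable_state (v₀ := v₀) hS hJ hL hp hx₁ hu ht.le
      (fun k s hs => hmu k s (by omega)) hmξ
    refine ⟨Finset.measurable_fun_sum _ fun s hst => ?_,
      measurable_played hx fun k => hmu k (t + 1) le_rfl⟩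
    have hst := Finset.mem_range.1 hst
    exact measurable_errorIncrement hS hJ hL hp hx₁ hu i (by omega)
      (fun k r hr => hmu k r (by omega)) fun k r hr => hmξ k r (by omega)
  obtain ⟨hW, hA⟩ := hWA mΩ (fun k s _ => hs.measurable_dir k s)
    fun k s _ j => hs.measurable_noise k s j
  have hind : IndepFun (fun ω => (W ω, A ω)) (fun ω => ξ ω i (t + 1)) μ :=
    indepFun_noise_of_forall_measurable hs i t fun m hmu hmξ =>
      (hWA m hmu hmξ).1.prodMk (hWA m hmu hmξ).2
  have hg : Measurable (Function.uncurry g) :=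
    (measurable_cdfError_retract hS hne hL i _).sub_const _
  have hincrement (ω : Ω) :
      G.errorIncrement U p x₁ v₀ (u ω) (ξ ω) i t = g (A ω) (ξ ω i (t + 1)) := by
    simp only [g, A, errorIncrement,
      retract_eq_self hS (played_mem_joint hS hp.radius_pos.le hx₁ (hu ω) (t + 1))]
  have hbound (ω : Ω) {s : ℕ} (hst : s ≤ t) :
      |G.errorIncrement U p x₁ v₀ (u ω) (ξ ω) i s| ≤ 2 * U :=
    abs_errorIncrement_le hS hJ hp hx₁ (hu ω) i (hst.trans_lt ht)
  have hWk (ω : Ω) : |W ω| ≤ (Finset.range t).card • (2 * U) :=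
    (Finset.abs_sum_le_sum_abs _ _).trans
      (Finset.sum_le_card_nsmul _ _ _ fun s hst => hbound ω (Finset.mem_range.1 hst).le)
  have hgc (ω : Ω) : |g (A ω) (ξ ω i (t + 1))| ≤ 2 * U :=
    (congrArg abs (hincrement ω)).symm.trans_le (hbound ω le_rfl)
  simp_rw [hincrement]
  exact integral_exp_mul_nonpos_of_indepFun (g := g) (A := A) hW hA
    (measurable_pi_lambda _ fun j => hs.measurable_noise i (t + 1) j) hind hg
    hWk hgc (fun ω => integral_cdfError_sub_nonpos hS hJ hL hs
      (hp.sampleSize_pos _ t.succ_pos ht) (retract_mem_joint hS hne _) _) hl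

end Increments

end RiskGame

section PowerSums

lemma rpow_neg_add_one_le_two_mul_sub {s : ℝ} (hs₀ : 0 ≤ s) (hs₁ : s ≤ 1 / 2) (m : ℕ) :
    ((m : ℝ) + 1) ^ (-s) ≤ 2 * (((m : ℝ) + 1) ^ (1 - s) - (m : ℝ) ^ (1 - s)) := by
  have hm : (0 : ℝ) < m + 1 := by positivity
  have hbernoulli : ((m : ℝ) / (m + 1)) ^ (1 - s) ≤ 1 - (1 - s) / (m + 1) := by
    have h := rpow_one_add_le_one_add_mul_self (s := -1 / ((m : ℝ) + 1)) (p := 1 - s)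
      (by rw [le_div_iff₀ hm]; linarith [m.cast_nonneg (α := ℝ)]) (by linarith) (by linarith)
    convert h using 2 <;> field_simp <;> ring
  rw [Real.div_rpow m.cast_nonneg hm.le, div_le_iff₀ (by positivity)] at hbernoulli
  have hsplit : ((m : ℝ) + 1) ^ (1 - s) = (m + 1) * ((m : ℝ) + 1) ^ (-s) := by
    rw [sub_eq_add_neg, Real.rpow_add hm, Real.rpow_one]
  have hincrement : (1 - s) / ((m : ℝ) + 1) * ((m : ℝ) + 1) ^ (1 - s) =
      (1 - s) * ((m : ℝ) + 1) ^ (-s) := by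
    rw [hsplit]
    field_simp
  have hhalf : ((m : ℝ) + 1) ^ (-s) ≤ 2 * ((1 - s) * ((m : ℝ) + 1) ^ (-s)) := by
    nlinarith [Real.rpow_pos_of_pos hm (-s)]
  linarith

lemma sum_range_add_one_rpow_neg_le {s : ℝ} (hs₀ : 0 ≤ s) (hs₁ : s ≤ 1 / 2) (m : ℕ) :
    ∑ k ∈ Finset.range m, ((k : ℝ) + 1) ^ (-s) ≤ 2 * (m : ℝ) ^ (1 - s) := by
  calc ∑ k ∈ Finset.range m, ((k : ℝ) + 1) ^ (-s)
      ≤ ∑ k ∈ Finset.range m, (2 * ((k + 1 : ℕ) : ℝ) ^ (1 - s) - 2 * (k : ℝ) ^ (1 - s)) := by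
        gcongr with k
        push_cast
        linarith [rpow_neg_add_one_le_two_mul_sub hs₀ hs₁ k]
    _ = 2 * (m : ℝ) ^ (1 - s) := by
        rw [Finset.sum_range_sub fun k : ℕ => 2 * (k : ℝ) ^ (1 - s), Nat.cast_zero,
          Real.zero_rpow (by linarith), mul_zero, sub_zero]

lemma sum_range_sub_rpow_neg_le {s : ℝ} (hs₀ : 0 ≤ s) (hs₁ : s ≤ 1 / 2) (m : ℕ) :
    ∑ k ∈ Finset.range m, ((m : ℝ) - k) ^ (-s) ≤ 2 * (m : ℝ) ^ (1 - s) := by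
  refine le_of_eq_of_le ?_ (sum_range_add_one_rpow_neg_le hs₀ hs₁ m)
  rw [← Finset.sum_range_reflect]
  refine Finset.sum_congr rfl fun k hk => ?_
  have hk := Finset.mem_range.1 hk
  rw [Nat.cast_sub (by omega), Nat.cast_sub (by omega), Nat.cast_one]
  congr 1
  ring

end PowerSums

lemma measure_not_forall_and_le {Ω : Type*} {mΩ : MeasurableSpace Ω} {μ : Measure Ω} {N : ℕ}
    (hN : 0 < N) {P Q : Fin N → Ω → Prop} {γ : ℝ}
    (hP : ∀ i, μ {ω | ¬ P i ω} ≤ ENNReal.ofReal (γ / (2 * N)))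
    (hQ : ∀ i, μ {ω | ¬ Q i ω} ≤ ENNReal.ofReal (γ / (2 * N))) :
    μ {ω | ¬ ∀ i, P i ω ∧ Q i ω} ≤ ENNReal.ofReal γ := by
  have hcover : {ω | ¬ ∀ i, P i ω ∧ Q i ω} ⊆ ⋃ i, {ω | ¬ P i ω} ∪ {ω | ¬ Q i ω} := fun ω hω => by
    obtain ⟨i, hi⟩ := not_forall.1 hω
    exact Set.mem_iUnion.2 ⟨i, not_and_or.1 hi⟩
  calc μ {ω | ¬ ∀ i, P i ω ∧ Q i ω}
      ≤ ∑ i : Fin N, μ ({ω | ¬ P i ω} ∪ {ω | ¬ Q i ω}) :=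
        (measure_mono hcover).trans (measure_iUnion_fintype_le μ _)
    _ ≤ ∑ _i : Fin N, (ENNReal.ofReal (γ / (2 * N)) + ENNReal.ofReal (γ / (2 * N))) :=
        Finset.sum_le_sum fun i _ => (measure_union_le _ _).trans (add_le_add (hP i) (hQ i))
    _ = ENNReal.ofReal γ := by
        have hN' : ((2 * N : ℕ) : ℝ) ≠ 0 := by exact_mod_cast (by omega : 2 * N ≠ 0)
        rw [Finset.sum_const, Finset.card_univ, Fintype.card_fin, ← two_nsmul, ← mul_nsmul,
          ← ENNReal.ofReal_nsmul, nsmul_eq_mul]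
        congr 1
        push_cast at hN' ⊢
        field_simp

namespace RiskGame

variable {N : ℕ} {G : RiskGame N} {Dx U L₀ : ℝ} {Ω : Type*} {mΩ : MeasurableSpace Ω}
  {μ : Measure Ω}

section Deviation

variable {p : Params N} {x₁ : Profile G.d} {v₀ : Fin N → ℝ} {T : ℕ} [IsProbabilityMeasure μ]
  {u : Ω → (i : Fin N) → ℕ → Act (G.d i)} {ξ : Ω → (i : Fin N) → ℕ → ℕ → G.Ξ i}

lemma measure_sum_noiseIncrement_gt_le (hS : G.Standing Dx) (hDx : 0 < Dx) (hU : 0 < U)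
    (hJ : G.ConvexBounded U) (hL : G.LipschitzCost L₀) (hp : p.Admissible T) (hT : 0 < T)
    (hx₁ : ∀ i, x₁ i ∈ shrink (G.X i) p.δ) (hv₀ : ∀ i, |v₀ i| ≤ U)
    (hs : G.IsSampling μ (fun i t ω => u ω i t) fun i t j ω => ξ ω i t j)
    (hu : ∀ ω i t, ‖u ω i t‖ = 1) (i : Fin N) {γ : ℝ} (hγ : 0 < γ) (hγ1 : γ < 1) :
    μ {ω | G.d i / p.δ * (3 * U) * Dx * √(2 * T * Real.log (1 / γ)) <
      ∑ t ∈ Finset.range T, G.noiseIncrement p x₁ v₀ (u ω) (ξ ω) i t} ≤ ENNReal.ofReal γ := by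
  have hd : (0 : ℝ) < G.d i := by exact_mod_cast hS.dim_pos i
  have hδ := hp.radius_pos
  exact measure_sum_gt_le_of_integral_exp_mul_nonpos (by positivity) hT hγ hγ1
    (fun t ht => measurable_noiseIncrement hS hJ hL hp hx₁ hu i ht.le
      (fun i s _ => hs.measurable_dir i s) fun i s _ j => hs.measurable_noise i s j)
    (fun t ht ω => abs_noiseIncrement_le hS hJ hp hx₁ hv₀ (hu ω) i ht)
    fun t ht l hl => integral_exp_mul_noiseIncrement_nonpos hS hJ hL hp hx₁ hv₀ hs hu i ht hl.le

lemma measure_sum_errorIncrement_gt_le (hS : G.Standing Dx) (hU : 0 < U)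
    (hJ : G.ConvexBounded U) (hL : G.LipschitzCost L₀) (hp : p.Admissible T) (hT : 0 < T)
    (hx₁ : ∀ i, x₁ i ∈ shrink (G.X i) p.δ)
    (hs : G.IsSampling μ (fun i t ω => u ω i t) fun i t j ω => ξ ω i t j)
    (hu : ∀ ω i t, ‖u ω i t‖ = 1) (i : Fin N) {γ : ℝ} (hγ : 0 < γ) (hγ1 : γ < 1) :
    μ {ω | 2 * U * √(2 * T * Real.log (1 / γ)) <
      ∑ t ∈ Finset.range T, G.errorIncrement U p x₁ v₀ (u ω) (ξ ω) i t} ≤ ENNReal.ofReal γ :=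
  measure_sum_gt_le_of_integral_exp_mul_nonpos (by positivity) hT hγ hγ1
    (fun t ht => measurable_errorIncrement hS hJ hL hp hx₁ hu i ht.le
      (fun i s _ => hs.measurable_dir i s) fun i s _ j => hs.measurable_noise i s j)
    (fun t ht ω => abs_errorIncrement_le hS hJ hp hx₁ (hu ω) i ht)
    fun t ht l hl => integral_exp_mul_errorIncrement_nonpos hS hJ hL hp hx₁ hs hu i ht hl.le

lemma measure_not_forall_sum_increments_le (hS : G.Standing Dx) (hDx : 0 < Dx) (hU : 0 < U)
    (hJ : G.ConvexBounded U) (hL : G.LipschitzCost L₀) (hp : p.Admissible T) (hT : 0 < T)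
    (hx₁ : ∀ i, x₁ i ∈ shrink (G.X i) p.δ) (hv₀ : ∀ i, |v₀ i| ≤ U)
    (hs : G.IsSampling μ (fun i t ω => u ω i t) fun i t j ω => ξ ω i t j)
    (hu : ∀ ω i t, ‖u ω i t‖ = 1) (hN : 0 < N) {γ : ℝ} (hγ : 0 < γ) (hγ1 : γ < 1) :
    μ {ω | ¬ ∀ i,
      ∑ t ∈ Finset.range T, G.noiseIncrement p x₁ v₀ (u ω) (ξ ω) i t ≤
        G.d i / p.δ * (3 * U) * Dx * √(2 * T * Real.log (1 / (γ / (2 * N)))) ∧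
      ∑ t ∈ Finset.range T, G.errorIncrement U p x₁ v₀ (u ω) (ξ ω) i t ≤
        2 * U * √(2 * T * Real.log (1 / (γ / (2 * N))))} ≤ ENNReal.ofReal γ := by
  have hN1 : (1 : ℝ) ≤ N := by exact_mod_cast hN
  have hγN : 0 < γ / (2 * N) := by positivity
  have hγN1 : γ / (2 * N) < 1 := by
    rw [div_lt_one (by positivity)]
    linarith
  refine measure_not_forall_and_le hN (fun i => ?_) fun i => ?_
  · simp only [not_le]
    exact measure_sum_noiseIncrement_gt_le hS hDx hU hJ hL hp hT hx₁ hv₀ hs hu i hγN hγN1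
  · simp only [not_le]
    exact measure_sum_errorIncrement_gt_le hS hU hJ hL hp hT hx₁ hs hu i hγN hγN1

end Deviation

section UnitDirections

variable {n : ℕ} {e v : Act n}

open Classical in
/-- The vector `v` if it has norm `1`, and otherwise the default `e`. It turns directions that are
almost surely unit vectors into directions that are unit vectors everywhere. -/
def toUnit (e v : Act n) : Act n := if ‖v‖ = 1 then v else e

lemma measurable_toUnit (e : Act n) : Measurable (toUnit e) :=
  Measurable.ite (measurableSet_eq_fun measurable_norm measurable_const) measurable_id
    measurable_const

lemma norm_toUnit (he : ‖e‖ = 1) (v : Act n) : ‖toUnit e v‖ = 1 := by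
  unfold toUnit
  split_ifs with h
  · exact h
  · exact he

lemma toUnit_of_norm_eq_one (hv : ‖v‖ = 1) : toUnit e v = v :=
  if_pos hv

lemma map_toUnit_uniformSphere (e : Act n) : (uniformSphere n).map (toUnit e) = uniformSphere n :=
  calc (uniformSphere n).map (toUnit e) = (uniformSphere n).map id :=
        Measure.map_congr (ae_uniformSphere_norm_eq_one.mono fun _ hv => toUnit_of_norm_eq_one hv)
    _ = uniformSphere n := Measure.map_id

variable {u : (i : Fin N) → ℕ → Ω → Act (G.d i)} {ξ : (i : Fin N) → ℕ → ℕ → Ω → G.Ξ i}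

lemma IsSampling.toUnit (hs : G.IsSampling μ u ξ) (e : (i : Fin N) → Act (G.d i)) :
    G.IsSampling μ (fun i t ω => RiskGame.toUnit (e i) (u i t ω)) ξ where
  measurable_dir i t := (measurable_toUnit _).comp (hs.measurable_dir i t)
  measurable_noise := hs.measurable_noise
  law_dir i t := by
    rw [← map_toUnit_uniformSphere (e i), ← hs.law_dir i t,
      Measure.map_map (measurable_toUnit _) (hs.measurable_dir i t), Function.comp_def]
  law_noise := hs.law_noise
  indep_dir := hs.indep_dir.comp (fun k => RiskGame.toUnit (e k.1)) fun k => measurable_toUnit _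
  indep_noise := hs.indep_noise
  indep_dir_noise :=
    hs.indep_dir_noise.comp
      (φ := fun (v : (k : Fin N × ℕ) → Act (G.d k.1)) (k : Fin N × ℕ) =>
        RiskGame.toUnit (e k.1) (v k))
      (measurable_pi_lambda _ fun k => (measurable_toUnit _).comp (measurable_pi_apply k))
      measurable_id

lemma IsSampling.ae_norm_eq_one (hs : G.IsSampling μ u ξ) : ∀ᵐ ω ∂μ, ∀ i t, ‖u i t ω‖ = 1 := by
  simp only [ae_all_iff]
  intro i t
  refine ae_of_ae_map (p := fun v => ‖v‖ = 1) (hs.measurable_dir i t).aemeasurable ?_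
  rw [hs.law_dir]
  exact ae_uniformSphere_norm_eq_one

end UnitDirections

end RiskGame

section Horizon

variable {a b U γ : ℝ} {N T : ℕ}

lemma eight_mul_rpow_le_horizon (ha₀ : 0 < a) (ha₁ : a < 1) (hN : 0 < N)
    (hT : (8 * (N : ℝ) ^ (2 / 3 : ℝ)) ^ (1 / a) ≤ (T : ℝ)) : 8 * (N : ℝ) ^ (2 / 3 : ℝ) ≤ T := by
  have hN1 : 1 ≤ (N : ℝ) ^ (2 / 3 : ℝ) :=
    Real.one_le_rpow (by exact_mod_cast hN) (by norm_num)
  exact (Real.self_le_rpow_of_one_le (by linarith) ((one_le_div ha₀).2 ha₁.le)).trans hT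

lemma eight_le_horizon (hN : 0 < N) (hT : 8 * (N : ℝ) ^ (2 / 3 : ℝ) ≤ T) : (8 : ℝ) ≤ T := by
  have : 1 ≤ (N : ℝ) ^ (2 / 3 : ℝ) := Real.one_le_rpow (by exact_mod_cast hN) (by norm_num)
  linarith

lemma two_mul_le_horizon_sq (hN : 0 < N) (hT : 8 * (N : ℝ) ^ (2 / 3 : ℝ) ≤ T) :
    2 * (N : ℝ) ≤ (T : ℝ) ^ 2 := by
  have hN_le : (N : ℝ) ≤ ((N : ℝ) ^ (2 / 3 : ℝ)) ^ 2 := by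
    rw [← Real.rpow_mul_natCast (by positivity)]
    exact Real.self_le_rpow_of_one_le (by exact_mod_cast hN) (by norm_num)
  calc 2 * (N : ℝ) ≤ (8 * (N : ℝ) ^ (2 / 3 : ℝ)) ^ 2 := by linarith
    _ ≤ (T : ℝ) ^ 2 := by gcongr

lemma one_le_log_horizon (hT : (8 : ℝ) ≤ T) (hγ : 0 < γ) (hγ1 : γ < 1) :
    1 ≤ Real.log (T / γ) := by
  rw [Real.le_log_iff_exp_le (by positivity), le_div_iff₀ hγ]
  have hexp := Real.exp_one_lt_d9
  nlinarith [Real.exp_pos 1]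

lemma log_union_bound_le (hN : 0 < N) (hT : 2 * (N : ℝ) ≤ (T : ℝ) ^ 2) (hγ : 0 < γ)
    (hγ1 : γ < 1) : Real.log (1 / (γ / (2 * N))) ≤ 2 * Real.log (T / γ) := by
  have : (0 : ℝ) < N := by exact_mod_cast hN
  rw [show (2 : ℝ) * Real.log (T / γ) = Real.log ((T / γ) ^ 2) by rw [Real.log_pow]; norm_num]
  refine Real.log_le_log (by positivity) ?_
  calc 1 / (γ / (2 * N)) = 2 * N / γ := by rw [one_div_div]
    _ ≤ (T : ℝ) ^ 2 / γ ^ 2 :=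
        div_le_div₀ (by positivity) hT (by positivity) (pow_le_of_le_one hγ.le hγ1.le two_ne_zero)
    _ = (T / γ) ^ 2 := (div_pow _ _ 2).symm

lemma sqrt_log_union_bound_le (hN : 0 < N) (hT : 8 * (N : ℝ) ^ (2 / 3 : ℝ) ≤ T) (hγ : 0 < γ)
    (hγ1 : γ < 1) :
    √(2 * T * Real.log (1 / (γ / (2 * N)))) ≤ 2 * √T * Real.log (T / γ) := by
  have hlog := one_le_log_horizon (eight_le_horizon hN hT) hγ hγ1
  have hunion := log_union_bound_le hN (two_mul_le_horizon_sq hN hT) hγ hγ1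
  refine Real.sqrt_le_iff.2 ⟨by positivity, ?_⟩
  calc 2 * T * Real.log (1 / (γ / (2 * N)))
      ≤ 2 * T * (2 * Real.log (T / γ) ^ 2) := by
        gcongr
        nlinarith
    _ = (2 * √T * Real.log (T / γ)) ^ 2 := by
        rw [mul_pow, mul_pow, Real.sq_sqrt T.cast_nonneg]
        ring

lemma sampleSize_pos (hb : 0 < b) (hU : 0 < U) {t : ℕ} (ht : t ≤ T) :
    0 < sampleSize a b U T t := by
  have : (0 : ℝ) ≤ T - t := sub_nonneg.2 (by exact_mod_cast ht)
  exact Nat.ceil_pos.2 (by positivity)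

lemma div_sqrt_sampleSize_le (hb : 0 < b) (hU : 0 < U) {t : ℕ} (ht : t < T) :
    U / √(sampleSize a b U T (t + 1)) ≤ 1 / √b * ((T : ℝ) - t) ^ (-(a / 2)) := by
  have hpos : (0 : ℝ) < T - t := sub_pos.2 (by exact_mod_cast ht)
  have : 0 < ((T : ℝ) - t) ^ (a / 2) := Real.rpow_pos_of_pos hpos _
  have hsqrt : √b * U * ((T : ℝ) - t) ^ (a / 2) ≤ √(sampleSize a b U T (t + 1)) := by
    refine Real.le_sqrt_of_sq_le ?_
    calc (√b * U * ((T : ℝ) - t) ^ (a / 2)) ^ 2 = b * U ^ 2 * ((T : ℝ) - t) ^ a := by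
          rw [mul_pow, mul_pow, Real.sq_sqrt hb.le, ← Real.rpow_mul_natCast hpos.le]
          norm_num
      _ = b * U ^ 2 * ((T : ℝ) - (t + 1 : ℕ) + 1) ^ a := by push_cast; ring_nf
      _ ≤ sampleSize a b U T (t + 1) := Nat.le_ceil _
  have := Real.sqrt_pos.2 hb
  calc U / √(sampleSize a b U T (t + 1)) ≤ U / (√b * U * ((T : ℝ) - t) ^ (a / 2)) := by gcongr
    _ = 1 / √b * ((T : ℝ) - t) ^ (-(a / 2)) := by
        rw [Real.rpow_neg hpos.le]
        field_simp

lemma sum_div_sqrt_sampleSize_le (ha₀ : 0 < a) (ha₁ : a < 1) (hb : 0 < b) (hU : 0 < U) (T : ℕ) :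
    ∑ t ∈ Finset.range T, U / √(sampleSize a b U T (t + 1)) ≤
      2 / √b * (T : ℝ) ^ (1 - a / 2) := by
  calc ∑ t ∈ Finset.range T, U / √(sampleSize a b U T (t + 1))
      ≤ 1 / √b * ∑ t ∈ Finset.range T, ((T : ℝ) - t) ^ (-(a / 2)) := by
        rw [Finset.mul_sum]
        exact Finset.sum_le_sum fun t ht => div_sqrt_sampleSize_le hb hU (Finset.mem_range.1 ht)
    _ ≤ 1 / √b * (2 * (T : ℝ) ^ (1 - a / 2)) := by
        gcongr
        exact sum_range_sub_rpow_neg_le (by linarith) (by linarith) T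
    _ = 2 / √b * (T : ℝ) ^ (1 - a / 2) := by ring

end Horizon

/-- The orders of magnitude in the regret bound, and all that the bound uses about them: `ℓ` is the
common lower bound of `D` and `L₀`, there are `n` agents, `S = S(α)`, `L = ln (T / γ)`,
`c = n^(1/6)` and `τ = T^(a/4)`. -/
structure RateScales (ℓ D L₀ d n c S L T τ : ℝ) : Prop where
  lower_pos : 0 < ℓ
  lower_le_diam : ℓ ≤ D
  lower_le_lipschitz : ℓ ≤ L₀
  one_le_dim : 1 ≤ d
  one_le_c : 1 ≤ c
  c_sq_le_agents : c ^ 2 ≤ n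
  one_le_S : 1 ≤ S
  one_le_log : 1 ≤ L
  one_le_τ : 1 ≤ τ
  τ_sq_le_sqrt : τ ^ 2 ≤ √T

namespace RateScales

variable {ℓ D L₀ d n c S L T τ η δ s U b C₀ ρ κ : ℝ} (h : RateScales ℓ D L₀ d n c S L T τ)

include h

lemma pos : 0 < D ∧ 0 < L₀ ∧ 0 < d ∧ 0 < n ∧ 0 < c ∧ 0 < S ∧ 0 < L ∧ 0 < T ∧ 0 < τ := by
  obtain ⟨hℓ, hD, hL₀, hd, hc, hcn, hS, hL, hτ, hτT⟩ := h
  have hT : 0 < √T := by nlinarith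
  refine ⟨?_, ?_, ?_, ?_, ?_, ?_, ?_, Real.sqrt_pos.1 hT, ?_⟩ <;> nlinarith

lemma c_le_agents : c ≤ n :=
  (le_self_pow₀ h.one_le_c two_ne_zero).trans h.c_sq_le_agents

lemma one_le_agents : 1 ≤ n :=
  h.one_le_c.trans h.c_le_agents

lemma sq_le_mul : ℓ ^ 2 ≤ D * L₀ := by
  have := h.lower_pos
  rw [sq]
  exact mul_le_mul h.lower_le_diam h.lower_le_lipschitz this.le h.pos.1.le

lemma τ_mul_sqrt_le : τ * √T ≤ T / τ := by
  obtain ⟨-, -, -, -, -, -, -, hT, hτ⟩ := h.pos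
  rw [le_div_iff₀ hτ]
  calc τ * √T * τ = τ ^ 2 * √T := by ring
    _ ≤ √T * √T := by gcongr; exact h.τ_sq_le_sqrt
    _ = T := Real.mul_self_sqrt hT.le

lemma le_rate_div_sq : d * n * S * L * (T / τ) ≤ D * d * L₀ * n * S * L * (T / τ) / ℓ ^ 2 := by
  obtain ⟨-, -, hd, hn, -, hS, hL, hT, hτ⟩ := h.pos
  have hℓ := h.lower_pos
  rw [le_div_iff₀ (by positivity)]
  calc d * n * S * L * (T / τ) * ℓ ^ 2 ≤ d * n * S * L * (T / τ) * (D * L₀) := by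
        gcongr
        exact h.sq_le_mul
    _ = D * d * L₀ * n * S * L * (T / τ) := by ring

lemma le_τ_mul_rate : T ≤ τ * (D * d * L₀ * n * S * L * (T / τ) / ℓ ^ 2) := by
  obtain ⟨-, -, hd, hn, -, hS, -, hT, hτ⟩ := h.pos
  calc T = τ * (1 * 1 * 1 * 1 * (T / τ)) := by field_simp
    _ ≤ τ * (d * n * S * L * (T / τ)) := by
        gcongr
        exacts [h.one_le_dim, h.one_le_agents, h.one_le_S, h.one_le_log]
    _ ≤ τ * (D * d * L₀ * n * S * L * (T / τ) / ℓ ^ 2) := by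
        gcongr
        exact h.le_rate_div_sq

lemma step_mul_le (hη : η = D / (d * L₀ * n) / τ ^ 3) (hδ : δ = D / (c * τ)) :
    η * (d / δ) ≤ δ / ℓ ^ 2 := by
  obtain ⟨hD, hL₀, hd, hn, hc, -, -, -, hτ⟩ := h.pos
  have hℓ := h.lower_pos
  have hstep : η * (d / δ) = c / (L₀ * n * τ ^ 2) := by
    rw [hη, hδ]
    field_simp
  rw [hstep, hδ, div_div, div_le_div_iff₀ (by positivity) (by positivity)]
  calc c * (c * τ * ℓ ^ 2) = ℓ ^ 2 * c ^ 2 * τ := by ring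
    _ ≤ D * L₀ * n * τ ^ 2 := by
        gcongr
        exacts [h.sq_le_mul, h.c_sq_le_agents, le_self_pow₀ h.one_le_τ two_ne_zero]
    _ = D * (L₀ * n * τ ^ 2) := by ring

lemma sq_div_step_le (hη : η = D / (d * L₀ * n) / τ ^ 3) :
    D ^ 2 / η ≤ D * d * L₀ * n * S * L * (T / τ) := by
  obtain ⟨hD, hL₀, hd, hn, -, hS, hL, -, hτ⟩ := h.pos
  have hcube : τ ^ 3 ≤ T / τ :=
    calc τ ^ 3 = τ * τ ^ 2 := by ring
      _ ≤ τ * √T := by gcongr; exact h.τ_sq_le_sqrt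
      _ ≤ T / τ := h.τ_mul_sqrt_le
  calc D ^ 2 / η = D * d * L₀ * n * 1 * 1 * τ ^ 3 := by rw [hη]; field_simp
    _ ≤ D * d * L₀ * n * S * L * (T / τ) := by
        gcongr
        exacts [h.one_le_S, h.one_le_log]

lemma step_mul_sq_le (hη : η = D / (d * L₀ * n) / τ ^ 3) (hδ : δ = D / (c * τ)) :
    η * T * (d / δ) ^ 2 ≤ D * d * L₀ * n * S * L * (T / τ) / ℓ ^ 4 := by
  obtain ⟨hD, hL₀, hd, hn, hc, hS, hL, hT, hτ⟩ := h.pos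
  have hℓ := h.lower_pos
  have hcn : c ^ 2 / n ≤ n :=
    ((div_le_one hn).2 h.c_sq_le_agents).trans h.one_le_agents
  calc η * T * (d / δ) ^ 2 = d * (c ^ 2 / n) * 1 * 1 * (T / τ) / (D * L₀) := by
        rw [hη, hδ]
        field_simp
    _ ≤ d * n * S * L * (T / τ) / ℓ ^ 2 := by
        gcongr
        exacts [h.one_le_S, h.one_le_log, h.sq_le_mul]
    _ ≤ D * d * L₀ * n * S * L * (T / τ) / ℓ ^ 2 / ℓ ^ 2 := by
        gcongr
        exact h.le_rate_div_sq
    _ = D * d * L₀ * n * S * L * (T / τ) / ℓ ^ 4 := by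
        rw [div_div]
        ring_nf

lemma sqrt_term_le (hδ : δ = D / (c * τ)) (hs₀ : 0 ≤ s) (hs : s ≤ S) :
    d / δ * D * (s * (√T * L)) ≤ D * d * L₀ * n * S * L * (T / τ) / ℓ ^ 2 := by
  obtain ⟨hD, -, hd, hn, hc, hS, hL, hT, hτ⟩ := h.pos
  refine le_trans ?_ h.le_rate_div_sq
  calc d / δ * D * (s * (√T * L)) = d * c * s * L * (τ * √T) := by
        rw [hδ]
        field_simp
    _ ≤ d * n * S * L * (T / τ) := by
        gcongr
        exacts [h.c_le_agents, h.τ_mul_sqrt_le]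

lemma sampling_term_le (hδ : δ = D / (c * τ)) (hs₀ : 0 ≤ s) (hs : s ≤ S) :
    d / δ * D * (s * (T / τ ^ 2)) ≤ D * d * L₀ * n * S * L * (T / τ) / ℓ ^ 2 := by
  obtain ⟨hD, -, hd, hn, hc, hS, -, hT, hτ⟩ := h.pos
  refine le_trans ?_ h.le_rate_div_sq
  calc d / δ * D * (s * (T / τ ^ 2)) = d * c * s * 1 * (T / τ) := by
        rw [hδ]
        field_simp
    _ ≤ d * n * S * L * (T / τ) := by
        gcongr
        exacts [h.c_le_agents, h.one_le_log]

lemma drift_term_le (hδ : δ = D / (c * τ)) (hs₀ : 0 ≤ s) (hs : s ≤ S) :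
    d / δ * D * (s * (T * (√n * δ / τ))) ≤ D * d * L₀ * n * S * L * (T / τ) / ℓ := by
  obtain ⟨hD, hL₀, hd, hn, hc, hS, -, hT, hτ⟩ := h.pos
  have hℓ := h.lower_pos
  have hsqrt : √n ≤ n := Real.sqrt_le_iff.2 ⟨hn.le, le_self_pow₀ h.one_le_agents two_ne_zero⟩
  rw [le_div_iff₀ hℓ]
  calc d / δ * D * (s * (T * (√n * δ / τ))) * ℓ = D * d * ℓ * √n * s * 1 * (T / τ) := by
        rw [hδ]
        field_simp
    _ ≤ D * d * L₀ * n * S * L * (T / τ) := by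
        gcongr
        exacts [h.lower_le_lipschitz, h.one_le_log]

lemma smoothing_term_le (hδ : δ = D / (c * τ)) :
    T * (L₀ * δ) ≤ D * d * L₀ * n * S * L * (T / τ) := by
  obtain ⟨hD, hL₀, hd, hn, hc, hS, -, hT, hτ⟩ := h.pos
  have hcd : 1 / c ≤ d := ((div_le_one hc).2 h.one_le_c).trans h.one_le_dim
  calc T * (L₀ * δ) = D * (1 / c) * L₀ * 1 * 1 * 1 * (T / τ) := by
        rw [hδ]
        field_simp
    _ ≤ D * d * L₀ * n * S * L * (T / τ) := by
        gcongr
        exacts [h.one_le_agents, h.one_le_S, h.one_le_log]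

lemma sum_terms_le (hη : η = D / (d * L₀ * n) / τ ^ 3) (hδ : δ = D / (c * τ)) (hs₀ : 0 ≤ s)
    (hs : s ≤ S) (hU : 0 < U) (hC₀ : 0 ≤ C₀) (hρ : 0 ≤ ρ) (hκ : 0 ≤ κ) :
    D ^ 2 / η + η * T * (d / δ * (3 * U)) ^ 2 + d / δ * (3 * U) * D * (2 * √T * L) +
      d / δ * D * (s * (2 * (2 * U * (2 * √T * L) + 2 / √b * (T / τ ^ 2)) +
        2 * T * (1 / (U ^ 2 * τ) * (2 * U * (C₀ * (√n * (κ * δ))))))) +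
      T * ((3 + ρ) * (L₀ * δ)) ≤
    (1 + 9 * U ^ 2 / ℓ ^ 4 + 6 * U / ℓ ^ 2 + (8 * U + 4 / √b) / ℓ ^ 2 + 4 * C₀ * κ / (U * ℓ) +
      (3 + ρ)) * (D * d * L₀ * n * S * L * (T / τ)) := by
  have hℓ := h.lower_pos
  set R := D * d * L₀ * n * S * L * (T / τ)
  calc _ = D ^ 2 / η + 9 * U ^ 2 * (η * T * (d / δ) ^ 2) +
          6 * U * (d / δ * D * (1 * (√T * L))) +
          (8 * U * (d / δ * D * (s * (√T * L))) + 4 / √b * (d / δ * D * (s * (T / τ ^ 2))) +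
            4 * C₀ * κ / U * (d / δ * D * (s * (T * (√n * δ / τ))))) +
          (3 + ρ) * (T * (L₀ * δ)) := by
        field_simp
        ring
    _ ≤ R + 9 * U ^ 2 * (R / ℓ ^ 4) + 6 * U * (R / ℓ ^ 2) +
          (8 * U * (R / ℓ ^ 2) + 4 / √b * (R / ℓ ^ 2) + 4 * C₀ * κ / U * (R / ℓ)) +
          (3 + ρ) * R := by
        gcongr
        exacts [h.sq_div_step_le hη, h.step_mul_sq_le hη hδ,
          h.sqrt_term_le hδ zero_le_one h.one_le_S, h.sqrt_term_le hδ hs₀ hs,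
          h.sampling_term_le hδ hs₀ hs, h.drift_term_le hδ hs₀ hs, h.smoothing_term_le hδ]
    _ = _ := by
        field_simp
        ring

end RateScales

namespace RiskGame

variable {N : ℕ} {G : RiskGame N} {Dx U L₀ C₀ a b ℓ ρ γ : ℝ} {T : ℕ}

lemma inv_level_le_S (hS : G.Standing Dx) (i : Fin N) : (G.α i)⁻¹ ≤ G.S := by
  have hα := hS.level_pos i
  calc (G.α i)⁻¹ ≤ (G.α i)⁻¹ ^ 2 :=
        le_self_pow₀ ((one_le_inv₀ hα).2 (hS.level_le_one i)) two_ne_zero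
    _ = 1 / G.α i ^ 2 := by rw [one_div, inv_pow]
    _ ≤ G.S := Finset.single_le_sum (f := fun k => 1 / G.α k ^ 2) (fun _ _ => by positivity)
        (Finset.mem_univ i)

lemma one_le_S (hS : G.Standing Dx) (i : Fin N) : 1 ≤ G.S :=
  ((one_le_inv₀ (hS.level_pos i)).2 (hS.level_le_one i)).trans (inv_level_le_S hS i)

/-- The constant of the regret bound. The summands up to `3 + ρ` bound the terms of the regret one
by one, the last one takes care of the short horizons, for which `β` or `δ` is too large. -/
def regretConstant (b U C₀ ℓ ρ : ℝ) : ℝ :=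
  1 + 9 * U ^ 2 / ℓ ^ 4 + 6 * U / ℓ ^ 2 + (8 * U + 4 / √b) / ℓ ^ 2 +
    4 * C₀ * (2 + 2 * U / ℓ ^ 2) / (U * ℓ) + (3 + ρ) + 2 * U * (2 / U ^ 2 + ρ) / ℓ ^ 2

lemma regretConstant_pos (hU : 0 < U) (hC₀ : 0 ≤ C₀) (hℓ : 0 < ℓ) (hρ : 0 ≤ ρ) :
    0 < regretConstant b U C₀ ℓ ρ := by
  unfold regretConstant
  positivity

/-- The parameter choice of the algorithm, in terms of the orders of magnitude of `RateScales`: all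
that the regret bound uses about it. -/
structure Tuned (G : RiskGame N) (p : Params N) (T : ℕ) (b U ℓ Dx L₀ c L τ : ℝ) : Prop where
  scales : ∀ i, RateScales ℓ Dx L₀ (G.d i) N c G.S L T τ
  step_eq : ∀ i, p.η i = Dx / (G.d i * L₀ * N) / τ ^ 3
  radius_eq : p.δ = Dx / (c * τ)
  momentum_eq : p.β = 1 / (U ^ 2 * τ)
  sampleSize_pos : ∀ t, 1 ≤ t → t ≤ T → 0 < p.n t
  sum_sampling_le : ∑ t ∈ Finset.range T, U / √(p.n (t + 1)) ≤ 2 / √b * (T / τ ^ 2)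

lemma rateScales (hS : G.Standing Dx) (hℓ : 0 < ℓ) (hL₀ : ℓ ≤ L₀) (hDx : ℓ ≤ Dx) (ha₀ : 0 < a)
    (ha₁ : a < 1) (hT : (8 : ℝ) ≤ T) (hγ : 0 < γ) (hγ1 : γ < 1) (i : Fin N) :
    RateScales ℓ Dx L₀ (G.d i) N ((N : ℝ) ^ (1 / 6 : ℝ)) G.S (Real.log (T / γ)) T
      ((T : ℝ) ^ (a / 4)) where
  lower_pos := hℓ
  lower_le_diam := hDx
  lower_le_lipschitz := hL₀
  one_le_dim := by exact_mod_cast hS.dim_pos i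
  one_le_c := Real.one_le_rpow (by exact_mod_cast i.pos) (by norm_num)
  c_sq_le_agents := by
    rw [← Real.rpow_mul_natCast (by positivity)]
    exact Real.rpow_le_self_of_one_le (by exact_mod_cast i.pos) (by norm_num)
  one_le_S := one_le_S hS i
  one_le_log := one_le_log_horizon hT hγ hγ1
  one_le_τ := Real.one_le_rpow (by linarith) (by linarith)
  τ_sq_le_sqrt := by
    rw [Real.sqrt_eq_rpow, ← Real.rpow_mul_natCast (by positivity)]
    exact Real.rpow_le_rpow_of_exponent_le (by linarith) (by push_cast; linarith)

lemma tuned_tunedParams (hS : G.Standing Dx) (hb : 0 < b) (hU : 0 < U) (hℓ : 0 < ℓ) (hL₀ : ℓ ≤ L₀)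
    (hDx : ℓ ≤ Dx) (ha₀ : 0 < a) (ha₁ : a < 1) (hT : (8 : ℝ) ≤ T) (hγ : 0 < γ) (hγ1 : γ < 1) :
    G.Tuned (tunedParams G.d a b U L₀ Dx T) T b U ℓ Dx L₀ ((N : ℝ) ^ (1 / 6 : ℝ))
      (Real.log (T / γ)) ((T : ℝ) ^ (a / 4)) where
  scales := rateScales hS hℓ hL₀ hDx ha₀ ha₁ hT hγ hγ1
  step_eq i := by
    have hT₀ : (0 : ℝ) ≤ T := by positivity
    simp only [tunedParams, Real.rpow_neg hT₀, ← div_eq_mul_inv, ← Real.rpow_mul_natCast hT₀]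
    congr 2
    push_cast
    ring
  radius_eq := by
    simp only [tunedParams, Real.rpow_neg T.cast_nonneg, ← div_eq_mul_inv, div_div]
  momentum_eq := rfl
  sampleSize_pos _ _ ht := _root_.sampleSize_pos hb hU ht
  sum_sampling_le := by
    have hpow : (T : ℝ) ^ (1 - a / 2) = T / ((T : ℝ) ^ (a / 4)) ^ 2 := by
      rw [Real.rpow_sub (by linarith), Real.rpow_one, ← Real.rpow_mul_natCast (by positivity)]
      congr 2
      push_cast
      ring
    rw [← hpow]
    exact sum_div_sqrt_sampleSize_le ha₀ ha₁ hb hU T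

namespace Tuned

variable {p : Params N} {c L τ : ℝ} (h : G.Tuned p T b U ℓ Dx L₀ c L τ)

include h

lemma admissible (hU : 0 < U) (hN : 0 < N) (hβ : p.β ≤ 1) : p.Admissible T where
  step_pos i := by
    obtain ⟨_, _, _, _, -, -, -, -, _⟩ := (h.scales i).pos
    rw [h.step_eq]
    positivity
  radius_pos := by
    obtain ⟨_, -, -, -, _, -, -, -, _⟩ := (h.scales ⟨0, hN⟩).pos
    rw [h.radius_eq]
    positivity
  momentum_nonneg := by
    obtain ⟨-, -, -, -, -, -, -, -, _⟩ := (h.scales ⟨0, hN⟩).pos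
    rw [h.momentum_eq]
    positivity
  momentum_le_one := hβ
  sampleSize_pos := h.sampleSize_pos

lemma momentum_le_half (hU : 0 < U) (hτ : 2 / U ^ 2 ≤ τ) : p.β ≤ 1 / 2 := by
  rw [div_le_iff₀ (by positivity)] at hτ
  rw [h.momentum_eq]
  exact one_div_le_one_div_of_le two_pos (by linarith)

lemma radius_mul_le (hN : 0 < N) (hρ : ρ ≤ τ) : p.δ * ρ ≤ Dx := by
  have hscales := h.scales ⟨0, hN⟩
  obtain ⟨hDx, -, -, -, hc, -, -, -, hτ⟩ := hscales.pos
  rw [h.radius_eq, div_mul_eq_mul_div, div_le_iff₀ (by positivity)]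
  gcongr
  exact hρ.trans (le_mul_of_one_le_left hτ.le hscales.one_le_c)

variable {x₁ : Profile G.d} {v₀ : Fin N → ℝ} {u : (i : Fin N) → ℕ → Act (G.d i)}
  {ξ : (i : Fin N) → ℕ → ℕ → G.Ξ i}

lemma norm_played_sub_played_le (hS : G.Standing Dx) (hU : 0 ≤ U) (hJ : G.ConvexBounded U)
    (hp : p.Admissible T) (hx₁ : ∀ i, x₁ i ∈ shrink (G.X i) p.δ) (hv₀ : ∀ i, |v₀ i| ≤ U)
    (hu : ∀ i t, ‖u i t‖ = 1) {t : ℕ} (ht : t < T) :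
    ‖G.played p x₁ v₀ u ξ (t + 1 + 1) - G.played p x₁ v₀ u ξ (t + 1)‖ ≤
      √N * ((2 + 2 * U / ℓ ^ 2) * p.δ) := by
  have hδ := hp.radius_pos
  have hstep (i : Fin N) : p.η i * (G.d i / p.δ * (2 * U)) ≤ 2 * U * (p.δ / ℓ ^ 2) :=
    calc p.η i * (G.d i / p.δ * (2 * U)) = 2 * U * (p.η i * (G.d i / p.δ)) := by ring
      _ ≤ 2 * U * (p.δ / ℓ ^ 2) := by
          gcongr
          exact (h.scales i).step_mul_le (h.step_eq i) h.radius_eq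
  exact (RiskGame.norm_played_sub_played_le hS hJ hp hx₁ hv₀ hu (by positivity) hstep ht).trans_eq
    (by ring)

lemma sum_trackingError_le (hS : G.Standing Dx) (hU : 0 ≤ U) (hC₀ : 0 ≤ C₀)
    (hJ : G.ConvexBounded U) (hC : G.LipschitzCDF C₀) (hp : p.Admissible T) (hβ : p.β ≤ 1 / 2)
    (hx₁ : ∀ i, x₁ i ∈ shrink (G.X i) p.δ) (hv₀ : ∀ i, |v₀ i| ≤ U) (hu : ∀ i t, ‖u i t‖ = 1)
    (i : Fin N) {B : ℝ} (hB : ∑ t ∈ Finset.range T, G.errorIncrement U p x₁ v₀ u ξ i t ≤ B) :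
    ∑ t ∈ Finset.range T, G.trackingError p x₁ v₀ u ξ i t ≤
      2 * (B + 2 / √b * (T / τ ^ 2)) +
        2 * T * (1 / (U ^ 2 * τ) * (2 * U * (C₀ * (√N * ((2 + 2 * U / ℓ ^ 2) * p.δ))))) := by
  have hδ := hp.radius_pos
  simp only [errorIncrement, Finset.sum_sub_distrib, sub_le_iff_le_add] at hB
  refine (RiskGame.sum_trackingError_le hS hJ hC₀ hC hp hβ hx₁ hu (by positivity) (fun t ht =>
    h.norm_played_sub_played_le hS hU hJ hp hx₁ hv₀ hu (Nat.lt_of_succ_lt ht)) i).trans ?_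
  rw [h.momentum_eq]
  gcongr
  exact hB.trans (by gcongr; exact h.sum_sampling_le)

lemma regret_le (hS : G.Standing Dx) (hU : 0 < U) (hC₀ : 0 ≤ C₀) (hρ : 0 < ρ)
    (hτ : 2 / U ^ 2 + ρ ≤ τ) (hJ : G.ConvexBounded U) (hL : G.LipschitzCost L₀)
    (hC : G.LipschitzCDF C₀) (hp : p.Admissible T) (hx₁ : ∀ i, x₁ i ∈ shrink (G.X i) p.δ)
    (hv₀ : ∀ i, |v₀ i| ≤ U) (hu : ∀ i t, ‖u i t‖ = 1) (i : Fin N)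
    (hball : ∃ c, Metric.closedBall c (Dx / ρ) ⊆ G.X i)
    (hnoise : ∑ t ∈ Finset.range T, G.noiseIncrement p x₁ v₀ u ξ i t ≤
      G.d i / p.δ * (3 * U) * Dx * (2 * √T * L))
    (herror : ∑ t ∈ Finset.range T, G.errorIncrement U p x₁ v₀ u ξ i t ≤
      2 * U * (2 * √T * L)) :
    G.regret i T (G.played p x₁ v₀ u ξ) ≤
      regretConstant b U C₀ ℓ ρ * (Dx * G.d i * L₀ * N * G.S * L * (T / τ)) := by
  obtain ⟨hDx, hL₀, hd, _, _, _, _, _, _⟩ := (h.scales i).pos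
  have hα := inv_nonneg.2 (hS.level_pos i).le
  have hδ := hp.radius_pos
  have hβ : p.β ≤ 1 / 2 := h.momentum_le_half hU ((le_add_of_nonneg_right hρ.le).trans hτ)
  have hδρ : p.δ * ρ ≤ Dx :=
    h.radius_mul_le i.pos ((le_add_of_nonneg_left (by positivity)).trans hτ)
  have htracking := h.sum_trackingError_le hS hU.le hC₀ hJ hC hp hβ hx₁ hv₀ hu i herror
  have hterms := (h.scales i).sum_terms_le (b := b) (h.step_eq i) h.radius_eq hα
    (inv_level_le_S hS i) hU hC₀ hρ.le (κ := 2 + 2 * U / ℓ ^ 2) (by positivity)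
  calc G.regret i T (G.played p x₁ v₀ u ξ) ≤ _ :=
        RiskGame.regret_le hS hJ hL₀.le hL hp hx₁ hv₀ hu hρ hδρ i hball
    _ ≤ _ := by gcongr
    _ ≤ _ := hterms
    _ ≤ regretConstant b U C₀ ℓ ρ * (Dx * G.d i * L₀ * N * G.S * L * (T / τ)) := by
        gcongr
        exact le_add_of_nonneg_right (by positivity)

lemma regret_le_of_short_horizon (hS : G.Standing Dx) (hU : 0 < U) (hC₀ : 0 ≤ C₀) (hρ : 0 ≤ ρ)
    (hτ : τ ≤ 2 / U ^ 2 + ρ) (hJ : G.ConvexBounded U) (hx₁ : ∀ i, x₁ i ∈ shrink (G.X i) p.δ)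
    (hu : ∀ i t, ‖u i t‖ = 1) (i : Fin N) :
    G.regret i T (G.played p x₁ v₀ u ξ) ≤
      regretConstant b U C₀ ℓ ρ * (Dx * G.d i * L₀ * N * G.S * L * (T / τ)) := by
  obtain ⟨_, _, _, _, _, _, _, _, _⟩ := (h.scales i).pos
  have hℓ := (h.scales i).lower_pos
  have hδ : 0 ≤ p.δ := by
    rw [h.radius_eq]
    positivity
  calc G.regret i T (G.played p x₁ v₀ u ξ) ≤ 2 * U * T := regret_le_two_mul hS hJ hδ hx₁ hu i
    _ ≤ 2 * U * (τ * (Dx * G.d i * L₀ * N * G.S * L * (T / τ) / ℓ ^ 2)) := by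
        gcongr
        exact (h.scales i).le_τ_mul_rate
    _ ≤ 2 * U * ((2 / U ^ 2 + ρ) * (Dx * G.d i * L₀ * N * G.S * L * (T / τ) / ℓ ^ 2)) := by
        gcongr
    _ = 2 * U * (2 / U ^ 2 + ρ) / ℓ ^ 2 * (Dx * G.d i * L₀ * N * G.S * L * (T / τ)) := by ring
    _ ≤ regretConstant b U C₀ ℓ ρ * (Dx * G.d i * L₀ * N * G.S * L * (T / τ)) := by
        gcongr
        exact le_add_of_nonneg_left (by positivity)

end Tuned

lemma measure_not_forall_regret_le {Ω : Type*} [MeasurableSpace Ω] {μ : Measure Ω}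
    [IsProbabilityMeasure μ] {p : Params N} {c τ : ℝ} {x₁ : Profile G.d} {v₀ : Fin N → ℝ}
    {u : Ω → (i : Fin N) → ℕ → Act (G.d i)} {ξ : Ω → (i : Fin N) → ℕ → ℕ → G.Ξ i}
    (h : G.Tuned p T b U ℓ Dx L₀ c (Real.log (T / γ)) τ) (hS : G.Standing Dx)
    (hU : 0 < U) (hC₀ : 0 ≤ C₀) (hρ : 0 < ρ)
    (hball : ∀ i, ∃ c, Metric.closedBall c (Dx / ρ) ⊆ G.X i) (hJ : G.ConvexBounded U)
    (hL : G.LipschitzCost L₀) (hC : G.LipschitzCDF C₀) (hN : 0 < N)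
    (hT : 8 * (N : ℝ) ^ (2 / 3 : ℝ) ≤ T) (hγ : 0 < γ) (hγ1 : γ < 1)
    (hx₁ : ∀ i, x₁ i ∈ shrink (G.X i) p.δ) (hv₀ : ∀ i, |v₀ i| ≤ U)
    (hs : G.IsSampling μ (fun i t ω => u ω i t) fun i t j ω => ξ ω i t j)
    (hu : ∀ ω i t, ‖u ω i t‖ = 1) :
    μ {ω | ¬ ∀ i, G.regret i T (G.played p x₁ v₀ (u ω) (ξ ω)) ≤ regretConstant b U C₀ ℓ ρ *
      (Dx * G.d i * L₀ * N * G.S * Real.log (T / γ) * (T / τ))} ≤ ENNReal.ofReal γ := by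
  obtain ⟨hDx, -, -, -, -, -, -, hT₀, -⟩ := (h.scales ⟨0, hN⟩).pos
  rcases le_total τ (2 / U ^ 2 + ρ) with hshort | hlong
  · simp [fun ω i => h.regret_le_of_short_horizon (v₀ := v₀) (ξ := ξ ω) hS hU hC₀ hρ.le hshort hJ
      hx₁ (hu ω) i]
  have hβ := h.momentum_le_half hU ((le_add_of_nonneg_right hρ.le).trans hlong)
  have hp := h.admissible hU hN (hβ.trans one_half_lt_one.le)
  have hδ := hp.radius_pos
  have hroot := sqrt_log_union_bound_le hN hT hγ hγ1
  refine (measure_mono fun ω hω => mt (fun hgood i => ?_) hω).trans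
    (measure_not_forall_sum_increments_le hS hDx hU hJ hL hp (by exact_mod_cast hT₀) hx₁ hv₀ hs hu
      hN hγ hγ1)
  exact h.regret_le hS hU hC₀ hρ hlong hJ hL hC hp hx₁ hv₀ (hu ω) i (hball i)
    ((hgood i).1.trans (by gcongr)) ((hgood i).2.trans (by gcongr))

end RiskGame

end

theorem theorem1 (a b U C₀ ℓ ρ : ℝ) (ha₀ : 0 < a) (ha₁ : a < 1) (hb : 0 < b) (hU : 0 < U)
    (hC₀ : 0 < C₀) (hℓ : 0 < ℓ) (hρ : 0 < ρ) :
    ∃ K : ℝ, 0 < K ∧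
      ∀ (L₀ Dx : ℝ), ℓ ≤ L₀ → ℓ ≤ Dx →
      ∀ (N : ℕ) (G : RiskGame N),
        G.Standing Dx →
        (∀ i, ∃ c, Metric.closedBall c (Dx / ρ) ⊆ G.X i) →
        G.ConvexBounded U → G.LipschitzCost L₀ → G.LipschitzCDF C₀ →
      ∀ (T : ℕ), (8 * (N : ℝ) ^ (2 / 3 : ℝ)) ^ (1 / a) ≤ (T : ℝ) →
      ∀ (γ : ℝ), 0 < γ → γ < 1 →
      ∀ (x₁ : Profile G.d),
        (∀ i, x₁ i ∈ shrink (G.X i) (tunedParams G.d a b U L₀ Dx T).δ) →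
      ∀ (v₀ : Fin N → ℝ), (∀ i, |v₀ i| ≤ U) →
      ∀ (Ω : Type*) [MeasurableSpace Ω] (μ : Measure Ω) [IsProbabilityMeasure μ]
        (u : (i : Fin N) → ℕ → Ω → Act (G.d i)) (ξ : (i : Fin N) → ℕ → ℕ → Ω → G.Ξ i),
        G.IsSampling μ u ξ →
        μ {ω | ¬ ∀ i,
            G.regret i T (G.played (tunedParams G.d a b U L₀ Dx T) x₁ v₀
              (fun i t => u i t ω) (fun i t j => ξ i t j ω)) ≤
            K * (Dx * G.d i * L₀ * N * G.S * Real.log (T / γ) * (T : ℝ) ^ (1 - a / 4))}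
          ≤ ENNReal.ofReal γ := by
  refine ⟨RiskGame.regretConstant b U C₀ ℓ ρ,
    RiskGame.regretConstant_pos hU hC₀.le hℓ hρ.le, ?_⟩
  intro L₀ Dx hL₀ hDx N G hS hball hJ hL hC T hT γ hγ hγ1 x₁ hx₁ v₀ hv₀ Ω _ μ _ u ξ hs
  rcases N.eq_zero_or_pos with rfl | hN
  · simp
  have hT_ge := eight_mul_rpow_le_horizon ha₀ ha₁ hN hT
  have hT8 := eight_le_horizon hN hT_ge
  have htuned := RiskGame.tuned_tunedParams hS hb hU hℓ hL₀ hDx ha₀ ha₁ hT8 hγ hγ1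
  have hunit (i : Fin N) : ∃ e : Act (G.d i), ‖e‖ = 1 :=
    have := RiskGame.nontrivial_act i hS
    exists_norm_eq (Act (G.d i)) zero_le_one
  choose e he using hunit
  have hbound := RiskGame.measure_not_forall_regret_le (ξ := fun ω i t j => ξ i t j ω) htuned hS hU
    hC₀.le hρ hball hJ hL hC hN hT_ge hγ hγ1 hx₁ hv₀ (hs.toUnit e)
    fun ω i t => RiskGame.norm_toUnit (he i) (u i t ω)
  have hpow : (T : ℝ) / (T : ℝ) ^ (a / 4) = (T : ℝ) ^ (1 - a / 4) := by
    rw [Real.rpow_sub (by linarith), Real.rpow_one]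
  rw [hpow] at hbound
  refine (measure_mono_ae ?_).trans hbound
  filter_upwards [hs.ae_norm_eq_one] with ω hω
  refine mt fun hbounded i => ?_
  simpa only [RiskGame.toUnit_of_norm_eq_one (hω _ _)] using hbounded i
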